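/- Fix two sets of channels (classical and quantum), countably many classical variables (ranging over $\mathbb R$), countably many quantum variables (each naming a qubit), and a set of process constants, each with a defining equation. The terms of qCCS are $$P ::= \mathbf{nil} \mid \tau.P \mid c?x.P \mid c!e.P \mid \mathsf c?q.P \mid \mathsf c!q.P \mid \mathcal E[\tilde q].P \mid M[\tilde q;x].P \mid P+P \mid P\,\|\,P \mid P[f] \mid P\backslash L \mid \mathbf{if}\ b\ \mathbf{then}\ P \mid A(\tilde q;\tilde e),$$ with $\mathcal E$ a trace-preserving super-operator, $M$ a non-degenerate projective measurement (whose outcome is bound to $x$), $f$ a relabelling and $L$ a set of channels. The sets $qv(P)$ and $fv(P)$ of free quantum and free classical variables are as usual, with $qv(\mathsf c?q.P)=qv(P)\setminus\{q\}$ and $qv(A(\tilde q;\tilde e))=\tilde q$. A term is legal if $q\notin qv(P)$ in every $\mathsf c!q.P$, $qv(P)\cap qv(Q)=\emptyset$ in every $P\,\|\,Q$, and constants are applied to the right numbers of parameters, the quantum ones distinct; a defining equation $A(\tilde q;\tilde x):=P$ must have $P$ legal, $qv(P)\subseteq\tilde q$ and $fv(P)\subseteq\tilde x$. The state space $\mathcal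 H$ is the (separable) tensor product of all the qubits. A configuration is a pair $\langle P,\rho\rangle$ of a closed legal term ($fv(P)=\emptyset$) and a density operator $\rho$ on $\mathcal H$. Configurations form a probabilistic labelled transition system: the transition rules are those of value-passing CCS, early style, where also $\mathsf c?q.P$ inputs any $r\notin qv(\mathsf c?q.P)$ with continuation $P[r/q]$, $\mathsf c!q.P$ outputs $q$, in $P\,\|\,Q$ neither component may alone input a quantum variable that is free in the other one, $\langle\mathcal E[\tilde q].P,\rho\rangle\xrightarrow{\tau}\langle P,\mathcal E_{\tilde q}(\rho)\rangle$, and $\langle M[\tilde q;x].P,\rho\rangle\xrightarrow{\tau}\sum_i p_i\,\langle P[\lambda_i/x],E^i_{\tilde q}\rho E^i_{\tilde q}/p_i\rangle$ for $M=\sum_i\lambda_iE^i$ and $p_i=\mathrm{tr}(E^i_{\tilde q}\rho)$. The lifting of a relation between states and distributions is the smallest relation between distributions that contains it (a state $s$ being identified with the point distribution $\overline s$) and is closed under finite convex combinations; a relation $\mathcal R$ between states is lifted to $\mathcal R^\dagger$ by regarding it as $\{(s,\overline t): s\,\mathcal R\,t\}$. Write $\stackrel{\hat\tau}{\Rightarrow}$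 for the reflexive and transitive closure of the lifting of "$s\xrightarrow{\tau}\Delta$ or $\Delta=\overline s$", and $\stackrel{\hat\alpha}{\Rightarrow}$ for $\stackrel{\hat\tau}{\Rightarrow}\xrightarrow{\alpha}\stackrel{\hat\tau}{\Rightarrow}$ if $\alpha\ne\tau$, with $\xrightarrow{\alpha}$ lifted. A relation $\mathcal R$ on configurations is an open simulation if $\langle P,\rho\rangle\,\mathcal R\,\langle Q,\sigma\rangle$ implies that $qv(P)=qv(Q)$, that $\mathrm{tr}_{qv(P)}(\rho)=\mathrm{tr}_{qv(P)}(\sigma)$, and that for every trace-preserving super-operator $\mathcal E$ on the qubits outside $qv(P)$, whenever $\langle P,\mathcal E(\rho)\rangle\xrightarrow{\alpha}\Delta$ there is $\Theta$ with $\langle Q,\mathcal E(\sigma)\rangle\stackrel{\hat\alpha}{\Rightarrow}\Theta$ and $\Delta\,\mathcal R^\dagger\,\Theta$. Open bisimilarity $\approx_o$ of configurations is the largest $\mathcal R$ such that $\mathcal R$ and $\mathcal R^{-1}$ are open simulations. For legal terms, $P\approx_oQ$ means that $\langle P\{\tilde v/\tilde x\},\rho\rangle\approx_o\langle Q\{\tilde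 v/\tilde x\},\rho\rangle$ for all density operators $\rho$ on $\mathcal H$ and all values $\tilde v$ of the free classical variables $\tilde x$. **Theorem.** The relation $\approx_o$ between processes is preserved by all the constructors of qCCS except for summation. That is: 1. If $P$, $Q$ are legal and $P\approx_oQ$, then $\tau.P\approx_o\tau.Q$, $c?x.P\approx_oc?x.Q$, $c!e.P\approx_oc!e.Q$, $\mathsf c?q.P\approx_o\mathsf c?q.Q$, $\mathsf c!q.P\approx_o\mathsf c!q.Q$, $\mathcal E[\tilde q].P\approx_o\mathcal E[\tilde q].Q$, $M[\tilde q;x].P\approx_oM[\tilde q;x].Q$, $P\,\|\,R\approx_oQ\,\|\,R$, $R\,\|\,P\approx_oR\,\|\,Q$, $P[f]\approx_oQ[f]$, $P\backslash L\approx_oQ\backslash L$ and $\mathbf{if}\ b\ \mathbf{then}\ P\approx_o\mathbf{if}\ b\ \mathbf{then}\ Q$, whenever the terms in question are legal. 2. (Recursion) Let $A_i$, $B_i$ ($i\in I$) be process constants with $A_i(\tilde q_i;\tilde x_i):=E_i\{\tilde A/\tilde X\}$ and $B_i(\tilde q_i;\tilde x_i):=F_i\{\tilde B/\tilde X\}$,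 where $E_i$, $F_i$ are process expressions in process variables $X_j$ ($j\in I$), none of which occurs within a summand, and where $qv(E_i)=\tilde q_i$. If $E_i\{\tilde C/\tilde X\}\approx_oF_i\{\tilde C/\tilde X\}$ for all $i$ and all families $\tilde C$ of constants with the same numbers of parameters as $\tilde A$, then $A_i(\tilde r;\tilde e)\approx_oB_i(\tilde r;\tilde e)$ for all $i$, all $\tilde r$ and all $\tilde e$ for which these terms are legal. In particular, constants with bisimilar bodies, in which all the formal quantum parameters are free, are bisimilar. 3. (Exception) There are legal $P,Q,R$ with $P\approx_oQ$ but $P+R\not\approx_oQ+R$. -/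

import Mathlib

open scoped ENNReal InnerProductSpace

namespace QCCS
noncomputable section

/-- The Hilbert space `ℓ²(ι)`, with orthonormal basis indexed by `ι`. -/
abbrev Ell (ι : Type*) := lp (fun _ : ι => ℂ) 2

section Hilbert
variable {ι κ : Type*}

open Classical in
/-- The basis vector `|i⟩`. -/
def basis (i : ι) : Ell ι := lp.single 2 i (1 : ℂ)

open Classical in
theorem basis_inner (i : ι) (x : Ell ι) : ⟪basis i, x⟫_ℂ = x i := by
  unfold basis
  rw [lp.inner_single_left]; simp

theorem norm_basis (i : ι) : ‖basis i‖ = 1 := by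
  classical
  unfold basis
  rw [lp.norm_single (by norm_num)]; simp

theorem basis_orthonormal : Orthonormal ℂ (basis : ι → Ell ι) := by
  classical
  rw [orthonormal_iff_ite]
  intro i j
  rw [basis_inner]
  unfold basis
  simp [lp.single_apply, Pi.single_apply]

/-- The isometry `|i⟩ ↦ |f i⟩` induced by an injection of the index sets. -/
def basisMap (f : ι ↪ κ) : Ell ι →ₗᵢ[ℂ] Ell κ :=
  (basis_orthonormal.comp f f.injective).orthogonalFamily.linearIsometry

theorem basisMap_basis (f : ι ↪ κ) (i : ι) : basisMap f (basis i) = basis (f i) := by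
  classical
  unfold basisMap
  conv_lhs => rw [basis]
  rw [OrthogonalFamily.linearIsometry_apply_single]
  simp

theorem ext_basis {F : Type*} [NormedAddCommGroup F] [NormedSpace ℂ F] {A B : Ell ι →L[ℂ] F}
    (h : ∀ i, A (basis i) = B (basis i)) : A = B := by
  classical
  refine lp.ext_continuousLinearMap (ENNReal.ofNat_ne_top (n := nat_lit 2)) fun i => ?_
  ext
  simpa [basis] using h i

/-- Parseval's identity. -/
theorem parseval (x : Ell ι) : ∑' i, ‖⟪basis i, x⟫_ℂ‖ₑ ^ 2 = ‖x‖ₑ ^ 2 := by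
  have h := lp.hasSum_norm (p := 2) (by norm_num) x
  simp only [ENNReal.toReal_ofNat, Real.rpow_ofNat] at h
  have h2 : ∀ y : ℝ, 0 ≤ y → ENNReal.ofReal (y ^ 2) = (ENNReal.ofReal y) ^ 2 := fun y hy =>
    ENNReal.ofReal_pow hy 2
  simp only [basis_inner, ← ofReal_norm, ← h2 _ (norm_nonneg _)]
  rw [← h.tsum_eq, ENNReal.ofReal_tsum_of_nonneg (fun _ => by positivity) h.summable]

theorem hs_adjoint (A : Ell ι →L[ℂ] Ell κ) :
    ∑' j, ‖A.adjoint (basis j)‖ₑ ^ 2 = ∑' i, ‖A (basis i)‖ₑ ^ 2 := by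
  simp_rw [← parseval]
  rw [ENNReal.tsum_comm]
  congr! 4 with i j
  rw [ContinuousLinearMap.adjoint_inner_right, ← ofReal_norm, norm_inner_symm, ofReal_norm]

theorem enorm_le_hs (A : Ell ι →L[ℂ] Ell κ) (x : Ell ι) :
    ‖A x‖ₑ ^ 2 ≤ (∑' i, ‖A (basis i)‖ₑ ^ 2) * ‖x‖ₑ ^ 2 := by
  rw [← hs_adjoint, ← parseval, ← ENNReal.tsum_mul_right]
  refine ENNReal.tsum_le_tsum fun j => ?_
  rw [← mul_pow]
  gcongr
  rw [← ContinuousLinearMap.adjoint_inner_left, ← ofReal_norm, ← ofReal_norm, ← ofReal_norm,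
    ← ENNReal.ofReal_mul (norm_nonneg _)]
  exact ENNReal.ofReal_le_ofReal (norm_inner_le_norm _ _)

theorem norm_sq_le_hs (A : Ell ι →L[ℂ] Ell κ) (h : ∑' i, ‖A (basis i)‖ₑ ^ 2 ≠ ∞) :
    ‖A‖ ^ 2 ≤ (∑' i, ‖A (basis i)‖ₑ ^ 2).toReal := by
  rw [← Real.le_sqrt (norm_nonneg _) ENNReal.toReal_nonneg]
  refine A.opNorm_le_bound (Real.sqrt_nonneg _) fun x => ?_
  refine abs_le_of_sq_le_sq' ?_ (by positivity) |>.2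
  rw [mul_pow, Real.sq_sqrt ENNReal.toReal_nonneg]
  have := ENNReal.toReal_mono (ENNReal.mul_ne_top h (by simp)) (enorm_le_hs A x)
  simpa using this

theorem hasSum_of_ofReal {g : ι → ℝ} (hg : ∀ i, 0 ≤ g i) {c : ℝ} (hc : 0 ≤ c)
    (h : ∑' i, ENNReal.ofReal (g i) = ENNReal.ofReal c) : HasSum g c := by
  have hs : Summable g := by
    have := ENNReal.summable_toReal (f := fun i => ENNReal.ofReal (g i)) (by rw [h]; simp)
    simpa [ENNReal.toReal_ofReal, hg] using this
  have := ENNReal.ofReal_tsum_of_nonneg hg hs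
  rw [h, ENNReal.ofReal_eq_ofReal_iff (tsum_nonneg hg) hc] at this
  exact this ▸ hs.hasSum

theorem inner_self_adjoint (A : Ell ι →L[ℂ] Ell κ) (x : Ell κ) :
    ⟪x, (A ∘L A.adjoint) x⟫_ℂ = ((‖A.adjoint x‖ ^ 2 : ℝ) : ℂ) := by
  rw [ContinuousLinearMap.comp_apply, ← ContinuousLinearMap.adjoint_inner_left,
    inner_self_eq_norm_sq_to_K]
  simp

theorem ofReal_norm_sq {F : Type*} [NormedAddCommGroup F] (x : F) :
    ENNReal.ofReal (‖x‖ ^ 2) = ‖x‖ₑ ^ 2 := by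
  rw [ENNReal.ofReal_pow (norm_nonneg _), ofReal_norm]

/-- A density operator on `ℓ²(ι)`: a positive operator of trace one. -/
@[ext] structure Density (ι : Type*) where
  op : Ell ι →L[ℂ] Ell ι
  pos : op.IsPositive
  trace_one : HasSum (fun i => ⟪basis i, op (basis i)⟫_ℂ) 1

theorem exists_sqrt_of_pos {E : Type*} [NormedAddCommGroup E] [InnerProductSpace ℂ E]
    [CompleteSpace E] (T : E →L[ℂ] E) (h : T.IsPositive) :
    ∃ r : E →L[ℂ] E, T = r ∘L r.adjoint := by
  have h0 : 0 ≤ T := T.nonneg_iff_isPositive.2 h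
  have hr : (CFC.sqrt T).adjoint = CFC.sqrt T := (CFC.sqrt_nonneg T).isSelfAdjoint
  exact ⟨CFC.sqrt T, by rw [hr]; exact (CFC.sqrt_mul_sqrt_self T h0).symm⟩

/-- A density operator is `r ∘ r†` with `r` Hilbert-Schmidt of norm one. -/
theorem Density.exists_sqrt (ρ : Density ι) : ∃ r : Ell ι →L[ℂ] Ell ι,
    ρ.op = r ∘L r.adjoint ∧ ∑' i, ‖r (basis i)‖ₑ ^ 2 = 1 := by
  obtain ⟨r, e⟩ := exists_sqrt_of_pos ρ.op ρ.pos
  refine ⟨r, e, ?_⟩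
  have h := ρ.trace_one
  rw [e] at h
  simp only [inner_self_adjoint] at h
  have h' : HasSum (fun i => ‖r.adjoint (basis i)‖ ^ 2) (1 : ℝ) := by
    simpa only [Complex.reCLM_apply, Complex.ofReal_re, Complex.one_re] using
      h.mapL Complex.reCLM
  rw [← hs_adjoint]
  simp only [← ofReal_norm_sq]
  rw [← ENNReal.ofReal_tsum_of_nonneg (fun _ => by positivity) h'.summable, h'.tsum_eq]
  simp

/-- A family of operators with `∑ k, (A k)† (A k) = I`: the Kraus operators of a
trace-preserving super-operator. -/
def IsKraus {τ : Type*} (A : τ → Ell ι →L[ℂ] Ell ι) : Prop :=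
  ∀ ψ, HasSum (fun k => ‖A k ψ‖ ^ 2) (‖ψ‖ ^ 2)

section kraus
variable {τ : Type*} {A : τ → Ell ι →L[ℂ] Ell ι}

theorem IsKraus.hs (hA : IsKraus A) {r : Ell ι →L[ℂ] Ell ι}
    (hr : ∑' i, ‖r (basis i)‖ₑ ^ 2 = 1) :
    ∑' k, ∑' i, ‖(A k ∘L r) (basis i)‖ₑ ^ 2 = 1 := by
  rw [ENNReal.tsum_comm, ← hr]
  congr! 2 with i
  simp only [← ofReal_norm_sq, ContinuousLinearMap.comp_apply]
  rw [← ENNReal.ofReal_tsum_of_nonneg (fun _ => by positivity) (hA _).summable, (hA _).tsum_eq]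

theorem conj_eq (B r : Ell ι →L[ℂ] Ell ι) :
    B ∘L (r ∘L r.adjoint) ∘L B.adjoint = (B ∘L r) ∘L (B ∘L r).adjoint := by
  rw [ContinuousLinearMap.adjoint_comp]; rfl

/-- The sum `∑ k, (A k) ρ (A k)†` converges absolutely. -/
theorem IsKraus.summable (hA : IsKraus A) (ρ : Density ι) :
    Summable fun k => A k ∘L ρ.op ∘L (A k).adjoint := by
  obtain ⟨r, e, hr⟩ := ρ.exists_sqrt
  have hh := hA.hs hr
  have hk : ∀ k, ∑' i, ‖(A k ∘L r) (basis i)‖ₑ ^ 2 ≠ ∞ := fun k =>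
    ne_top_of_le_ne_top (by simp) ((ENNReal.le_tsum k).trans hh.le)
  refine Summable.of_norm_bounded
    (g := fun k => (∑' i, ‖(A k ∘L r) (basis i)‖ₑ ^ 2).toReal)
    (ENNReal.summable_toReal (by rw [hh]; simp)) fun k => ?_
  rw [e, conj_eq]
  refine le_trans ?_ (norm_sq_le_hs _ (hk k))
  refine (ContinuousLinearMap.opNorm_comp_le _ _).trans ?_
  rw [LinearIsometryEquiv.norm_map, sq]

theorem IsKraus.hasSum_inner (hA : IsKraus A) (ρ : Density ι) {r : Ell ι →L[ℂ] Ell ι}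
    (e : ρ.op = r ∘L r.adjoint) (x : Ell ι) :
    HasSum (fun k => ((‖(A k ∘L r).adjoint x‖ ^ 2 : ℝ) : ℂ))
      ⟪x, (∑' k, A k ∘L ρ.op ∘L (A k).adjoint) x⟫_ℂ := by
  have h1 := (((hA.summable ρ).hasSum).mapL
    (ContinuousLinearMap.apply ℂ (Ell ι) x)).mapL (innerSL ℂ x)
  have h3 : ∀ k, innerSL ℂ x (ContinuousLinearMap.apply ℂ (Ell ι) x
      (A k ∘L ρ.op ∘L (A k).adjoint)) = ((‖(A k ∘L r).adjoint x‖ ^ 2 : ℝ) : ℂ) := by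
    intro k
    rw [e, conj_eq]
    exact inner_self_adjoint (A k ∘L r) x
  simp only [h3] at h1
  exact h1

/-- The action `ρ ↦ ∑ k, (A k) ρ (A k)†` on states of the trace-preserving super-operator with
Kraus operators `A k`. -/
def IsKraus.apply (hA : IsKraus A) (ρ : Density ι) : Density ι where
  op := ∑' k, A k ∘L ρ.op ∘L (A k).adjoint
  pos := by
    obtain ⟨r, e, -⟩ := ρ.exists_sqrt
    rw [ContinuousLinearMap.isPositive_iff_complex]
    intro x
    have h := (hA.hasSum_inner ρ e x)
    have h' := h.mapL Complex.reCLM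
    simp only [Complex.reCLM_apply, Complex.ofReal_re] at h'
    have h'' := (h'.mapL Complex.ofRealCLM).unique h
    simp only [Complex.ofRealCLM_apply] at h''
    rw [← inner_conj_symm, ← h'']
    simpa using h'.nonneg (fun k => by positivity)
  trace_one := by
    obtain ⟨r, e, hr⟩ := ρ.exists_sqrt
    have h := fun i : ι => (hA.hasSum_inner ρ e (basis i))
    have h' := fun i : ι => (h i).mapL Complex.reCLM
    simp only [Complex.reCLM_apply, Complex.ofReal_re] at h'
    have h'' := fun i : ι => ((h' i).mapL Complex.ofRealCLM).unique (h i)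
    simp only [Complex.ofRealCLM_apply] at h''
    rw [← funext h'']
    have hg := hasSum_of_ofReal (fun i => (h' i).nonneg (fun k => by positivity)) zero_le_one (by
      have h4 : ∀ i, ENNReal.ofReal (⟪basis i, (∑' k, A k ∘L ρ.op ∘L (A k).adjoint)
          (basis i)⟫_ℂ).re = ∑' k, ‖(A k ∘L r).adjoint (basis i)‖ₑ ^ 2 := by
        intro i
        rw [← (h' i).tsum_eq,
          ENNReal.ofReal_tsum_of_nonneg (fun _ => by positivity) (h' i).summable]
        simp only [ofReal_norm_sq]
      simp only [h4]
      rw [ENNReal.tsum_comm]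
      simp only [hs_adjoint]
      rw [hA.hs hr]; simp)
    simpa only [Complex.ofRealCLM_apply, Complex.ofReal_one] using hg.mapL Complex.ofRealCLM
/-- Selecting one of the Kraus operators: the probabilities and the normalised states. -/
theorem IsKraus.exists_select (hA : IsKraus A) (ρ : Density ι) :
    ∃ (p : PMF τ) (σ : τ → Density ι), ∀ k,
      ((p k).toReal : ℂ) • (σ k).op = A k ∘L ρ.op ∘L (A k).adjoint := by
  classical
  obtain ⟨r, e, hr⟩ := ρ.exists_sqrt
  have hh := hA.hs hr
  set w : τ → ℝ≥0∞ := fun k => ∑' i, ‖(A k ∘L r) (basis i)‖ₑ ^ 2 with hw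
  have hfin : ∀ k, w k ≠ ∞ := fun k =>
    ne_top_of_le_ne_top (by simp) ((ENNReal.le_tsum k).trans hh.le)
  have hs : ∀ k, ∃ σ : Density ι,
      ((w k).toReal : ℂ) • σ.op = A k ∘L ρ.op ∘L (A k).adjoint := by
    intro k
    by_cases h0 : w k = 0
    · refine ⟨ρ, ?_⟩
      have h1 := norm_sq_le_hs _ (hfin k)
      change _ ≤ (w k).toReal at h1
      rw [h0, ENNReal.toReal_zero] at h1
      have h2 : A k ∘L r = 0 := by
        rw [← norm_eq_zero]; exact pow_eq_zero_iff (two_ne_zero) |>.1 (le_antisymm h1 (by positivity))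
      rw [e, conj_eq, h2, h0]
      simp
    · have hpos : 0 < (w k).toReal := ENNReal.toReal_pos h0 (hfin k)
      refine ⟨⟨(((w k).toReal⁻¹ : ℝ) : ℂ) • (A k ∘L ρ.op ∘L (A k).adjoint), ?_, ?_⟩, ?_⟩
      · exact (ρ.pos.conj_adjoint (A k)).smul_of_nonneg (by
          rw [Complex.zero_le_real]; positivity)
      · rw [e, conj_eq]
        have h3 : HasSum (fun i => ‖(A k ∘L r).adjoint (basis i)‖ ^ 2) (w k).toReal := by
          refine hasSum_of_ofReal (fun _ => by positivity) ENNReal.toReal_nonneg ?_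
          simp only [ofReal_norm_sq]
          rw [hs_adjoint, ENNReal.ofReal_toReal (hfin k)]
        have h4 := (h3.mul_left (w k).toReal⁻¹).mapL Complex.ofRealCLM
        rw [inv_mul_cancel₀ hpos.ne'] at h4
        simp only [Complex.ofRealCLM_apply, Complex.ofReal_one] at h4
        convert h4 using 2 with i
        rw [_root_.smul_apply, inner_smul_right, inner_self_adjoint]
        push_cast; rfl
      · rw [smul_smul, ← Complex.ofReal_mul, mul_inv_cancel₀ hpos.ne']
        simp
  choose σ hσ using hs
  exact ⟨⟨w, hh ▸ ENNReal.summable.hasSum⟩, σ, hσ⟩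
end kraus
end Hilbert

section Qubits

/-- Quantum variables; each one names a qubit. -/
abbrev QVar := ℕ

/-- The state space of all the qubits. The basis state `|u⟩`, for a finite set `u` of quantum
variables, has the qubits of `u` in state `|1⟩` and all the other ones in state `|0⟩`. -/
abbrev Env := Ell (Finset QVar)

/-- The state space of the qubits that are not in `S`. -/
abbrev Rest (S : Finset QVar) := Ell {u : Finset QVar // Disjoint u S}

/-- States of the whole environment. -/
abbrev QState := Density (Finset QVar)

/-- For `a ⊆ S` the isometry `ψ ↦ |a⟩ ⊗ ψ`, where `|a⟩` is the basis state of the qubits in `S`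
that has exactly the qubits in `a` in state `|1⟩`. -/
def ket (S a : Finset QVar) : Rest S →L[ℂ] Env :=
  (basisMap (⟨fun u => u.1 ∪ (a ∩ S), by
    rintro ⟨u, hu⟩ ⟨v, hv⟩ h
    simp only [Subtype.mk.injEq]
    rw [Finset.disjoint_left] at hu hv
    ext x
    have := Finset.ext_iff.1 h x
    simp only [Finset.mem_union, Finset.mem_inter] at this
    have h1 := @hu x
    have h2 := @hv x
    tauto⟩ : {u : Finset QVar // Disjoint u S} ↪ Finset QVar)).toContinuousLinearMap

theorem ket_basis {S a : Finset QVar} (ha : a ⊆ S) (u : {u : Finset QVar // Disjoint u S}) :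
    ket S a (basis u) = basis (u.1 ∪ a) := by
  have : a ∩ S = a := Finset.inter_eq_left.2 ha
  change basisMap _ (basis u) = _
  rw [basisMap_basis]
  simp [this]

theorem adjoint_ket_ket {S a b : Finset QVar} (ha : a ⊆ S) (hb : b ⊆ S) :
    (ket S a).adjoint ∘L ket S b = if a = b then 1 else 0 := by
  classical
  refine ext_basis fun v => ?_
  refine lp.ext (funext fun u => ?_)
  rw [← basis_inner, ← basis_inner, ContinuousLinearMap.comp_apply,
    ContinuousLinearMap.adjoint_inner_right, ket_basis ha, ket_basis hb,
    orthonormal_iff_ite.1 basis_orthonormal]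
  have key : (u.1 ∪ a = v.1 ∪ b) ↔ (a = b ∧ u = v) := by
    constructor
    · intro h
      have hu := Finset.disjoint_left.1 u.2
      have hv := Finset.disjoint_left.1 v.2
      have h' := fun x => Finset.ext_iff.1 h x
      simp only [Finset.mem_union] at h'
      refine ⟨?_, Subtype.ext ?_⟩ <;> ext x <;> have h1 := h' x <;> have h2 := @hu x <;>
        have h3 := @hv x <;> have h4 := @ha x <;> have h5 := @hb x <;> tauto
    · rintro ⟨rfl, rfl⟩; rfl
  by_cases hab : a = b
  · rw [if_pos hab, one_apply_eq_self, orthonormal_iff_ite.1 basis_orthonormal]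
    simp only [key, and_iff_right hab]
  · rw [if_neg hab, if_neg (by rw [key]; tauto)]
    simp

theorem sum_ket_adjoint (S : Finset QVar) :
    ∑ a ∈ S.powerset, ket S a ∘L (ket S a).adjoint = 1 := by
  classical
  refine ext_basis fun s => ?_
  have hs : basis s = ket S (s ∩ S) (basis ⟨s \ S, Finset.sdiff_disjoint⟩) := by
    rw [ket_basis Finset.inter_subset_right]
    congr 1
    exact (Finset.sdiff_union_inter s S).symm
  rw [hs, _root_.sum_apply]
  rw [Finset.sum_eq_single (s ∩ S)]
  · rw [ContinuousLinearMap.comp_apply, ← ContinuousLinearMap.comp_apply (ket S (s ∩ S)).adjoint,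
      adjoint_ket_ket Finset.inter_subset_right Finset.inter_subset_right]
    simp
  · intro a ha hne
    rw [ContinuousLinearMap.comp_apply, ← ContinuousLinearMap.comp_apply (ket S a).adjoint,
      adjoint_ket_ket (Finset.mem_powerset.1 ha) Finset.inter_subset_right, if_neg hne]
    simp
  · intro h
    exact absurd (Finset.mem_powerset.2 Finset.inter_subset_right) h

theorem inner_ket_ket {S a b : Finset QVar} (ha : a ⊆ S) (hb : b ⊆ S) (x y : Rest S) :
    ⟪ket S a x, ket S b y⟫_ℂ = if a = b then ⟪x, y⟫_ℂ else 0 := by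
  rw [← ContinuousLinearMap.adjoint_inner_right, ← ContinuousLinearMap.comp_apply,
    adjoint_ket_ket ha hb]
  split_ifs <;> simp

theorem norm_sum_ket {τ : Type*} (s : Finset τ) {S : Finset QVar} (g : τ → Finset QVar)
    (hg : ∀ t, g t ⊆ S) (hi : Function.Injective g) (x : τ → Rest S) :
    ‖∑ t ∈ s, ket S (g t) (x t)‖ ^ 2 = ∑ t ∈ s, ‖x t‖ ^ 2 := by
  classical
  have : ((‖∑ t ∈ s, ket S (g t) (x t)‖ ^ 2 : ℝ) : ℂ) = ((∑ t ∈ s, ‖x t‖ ^ 2 : ℝ) : ℂ) := by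
    push_cast
    have h := inner_self_eq_norm_sq_to_K (𝕜 := ℂ) (∑ t ∈ s, ket S (g t) (x t))
    simp only [Complex.coe_algebraMap] at h
    rw [← h, sum_inner]
    refine Finset.sum_congr rfl fun t ht => ?_
    rw [inner_sum, Finset.sum_eq_single t]
    · rw [inner_ket_ket (hg t) (hg t), if_pos rfl]
      simp [inner_self_eq_norm_sq_to_K]
    · intro b _ hb
      rw [inner_ket_ket (hg t) (hg b), if_neg fun e => hb (hi e).symm]
    · exact fun h => absurd ht h
  exact_mod_cast this

theorem sum_norm_adjoint_ket (S : Finset QVar) (ψ : Env) :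
    ∑ a ∈ S.powerset, ‖(ket S a).adjoint ψ‖ ^ 2 = ‖ψ‖ ^ 2 := by
  have e : ψ = ∑ a : S.powerset, ket S a.1 ((ket S a.1).adjoint ψ) := by
    conv_lhs => rw [← one_apply_eq_self (F := Env →L[ℂ] Env) ψ, ← sum_ket_adjoint S]
    rw [_root_.sum_apply, ← Finset.sum_coe_sort]
    rfl
  conv_rhs => rw [e]
  rw [norm_sum_ket Finset.univ (fun a : S.powerset => a.1)
      (fun a => Finset.mem_powerset.1 a.2) Subtype.val_injective]
  exact (Finset.sum_coe_sort S.powerset fun a => ‖(ket S a).adjoint ψ‖ ^ 2).symm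

/-- The partial trace over the qubits in `S`. -/
def ptr (S : Finset QVar) (T : Env →L[ℂ] Env) : Rest S →L[ℂ] Rest S :=
  ∑ a ∈ S.powerset, (ket S a).adjoint ∘L T ∘L ket S a

/-- The operator `I ⊗ A` on the environment, where `A` acts on the qubits outside `S`. -/
def onRest (S : Finset QVar) (A : Rest S →L[ℂ] Rest S) : Env →L[ℂ] Env :=
  ∑ a ∈ S.powerset, ket S a ∘L A ∘L (ket S a).adjoint

/-- The operator `B ⊗ I` on the environment, where the `n`-qubit matrix `B` acts on the qubits
`q 0, …, q (n - 1)`. Rows and columns of `B` are indexed by the `2 ^ n` basis states: the set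
`a : Finset (Fin n)` stands for the state with exactly the qubits in `a` in state `|1⟩`. -/
def onVars {n : ℕ} (q : Fin n ↪ QVar) (B : Matrix (Finset (Fin n)) (Finset (Fin n)) ℂ) :
    Env →L[ℂ] Env :=
  ∑ a, ∑ b, B a b • (ket (Finset.univ.map q) (a.map q) ∘L
    (ket (Finset.univ.map q) (b.map q)).adjoint)

theorem IsKraus.onRest {τ : Type*} {S : Finset QVar} {A : τ → Rest S →L[ℂ] Rest S}
    (hA : IsKraus A) : IsKraus fun k => onRest S (A k) := by
  intro ψ
  have h : ∀ k, ‖QCCS.onRest S (A k) ψ‖ ^ 2 =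
      ∑ a : S.powerset, ‖A k ((ket S a.1).adjoint ψ)‖ ^ 2 := by
    intro k
    rw [← norm_sum_ket Finset.univ (fun a : S.powerset => a.1)
      (fun a => Finset.mem_powerset.1 a.2) Subtype.val_injective]
    unfold QCCS.onRest
    rw [_root_.sum_apply, ← Finset.sum_coe_sort]
    rfl
  simp only [h]
  rw [← sum_norm_adjoint_ket S, ← Finset.sum_coe_sort]
  exact hasSum_sum fun a _ => hA _

theorem IsKraus.onVars {τ : Type*} [Fintype τ] {n : ℕ} (q : Fin n ↪ QVar)
    {B : τ → Matrix (Finset (Fin n)) (Finset (Fin n)) ℂ}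
    (hB : ∑ k, (B k).conjTranspose * B k = 1) : IsKraus fun k => onVars q (B k) := by
  intro ψ
  have hsub : ∀ a : Finset (Fin n), a.map q ⊆ Finset.univ.map q := fun a =>
    Finset.map_subset_map.2 (Finset.subset_univ a)
  set x : Finset (Fin n) → Rest (Finset.univ.map q) := fun b =>
    (ket (Finset.univ.map q) (b.map q)).adjoint ψ with hx
  have h : ∀ k, ‖QCCS.onVars q (B k) ψ‖ ^ 2 = ∑ a, ‖∑ b, B k a b • x b‖ ^ 2 := by
    intro k
    rw [← norm_sum_ket Finset.univ (fun a : Finset (Fin n) => a.map q) hsub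
      (Finset.map_injective q)]
    unfold QCCS.onVars
    simp only [_root_.sum_apply, map_sum, map_smul]
    rfl
  have h2 : ‖ψ‖ ^ 2 = ∑ k, ‖QCCS.onVars q (B k) ψ‖ ^ 2 := by
    have h3 : ‖ψ‖ ^ 2 = ∑ b, ‖x b‖ ^ 2 := by
      rw [← sum_norm_adjoint_ket (Finset.univ.map q)]
      symm
      refine Finset.sum_bij (fun a _ => a.map q) (fun a _ => Finset.mem_powerset.2 (hsub a))
        (fun a _ b _ e => Finset.map_injective q e) ?_ (fun _ _ => rfl)
      intro b hb
      obtain ⟨u, -, hu⟩ := Finset.subset_map_iff.1 (Finset.mem_powerset.1 hb)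
      exact ⟨u, Finset.mem_univ _, hu.symm⟩
    rw [h3]
    simp only [h]
    have h4 : ((∑ b, ‖x b‖ ^ 2 : ℝ) : ℂ) = ((∑ k, ∑ a, ‖∑ b, B k a b • x b‖ ^ 2 : ℝ) : ℂ) := by
      push_cast
      have h5 : ∀ y : Rest (Finset.univ.map q), ((‖y‖ : ℂ)) ^ 2 = ⟪y, y⟫_ℂ := fun y => by
        simp [inner_self_eq_norm_sq_to_K]
      simp only [h5, sum_inner, inner_sum, inner_smul_left, inner_smul_right]
      have h6 : ∀ b c, ∑ k, ∑ a, (starRingEnd ℂ) (B k a b) * B k a c =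
          if b = c then 1 else 0 := by
        intro b c
        have := congrFun (congrFun hB b) c
        rw [Matrix.sum_apply] at this
        simpa [Matrix.mul_apply, Matrix.one_apply] using this
      have h7 : ∀ b, ⟪x b, x b⟫_ℂ = ∑ c, (∑ k, ∑ a, (starRingEnd ℂ) (B k a b) * B k a c) *
          ⟪x b, x c⟫_ℂ := fun b => by simp [h6]
      rw [Finset.sum_congr rfl fun b _ => h7 b]
      simp only [Finset.sum_mul]
      have h8 : ∀ f : τ → Finset (Fin n) → Finset (Fin n) → Finset (Fin n) → ℂ,
          ∑ b, ∑ c, ∑ k, ∑ a, f k a b c = ∑ k, ∑ a, ∑ c, ∑ b, f k a b c := by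
        intro f
        rw [Finset.sum_comm, Finset.sum_congr rfl fun c _ => Finset.sum_comm, Finset.sum_comm]
        refine Finset.sum_congr rfl fun k _ => ?_
        rw [Finset.sum_congr rfl fun c _ => Finset.sum_comm, Finset.sum_comm]
      rw [h8]
      simp only [Finset.mul_sum]
      refine Finset.sum_congr rfl fun k _ => Finset.sum_congr rfl fun a _ => ?_
      exact Finset.sum_congr rfl fun b _ => Finset.sum_congr rfl fun c _ => by ring
    exact_mod_cast h4
  rw [h2]
  exact hasSum_fintype _

/-- A trace-preserving super-operator on `n` qubits, given by Kraus operators. -/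
structure SuperOp (n : ℕ) where
  num : ℕ
  kraus : Fin num → Matrix (Finset (Fin n)) (Finset (Fin n)) ℂ
  sum_eq_one : ∑ k, (kraus k).conjTranspose * kraus k = 1

/-- The state `E_q(ρ)`: the super-operator `E` applied to the qubits `q`. -/
def SuperOp.app {n : ℕ} (E : SuperOp n) (q : Fin n ↪ QVar) (ρ : QState) : QState :=
  (IsKraus.onVars q E.sum_eq_one).apply ρ

/-- A trace-preserving super-operator on the qubits outside `S`, given by Kraus operators
(countably many, as the space is separable and infinite dimensional). -/
structure RestOp (S : Finset QVar) where
  kraus : ℕ → Rest S →L[ℂ] Rest S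
  isKraus : IsKraus kraus

/-- The super-operator `E`, extended by the identity on the qubits in `S`, applied to `ρ`. -/
def RestOp.app {S : Finset QVar} (E : RestOp S) (ρ : QState) : QState :=
  E.isKraus.onRest.apply ρ

/-- A non-degenerate projective measurement on `n` qubits: a Hermitian matrix all of whose
eigenvalues are simple. Its outcomes are indexed by `Finset (Fin n)`. -/
structure Meas (n : ℕ) where
  mat : Matrix (Finset (Fin n)) (Finset (Fin n)) ℂ
  herm : mat.IsHermitian
  nondeg : Function.Injective herm.eigenvalues

/-- The eigenvalue which is reported as the outcome with index `i`. -/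
def Meas.value {n : ℕ} (M : Meas n) (i : Finset (Fin n)) : ℝ := M.herm.eigenvalues i

/-- The projector onto the eigenspace of the eigenvalue with index `i`. -/
def Meas.proj {n : ℕ} (M : Meas n) (i : Finset (Fin n)) :
    Matrix (Finset (Fin n)) (Finset (Fin n)) ℂ :=
  Matrix.vecMulVec (M.herm.eigenvectorBasis i) (star (M.herm.eigenvectorBasis i : _ → ℂ))

/-- `p i` is the probability of outcome `i` and `σ i` the state after outcome `i` (which is
arbitrary if `p i = 0`) when `M` is applied to the qubits `q` in state `ρ`. As `σ i` has trace
one, the equation says `p i = tr (E i ρ)` and `σ i = (E i) ρ (E i) / p i` with the projectors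
`E i = M.proj i`. -/
def Meas.Result {n : ℕ} (M : Meas n) (q : Fin n ↪ QVar) (ρ : QState)
    (p : PMF (Finset (Fin n))) (σ : Finset (Fin n) → QState) : Prop :=
  ∀ i, ((p i).toReal : ℂ) • (σ i).op =
    onVars q (M.proj i) ∘L ρ.op ∘L onVars q (M.proj i)

theorem Meas.proj_conjTranspose {n : ℕ} (M : Meas n) (i : Finset (Fin n)) :
    (M.proj i).conjTranspose = M.proj i := by
  unfold Meas.proj
  rw [Matrix.conjTranspose_vecMulVec, star_star]

theorem Meas.sum_proj {n : ℕ} (M : Meas n) :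
    ∑ i, (M.proj i).conjTranspose * M.proj i = 1 := by
  have h1 : ∀ i, (M.proj i).conjTranspose * M.proj i = M.proj i := by
    intro i
    rw [M.proj_conjTranspose]
    unfold Meas.proj
    rw [Matrix.vecMulVec_mul_vecMulVec]
    have h2 := M.herm.eigenvectorBasis.inner_eq_one i
    rw [EuclideanSpace.inner_eq_star_dotProduct, dotProduct_comm] at h2
    rw [h2]; simp
  simp only [h1]
  have h3 := Matrix.mem_unitaryGroup_iff.1 M.herm.eigenvectorUnitary.2
  rw [← h3]
  ext a b
  rw [Matrix.sum_apply, Matrix.mul_apply]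
  rfl

theorem onVars_adjoint {n : ℕ} (q : Fin n ↪ QVar)
    (B : Matrix (Finset (Fin n)) (Finset (Fin n)) ℂ) :
    (onVars q B).adjoint = onVars q B.conjTranspose := by
  unfold onVars
  simp only [map_sum, map_smulₛₗ, ContinuousLinearMap.adjoint_comp,
    ContinuousLinearMap.adjoint_adjoint]
  rw [Finset.sum_comm]
  rfl

/-- Every measurement can be carried out in every state. -/
theorem Meas.exists_result {n : ℕ} (M : Meas n) (q : Fin n ↪ QVar) (ρ : QState) :
    ∃ p σ, M.Result q ρ p σ := by
  obtain ⟨p, σ, h⟩ := (IsKraus.onVars q M.sum_proj).exists_select ρ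
  refine ⟨p, σ, fun i => ?_⟩
  rw [h i, onVars_adjoint, M.proj_conjTranspose]

end Qubits

section Language

/-- Classical variables. -/
abbrev CVar := ℕ

/-- A data expression over the reals: its free variables, and its value under each valuation,
which depends on the free variables only. -/
@[ext] structure CExp where
  fv : Finset CVar
  eval : (CVar → ℝ) → ℝ
  eval_congr : ∀ η η', (∀ x ∈ fv, η x = η' x) → eval η = eval η'

/-- A boolean expression over the reals. -/
@[ext] structure BExp where
  fv : Finset CVar
  eval : (CVar → ℝ) → Prop
  eval_congr : ∀ η η', (∀ x ∈ fv, η x = η' x) → (eval η ↔ eval η')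

/-- A partial assignment of values to classical variables, used as a substitution. -/
abbrev CSubst := CVar → Option ℝ

/-- The substitution `[v/x]`. -/
def CSubst.single (x : CVar) (v : ℝ) : CSubst := fun y => if y = x then some v else none

/-- The simultaneous substitution `[vs/xs]`. -/
def CSubst.ofLists (xs : List CVar) (vs : List ℝ) : CSubst := fun y => (xs.zip vs).lookup y

/-- The substitution that leaves `x` alone and agrees with `s` elsewhere. -/
def CSubst.erase (s : CSubst) (x : CVar) : CSubst := fun y => if y = x then none else s y

/-- The result of substituting values in an expression. -/
def CExp.subst (s : CSubst) (e : CExp) : CExp where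
  fv := e.fv.filter fun x => s x = none
  eval η := e.eval fun x => (s x).getD (η x)
  eval_congr η η' h := e.eval_congr _ _ fun x hx => by
    cases hs : s x with
    | none => simpa using h x (Finset.mem_filter.2 ⟨hx, hs⟩)
    | some v => rfl

/-- The result of substituting values in a boolean expression. -/
def BExp.subst (s : CSubst) (b : BExp) : BExp where
  fv := b.fv.filter fun x => s x = none
  eval η := b.eval fun x => (s x).getD (η x)
  eval_congr η η' h := b.eval_congr _ _ fun x hx => by
    cases hs : s x with
    | none => simpa using h x (Finset.mem_filter.2 ⟨hx, hs⟩)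
    | some v => rfl

/-- The value of a closed expression. -/
def CExp.val (e : CExp) : ℝ := e.eval fun _ => 0

/-- The truth of a closed boolean expression. -/
def BExp.holds (b : BExp) : Prop := b.eval fun _ => 0

/-- Actions. `CC` and `QC` are the sets of classical and of quantum channels. -/
inductive Act (CC QC : Type*)
  | tau : Act CC QC
  | cin : CC → ℝ → Act CC QC
  | cout : CC → ℝ → Act CC QC
  | qin : QC → QVar → Act CC QC
  | qout : QC → QVar → Act CC QC

/-- A relabelling function. -/
structure Relabel (CC QC : Type*) where
  onC : CC → CC
  onQ : QC → QC

/-- The relabelled action `f(α)`. -/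
def Act.relabel {CC QC : Type*} (f : Relabel CC QC) : Act CC QC → Act CC QC
  | .tau => .tau
  | .cin c v => .cin (f.onC c) v
  | .cout c v => .cout (f.onC c) v
  | .qin c r => .qin (f.onQ c) r
  | .qout c r => .qout (f.onQ c) r

/-- The set of channel names `cn(α)`. -/
def Act.cn {CC QC : Type*} : Act CC QC → Set (CC ⊕ QC)
  | .tau => ∅
  | .cin c _ => {.inl c}
  | .cout c _ => {.inl c}
  | .qin c _ => {.inr c}
  | .qout c _ => {.inr c}

/-- The set of bound quantum variables `qbv(α)`. -/
def Act.qbv {CC QC : Type*} : Act CC QC → Finset QVar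
  | .qin _ r => {r}
  | _ => ∅

/-- Terms of qCCS. `K` is the set of process constants.
* `nil`, `tau P`, `cin c x P` (`c?x.P`), `cout c e P` (`c!e.P`),
* `qin c q P` (`c?q.P`), `qout c q P` (`c!q.P`),
* `oper E q P` (`E[q].P`), `meas M q x P` (`M[q;x].P`),
* `sum P Q` (`P + Q`), `par P Q` (`P ‖ Q`), `rel P f` (`P[f]`), `res P L` (`P \ L`),
* `ite b P` (`if b then P`), `const A qs es` (`A(qs;es)`). -/
inductive Proc (CC QC K : Type*)
  | nil : Proc CC QC K
  | tau (P : Proc CC QC K) : Proc CC QC K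
  | cin (c : CC) (x : CVar) (P : Proc CC QC K) : Proc CC QC K
  | cout (c : CC) (e : CExp) (P : Proc CC QC K) : Proc CC QC K
  | qin (c : QC) (q : QVar) (P : Proc CC QC K) : Proc CC QC K
  | qout (c : QC) (q : QVar) (P : Proc CC QC K) : Proc CC QC K
  | oper {n : ℕ} (E : SuperOp n) (q : Fin n ↪ QVar) (P : Proc CC QC K) : Proc CC QC K
  | meas {n : ℕ} (M : Meas n) (q : Fin n ↪ QVar) (x : CVar) (P : Proc CC QC K) : Proc CC QC K
  | sum (P Q : Proc CC QC K) : Proc CC QC K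
  | par (P Q : Proc CC QC K) : Proc CC QC K
  | rel (P : Proc CC QC K) (f : Relabel CC QC) : Proc CC QC K
  | res (P : Proc CC QC K) (L : Set (CC ⊕ QC)) : Proc CC QC K
  | ite (b : BExp) (P : Proc CC QC K) : Proc CC QC K
  | const (A : K) (qs : List QVar) (es : List CExp) : Proc CC QC K

namespace Proc
variable {CC QC K : Type*}

/-- Free quantum variables. -/
def qv : Proc CC QC K → Finset QVar
  | nil => ∅
  | tau P => P.qv
  | cin _ _ P => P.qv
  | cout _ _ P => P.qv
  | qin _ q P => P.qv \ {q}
  | qout _ q P => P.qv ∪ {q}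
  | oper _ q P => P.qv ∪ Finset.univ.map q
  | meas _ q _ P => P.qv ∪ Finset.univ.map q
  | sum P Q => P.qv ∪ Q.qv
  | par P Q => P.qv ∪ Q.qv
  | rel P _ => P.qv
  | res P _ => P.qv
  | ite _ P => P.qv
  | const _ qs _ => qs.toFinset

/-- Free classical variables. -/
def fv : Proc CC QC K → Set CVar
  | nil => ∅
  | tau P => P.fv
  | cin _ x P => P.fv \ {x}
  | cout _ e P => P.fv ∪ e.fv
  | qin _ _ P => P.fv
  | qout _ _ P => P.fv
  | oper _ _ P => P.fv
  | meas _ _ x P => P.fv \ {x}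
  | sum P Q => P.fv ∪ Q.fv
  | par P Q => P.fv ∪ Q.fv
  | rel P _ => P.fv
  | res P _ => P.fv
  | ite b P => P.fv ∪ b.fv
  | const _ _ es => {x | ∃ e ∈ es, x ∈ e.fv}

/-- Substitution of values for free classical variables. -/
def subst (s : CSubst) : Proc CC QC K → Proc CC QC K
  | nil => nil
  | tau P => tau (P.subst s)
  | cin c x P => cin c x (P.subst (s.erase x))
  | cout c e P => cout c (e.subst s) (P.subst s)
  | qin c q P => qin c q (P.subst s)
  | qout c q P => qout c q (P.subst s)
  | oper E q P => oper E q (P.subst s)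
  | meas M q x P => meas M q x (P.subst (s.erase x))
  | sum P Q => sum (P.subst s) (Q.subst s)
  | par P Q => par (P.subst s) (Q.subst s)
  | rel P f => rel (P.subst s) f
  | res P L => res (P.subst s) L
  | ite b P => ite (b.subst s) (P.subst s)
  | const A qs es => const A qs (es.map (CExp.subst s))

/-- The action of a permutation of the quantum variables on terms (on free and on bound
variables alike). -/
def perm (π : Equiv.Perm QVar) : Proc CC QC K → Proc CC QC K
  | nil => nil
  | tau P => tau (P.perm π)
  | cin c x P => cin c x (P.perm π)
  | cout c e P => cout c e (P.perm π)
  | qin c q P => qin c (π q) (P.perm π)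
  | qout c q P => qout c (π q) (P.perm π)
  | oper E q P => oper E (q.trans π.toEmbedding) (P.perm π)
  | meas M q x P => meas M (q.trans π.toEmbedding) x (P.perm π)
  | sum P Q => sum (P.perm π) (Q.perm π)
  | par P Q => par (P.perm π) (Q.perm π)
  | rel P f => rel (P.perm π) f
  | res P L => res (P.perm π) L
  | ite b P => ite b (P.perm π)
  | const A qs es => const A (qs.map π) es

/-- Replacement of the process constants. -/
def mapConst {K' : Type*} (g : K → K') : Proc CC QC K → Proc CC QC K'
  | nil => nil
  | tau P => tau (P.mapConst g)
  | cin c x P => cin c x (P.mapConst g)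
  | cout c e P => cout c e (P.mapConst g)
  | qin c q P => qin c q (P.mapConst g)
  | qout c q P => qout c q (P.mapConst g)
  | oper E q P => oper E q (P.mapConst g)
  | meas M q x P => meas M q x (P.mapConst g)
  | sum P Q => sum (P.mapConst g) (Q.mapConst g)
  | par P Q => par (P.mapConst g) (Q.mapConst g)
  | rel P f => rel (P.mapConst g) f
  | res P L => res (P.mapConst g) L
  | ite b P => ite b (P.mapConst g)
  | const A qs es => const (g A) qs es

/-- The constants that occur in a term. -/
def consts : Proc CC QC K → Set K
  | nil => ∅
  | tau P => P.consts
  | cin _ _ P => P.consts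
  | cout _ _ P => P.consts
  | qin _ _ P => P.consts
  | qout _ _ P => P.consts
  | oper _ _ P => P.consts
  | meas _ _ _ P => P.consts
  | sum P Q => P.consts ∪ Q.consts
  | par P Q => P.consts ∪ Q.consts
  | rel P _ => P.consts
  | res P _ => P.consts
  | ite _ P => P.consts
  | const A _ _ => {A}

/-- Legal terms, where the constant `A` takes `qa A` quantum and `ca A` classical parameters. -/
def Legal (qa ca : K → ℕ) : Proc CC QC K → Prop
  | nil => True
  | tau P => P.Legal qa ca
  | cin _ _ P => P.Legal qa ca
  | cout _ _ P => P.Legal qa ca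
  | qin _ _ P => P.Legal qa ca
  | qout _ q P => q ∉ P.qv ∧ P.Legal qa ca
  | oper _ _ P => P.Legal qa ca
  | meas _ _ _ P => P.Legal qa ca
  | sum P Q => P.Legal qa ca ∧ Q.Legal qa ca
  | par P Q => Disjoint P.qv Q.qv ∧ P.Legal qa ca ∧ Q.Legal qa ca
  | rel P _ => P.Legal qa ca
  | res P _ => P.Legal qa ca
  | ite _ P => P.Legal qa ca
  | const A qs es => qs.Nodup ∧ qs.length = qa A ∧ es.length = ca A

end Proc

/-- Process expressions: terms in which, besides the constants `K`, process variables from `I`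
may occur (each one applied to parameters, as a constant). -/
abbrev PExp (CC QC K I : Type*) := Proc CC QC (K ⊕ I)

namespace PExp
variable {CC QC K I : Type*}

/-- The term that arises by replacing each process variable `i` by the constant `C i`. -/
def inst (C : I → K) (E : PExp CC QC K I) : Proc CC QC K := E.mapConst (Sum.elim id C)

/-- No process variable occurs in the expression. -/
def NoVar (E : PExp CC QC K I) : Prop := ∀ i, Sum.inr i ∉ E.consts

end PExp

/-- No process variable occurs within a summand. -/
def Proc.NoVarInSum {CC QC K I : Type*} : Proc CC QC (K ⊕ I) → Prop
  | .nil => True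
  | .tau P => P.NoVarInSum
  | .cin _ _ P => P.NoVarInSum
  | .cout _ _ P => P.NoVarInSum
  | .qin _ _ P => P.NoVarInSum
  | .qout _ _ P => P.NoVarInSum
  | .oper _ _ P => P.NoVarInSum
  | .meas _ _ _ P => P.NoVarInSum
  | .sum P Q => PExp.NoVar P ∧ PExp.NoVar Q
  | .par P Q => P.NoVarInSum ∧ Q.NoVarInSum
  | .rel P _ => P.NoVarInSum
  | .res P _ => P.NoVarInSum
  | .ite _ P => P.NoVarInSum
  | .const _ _ _ => True

/-- A system of defining equations `A(qpar A; cpar A) := body A`, one for each constant. -/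
structure Defs (CC QC K : Type*) where
  qpar : K → List QVar
  cpar : K → List CVar
  body : K → Proc CC QC K
  qpar_nodup : ∀ A, (qpar A).Nodup
  cpar_nodup : ∀ A, (cpar A).Nodup
  qv_body : ∀ A, (body A).qv ⊆ (qpar A).toFinset
  fv_body : ∀ A, ∀ x ∈ (body A).fv, x ∈ cpar A
  legal_body : ∀ A, (body A).Legal (fun B => (qpar B).length) (fun B => (cpar B).length)

/-- Legal terms with respect to the defining equations `D`. -/
def Defs.Legal {CC QC K : Type*} (D : Defs CC QC K) (P : Proc CC QC K) : Prop :=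
  P.Legal (fun B => (D.qpar B).length) (fun B => (D.cpar B).length)

/-- Configurations `⟨P, ρ⟩`. -/
structure Con (CC QC K : Type*) where
  proc : Proc CC QC K
  st : QState

variable {CC QC K : Type*}

/-- `mapProc g ⟨P, ρ⟩ = ⟨g P, ρ⟩`. -/
def Con.mapProc (g : Proc CC QC K → Proc CC QC K) (C : Con CC QC K) : Con CC QC K :=
  ⟨g C.proc, C.st⟩

/-- The transition rules. In `qinp` the transposition of `q` and `r` renames `q` into `r`, up to
renaming of bound variables, as `r` is not free in `c?q.P`. In `const` the permutation `π`
likewise replaces the formal quantum parameters, which contain all the free quantum variables of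
the body, by the actual ones. -/
inductive Step (D : Defs CC QC K) : Con CC QC K → Act CC QC → PMF (Con CC QC K) → Prop
  | tau (P : Proc CC QC K) (ρ : QState) :
      Step D ⟨.tau P, ρ⟩ .tau (PMF.pure ⟨P, ρ⟩)
  | cinp (c : CC) (x : CVar) (P : Proc CC QC K) (ρ : QState) (v : ℝ) :
      Step D ⟨.cin c x P, ρ⟩ (.cin c v) (PMF.pure ⟨P.subst (CSubst.single x v), ρ⟩)
  | coutp (c : CC) (e : CExp) (P : Proc CC QC K) (ρ : QState) :
      Step D ⟨.cout c e P, ρ⟩ (.cout c e.val) (PMF.pure ⟨P, ρ⟩)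
  | ccom_left (c : CC) (v : ℝ) (P P' Q Q' : Proc CC QC K) (ρ : QState) :
      Step D ⟨P, ρ⟩ (.cin c v) (PMF.pure ⟨P', ρ⟩) →
      Step D ⟨Q, ρ⟩ (.cout c v) (PMF.pure ⟨Q', ρ⟩) →
      Step D ⟨.par P Q, ρ⟩ .tau (PMF.pure ⟨.par P' Q', ρ⟩)
  | ccom_right (c : CC) (v : ℝ) (P P' Q Q' : Proc CC QC K) (ρ : QState) :
      Step D ⟨P, ρ⟩ (.cout c v) (PMF.pure ⟨P', ρ⟩) →
      Step D ⟨Q, ρ⟩ (.cin c v) (PMF.pure ⟨Q', ρ⟩) →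
      Step D ⟨.par P Q, ρ⟩ .tau (PMF.pure ⟨.par P' Q', ρ⟩)
  | qinp (c : QC) (q r : QVar) (P : Proc CC QC K) (ρ : QState) :
      r ∉ (Proc.qin c q P).qv →
      Step D ⟨.qin c q P, ρ⟩ (.qin c r) (PMF.pure ⟨P.perm (Equiv.swap q r), ρ⟩)
  | qoutp (c : QC) (q : QVar) (P : Proc CC QC K) (ρ : QState) :
      Step D ⟨.qout c q P, ρ⟩ (.qout c q) (PMF.pure ⟨P, ρ⟩)
  | qcom_left (c : QC) (r : QVar) (P P' Q Q' : Proc CC QC K) (ρ : QState) :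
      Step D ⟨P, ρ⟩ (.qin c r) (PMF.pure ⟨P', ρ⟩) →
      Step D ⟨Q, ρ⟩ (.qout c r) (PMF.pure ⟨Q', ρ⟩) →
      Step D ⟨.par P Q, ρ⟩ .tau (PMF.pure ⟨.par P' Q', ρ⟩)
  | qcom_right (c : QC) (r : QVar) (P P' Q Q' : Proc CC QC K) (ρ : QState) :
      Step D ⟨P, ρ⟩ (.qout c r) (PMF.pure ⟨P', ρ⟩) →
      Step D ⟨Q, ρ⟩ (.qin c r) (PMF.pure ⟨Q', ρ⟩) →
      Step D ⟨.par P Q, ρ⟩ .tau (PMF.pure ⟨.par P' Q', ρ⟩)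
  | oper {n : ℕ} (E : SuperOp n) (q : Fin n ↪ QVar) (P : Proc CC QC K) (ρ : QState) :
      Step D ⟨.oper E q P, ρ⟩ .tau (PMF.pure ⟨P, E.app q ρ⟩)
  | meas {n : ℕ} (M : Meas n) (q : Fin n ↪ QVar) (x : CVar) (P : Proc CC QC K) (ρ : QState)
      (p : PMF (Finset (Fin n))) (σ : Finset (Fin n) → QState) :
      M.Result q ρ p σ →
      Step D ⟨.meas M q x P, ρ⟩ .tau
        (p.bind fun i => PMF.pure ⟨P.subst (CSubst.single x (M.value i)), σ i⟩)
  | int_left (P Q : Proc CC QC K) (ρ : QState) (α : Act CC QC) (Δ : PMF (Con CC QC K)) :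
      Step D ⟨P, ρ⟩ α Δ → Disjoint α.qbv Q.qv →
      Step D ⟨.par P Q, ρ⟩ α (Δ.map (Con.mapProc fun P' => .par P' Q))
  | int_right (P Q : Proc CC QC K) (ρ : QState) (α : Act CC QC) (Δ : PMF (Con CC QC K)) :
      Step D ⟨Q, ρ⟩ α Δ → Disjoint α.qbv P.qv →
      Step D ⟨.par P Q, ρ⟩ α (Δ.map (Con.mapProc fun Q' => .par P Q'))
  | sum_left (P Q : Proc CC QC K) (ρ : QState) (α : Act CC QC) (Δ : PMF (Con CC QC K)) :
      Step D ⟨P, ρ⟩ α Δ → Step D ⟨.sum P Q, ρ⟩ α Δ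
  | sum_right (P Q : Proc CC QC K) (ρ : QState) (α : Act CC QC) (Δ : PMF (Con CC QC K)) :
      Step D ⟨Q, ρ⟩ α Δ → Step D ⟨.sum P Q, ρ⟩ α Δ
  | rel (P : Proc CC QC K) (f : Relabel CC QC) (ρ : QState) (α : Act CC QC)
      (Δ : PMF (Con CC QC K)) :
      Step D ⟨P, ρ⟩ α Δ →
      Step D ⟨.rel P f, ρ⟩ (α.relabel f) (Δ.map (Con.mapProc fun P' => .rel P' f))
  | res (P : Proc CC QC K) (L : Set (CC ⊕ QC)) (ρ : QState) (α : Act CC QC)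
      (Δ : PMF (Con CC QC K)) :
      Step D ⟨P, ρ⟩ α Δ → Disjoint α.cn L →
      Step D ⟨.res P L, ρ⟩ α (Δ.map (Con.mapProc fun P' => .res P' L))
  | ite (b : BExp) (P : Proc CC QC K) (ρ : QState) (α : Act CC QC) (Δ : PMF (Con CC QC K)) :
      Step D ⟨P, ρ⟩ α Δ → b.holds → Step D ⟨.ite b P, ρ⟩ α Δ
  | const (A : K) (qs : List QVar) (es : List CExp) (π : Equiv.Perm QVar) (ρ : QState)
      (α : Act CC QC) (Δ : PMF (Con CC QC K)) :
      (D.qpar A).map π = qs →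
      Step D ⟨((D.body A).perm π).subst (CSubst.ofLists (D.cpar A) (es.map CExp.val)), ρ⟩ α Δ →
      Step D ⟨.const A qs es, ρ⟩ α Δ

end Language

section Bisimulation

/-- The lifting of a relation between states and distributions to distributions: the smallest
relation that contains it (on point distributions) and is closed under finite convex
combinations. -/
inductive Lift {S : Type*} (R : S → PMF S → Prop) : PMF S → PMF S → Prop
  | point (s : S) (Θ : PMF S) : R s Θ → Lift R (PMF.pure s) Θ
  | linear (n : ℕ) (p : PMF (Fin n)) (Δ Θ : Fin n → PMF S) :
      (∀ i, Lift R (Δ i) (Θ i)) → Lift R (p.bind Δ) (p.bind Θ)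

/-- The lifting of a relation between states to distributions. -/
def LiftRel {S : Type*} (R : S → S → Prop) : PMF S → PMF S → Prop :=
  Lift fun s Θ => ∃ t, R s t ∧ Θ = PMF.pure t

variable {CC QC K : Type*}

/-- The relation written with a hatted action on the arrow: a step, or (only for `τ`) nothing. -/
def HatStep (D : Defs CC QC K) (α : Act CC QC) (C : Con CC QC K) (Δ : PMF (Con CC QC K)) : Prop :=
  Step D C α Δ ∨ (α = .tau ∧ Δ = PMF.pure C)

/-- Finitely many (lifted) hatted `τ`-steps between distributions. -/
def WeakTau (D : Defs CC QC K) : PMF (Con CC QC K) → PMF (Con CC QC K) → Prop :=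
  Relation.ReflTransGen (Lift (HatStep D .tau))

/-- Weak transitions between distributions: hatted `τ`-steps if `α` is `τ`, and otherwise an
`α`-step preceded and followed by hatted `τ`-steps. -/
def WeakStep (D : Defs CC QC K) (α : Act CC QC) (Δ Θ : PMF (Con CC QC K)) : Prop :=
  (α = .tau ∧ WeakTau D Δ Θ) ∨
  (α ≠ .tau ∧ ∃ Δ₁ Δ₂, WeakTau D Δ Δ₁ ∧ Lift (HatStep D α) Δ₁ Δ₂ ∧ WeakTau D Δ₂ Θ)

/-- Weak open simulations. -/
def IsOpenSim (D : Defs CC QC K) (R : Con CC QC K → Con CC QC K → Prop) : Prop :=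
  ∀ C C', R C C' →
    C.proc.qv = C'.proc.qv ∧ ptr C.proc.qv C.st.op = ptr C.proc.qv C'.st.op ∧
    ∀ (E : RestOp C.proc.qv) (α : Act CC QC) (Δ : PMF (Con CC QC K)),
      Step D ⟨C.proc, E.app C.st⟩ α Δ →
      ∃ Θ, WeakStep D α (PMF.pure ⟨C'.proc, E.app C'.st⟩) Θ ∧ LiftRel R Δ Θ

/-- Weak open bisimulations. -/
def IsOpenBisim (D : Defs CC QC K) (R : Con CC QC K → Con CC QC K → Prop) : Prop :=
  IsOpenSim D R ∧ IsOpenSim D (fun C C' => R C' C)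

/-- Open bisimilarity of configurations: the union of all weak open bisimulations. -/
def OpenBisimilar (D : Defs CC QC K) (C C' : Con CC QC K) : Prop :=
  ∃ R, IsOpenBisim D R ∧ R C C'

/-- Open bisimilarity of processes: bisimilarity in every state, for all values of the free
classical variables. -/
def PBisimilar (D : Defs CC QC K) (P Q : Proc CC QC K) : Prop :=
  ∀ (ρ : QState) (ν : CVar → ℝ),
    OpenBisimilar D ⟨P.subst fun x => some (ν x), ρ⟩ ⟨Q.subst fun x => some (ν x), ρ⟩

end Bisimulation

end
end QCCS

/-! Bisimilarity is first made manageable. Composites of super-operators outside a set of qubits are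
again of this kind, so open bisimilarity is closed under them (`OpenBisimilar.isStable`).
Conversely, a relation that is closed under them, respects the free quantum variables and the
reduced states, and matches plain transitions in both directions is contained in it
(`IsStable.openBisimilar`). The quantifier over super-operators thus disappears from most arguments.
Decomposing liftings by Bayes' formula gives transitivity (`OpenBisimilar.trans`); the symmetry of
the rules in the names of the qubits gives invariance under permutations and under renaming of bound
variables. Prefixes and conditionals then follow by matching first steps, using permutations for
quantum input; relabelling and restriction follow by transporting weak transitions.

The hard constructor is parallel composition `P ‖ R`, in the case where `R` measures its own qubits.
The resulting normalised states are not images of the old state under a trace-preserving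
super-operator, and the definition says nothing about single outcomes. What is needed is
`OpenBisimilar.outcome`: bisimilarity survives each outcome, of nonzero probability, of an
instrument outside the processes, and the probabilities agree. The proof stores in a fresh bit
outside the processes whether the desired outcome has occurred. Such a bit always fits, because the
space of the remaining qubits is infinite dimensional and hence isomorphic to two copies of itself.
Storing it is trace preserving, so bisimilarity is kept, and one afterwards conditions on the bit
being `false`.

It remains to see that conditioning preserves bisimilarity (`PostSelected.openBisimilar`). Every
transition is an instrument on the qubits of the process (`Step.exists_instr`), so it commutes with
reading a bit outside. Transitions of conditioned configurations therefore are exactly the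
conditioned transitions (`Step.cond`, `Step.exists_of_cond`), weak transitions can be conditioned
step by step (`WeakStep.cond`), and bisimilar configurations give the bit the same probability. A
super-operator applied after conditioning is the conditioned version of one that is controlled by
the bit (`cond_ctrl`).

For recursion, each transition of `G{A}` is matched by a strong transition, to the same outcome with
`B` in place of `A`, of some term bisimilar to `G{B}` (`Unfolding.matches`). The proof is by
induction on the derivation. When a constant `A i` is unfolded, the term found for `E i {B}` serves
also for `B i`, since `E i {B}` is bisimilar to `F i {B}`, the body of `B i`, and a constant is
bisimilar to its body if all its quantum parameters are free there. The congruence properties carry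
the matching terms through static contexts; summation has no such property, whence the condition on
summands. Since bisimilarity is transitive, relating `G{A}` to everything bisimilar to `G{B}` gives
a weak simulation, without any appeal to weak bisimulation up to bisimilarity. Composed on the left
with bisimilarity, this relation has as converse the one with `A` and `B` exchanged.

The exception is the usual one: `nil` and `τ.nil` are bisimilar, but an initial `τ` can pre-empt an
alternative. The alternative here is a NOT gate, whose effect on the state is observable. -/

namespace QCCS
noncomputable section

/-! ### Conditioning of discrete distributions -/

section Reweight
variable {S T ι : Type*}

theorem bind_congr_support {p : PMF ι} {f g : ι → PMF S} (h : ∀ i ∈ p.support, f i = g i) :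
    p.bind f = p.bind g := by
  ext s
  rw [PMF.bind_apply, PMF.bind_apply]
  refine tsum_congr fun i => ?_
  by_cases hi : p i = 0
  · simp [hi]
  · rw [h i hi]

/-- The mean value of `g`. -/
def mass (g : S → ℝ≥0∞) (Δ : PMF S) : ℝ≥0∞ := ∑' s, Δ s * g s

theorem mass_pure (g : S → ℝ≥0∞) (s : S) : mass g (PMF.pure s) = g s := by
  unfold mass
  rw [tsum_eq_single s]
  · simp
  · intro t ht; simp [PMF.pure_apply, ht]

theorem mass_bind (g : S → ℝ≥0∞) (p : PMF ι) (Δ : ι → PMF S) :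
    mass g (p.bind Δ) = mass (fun i => mass g (Δ i)) p := by
  unfold mass
  simp only [PMF.bind_apply, ← ENNReal.tsum_mul_right, ← ENNReal.tsum_mul_left]
  rw [ENNReal.tsum_comm]
  simp only [mul_assoc]

theorem mass_le_one {g : S → ℝ≥0∞} (hg : ∀ s, g s ≤ 1) (Δ : PMF S) : mass g Δ ≤ 1 := by
  unfold mass
  rw [← Δ.tsum_coe]
  exact ENNReal.tsum_le_tsum fun s => mul_le_of_le_one_right' (hg s)

theorem mass_ne_top {g : S → ℝ≥0∞} (hg : ∀ s, g s ≤ 1) (Δ : PMF S) : mass g Δ ≠ ∞ :=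
  ne_top_of_le_ne_top (by simp) (mass_le_one hg Δ)

theorem mass_congr {g g' : S → ℝ≥0∞} {Δ : PMF S} (h : ∀ s ∈ Δ.support, g s = g' s) :
    mass g Δ = mass g' Δ := by
  unfold mass
  refine tsum_congr fun s => ?_
  by_cases hs : Δ s = 0
  · simp [hs]
  · rw [h s hs]

open Classical in
/-- The distribution `Δ` conditioned on an event that has probability `g s` in the state `s`. -/
def reweight (g : S → ℝ≥0∞) (Δ : PMF S) : PMF S :=
  if h : mass g Δ ≠ 0 ∧ mass g Δ ≠ ∞ then PMF.normalize (fun s => Δ s * g s) h.1 h.2 else Δ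

theorem reweight_apply {g : S → ℝ≥0∞} {Δ : PMF S} (h0 : mass g Δ ≠ 0) (h1 : mass g Δ ≠ ∞)
    (s : S) : reweight g Δ s = Δ s * g s * (mass g Δ)⁻¹ := by
  unfold reweight
  rw [dif_pos ⟨h0, h1⟩]
  rfl

/-- The division-free form of conditioning. It also holds for events of probability zero, where both
sides vanish whatever default value `reweight` takes. -/
theorem mass_mul_reweight {g : S → ℝ≥0∞} {Δ : PMF S} (h1 : mass g Δ ≠ ∞)
    (s : S) : mass g Δ * reweight g Δ s = Δ s * g s := by
  by_cases h0 : mass g Δ = 0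
  · rw [h0, zero_mul]
    exact (ENNReal.tsum_eq_zero.1 h0 s).symm
  · rw [reweight_apply h0 h1, mul_comm, mul_assoc, ENNReal.inv_mul_cancel h0 h1, mul_one]

theorem mem_support_reweight {g : S → ℝ≥0∞} {Δ : PMF S} (h0 : mass g Δ ≠ 0) (h1 : mass g Δ ≠ ∞)
    {s : S} : s ∈ (reweight g Δ).support ↔ s ∈ Δ.support ∧ g s ≠ 0 := by
  rw [PMF.mem_support_iff, reweight_apply h0 h1, PMF.mem_support_iff]
  simp [h1]

/-- The default value of `reweight` is the distribution itself, so no condition on `g s` is needed.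
-/
theorem reweight_pure (g : S → ℝ≥0∞) (s : S) : reweight g (PMF.pure s) = PMF.pure s := by
  by_cases h : mass g (PMF.pure s) ≠ 0 ∧ mass g (PMF.pure s) ≠ ∞
  · ext t
    rw [reweight_apply h.1 h.2]
    rw [mass_pure] at h ⊢
    by_cases ht : t = s
    · subst ht; simp [ENNReal.mul_inv_cancel h.1 h.2]
    · simp [PMF.pure_apply, ht]
  · unfold reweight
    rw [dif_neg h]

/-- Conditioning a mixture means conditioning the components and updating the weights by their
likelihoods. Components in which the event is impossible receive weight zero, so the default value
of `reweight` on them does no harm. This is what makes conditioning compatible with liftings, which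
are built from mixtures. -/
theorem reweight_bind {g : S → ℝ≥0∞} (hg : ∀ s, g s ≤ 1) (p : PMF ι) (Δ : ι → PMF S)
    (h0 : mass g (p.bind Δ) ≠ 0) :
    reweight g (p.bind Δ) = (reweight (fun i => mass g (Δ i)) p).bind fun i => reweight g (Δ i) := by
  ext s
  have h0' := h0
  rw [mass_bind] at h0'
  rw [reweight_apply h0 (mass_ne_top hg _), PMF.bind_apply, PMF.bind_apply,
    ← ENNReal.tsum_mul_right, ← ENNReal.tsum_mul_right]
  refine tsum_congr fun i => ?_
  rw [reweight_apply h0' (mass_ne_top (fun i => mass_le_one hg _) _), ← mass_bind, mul_assoc (p i),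
    ← mass_mul_reweight (mass_ne_top hg _)]
  ring

/-- Bayes' formula: a state drawn from a mixture, followed by an index drawn from the posterior
distribution. -/
theorem bind_posterior {U : Type*} (p : PMF ι) (Δ : ι → PMF S) (h : ι → S → PMF U) :
    (p.bind Δ).bind (fun s => (reweight (fun i => Δ i s) p).bind fun i => h i s) =
      p.bind fun i => (Δ i).bind (h i) := by
  ext u
  simp only [PMF.bind_apply (p := p.bind Δ), PMF.bind_apply (p := p)]
  simp only [PMF.bind_apply, ← ENNReal.tsum_mul_left]
  rw [ENNReal.tsum_comm]
  conv_rhs => rw [ENNReal.tsum_comm]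
  rw [ENNReal.tsum_comm]
  refine tsum_congr fun s => tsum_congr fun i => ?_
  -- The probability of `s` in the mixture is the normalising factor of its posterior, so the two
  -- cancel.
  have e : ∑' a, p a * Δ a s = mass (fun i => Δ i s) p := rfl
  rw [e, ← mul_assoc, mass_mul_reweight (mass_ne_top (fun i => PMF.coe_le_one _ _) _), mul_assoc]

/-- A finitely supported distribution is the image of one on some `Fin n` with full support. -/
theorem exists_map_fin (p : PMF ι) (h : p.support.Finite) :
    ∃ (n : ℕ) (p' : PMF (Fin n)) (e : Fin n → ι), p = p'.map e ∧ (∀ j, e j ∈ p.support) ∧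
      ∀ j, j ∈ p'.support := by
  classical
  have : Fintype p.support := h.fintype
  have e := (Fintype.equivFin p.support)
  have hs : ∑' j : Fin (Fintype.card p.support), p (e.symm j) = 1 := by
    rw [e.symm.tsum_eq (fun x : p.support => p x), ← p.tsum_coe]
    exact tsum_subtype_eq_of_support_subset (fun _ h => h)
  obtain ⟨p', hp'⟩ : ∃ p' : PMF (Fin (Fintype.card p.support)), ∀ j, p' j = p (e.symm j) :=
    ⟨⟨fun j => p (e.symm j), hs ▸ ENNReal.summable.hasSum⟩, fun _ => rfl⟩
  refine ⟨_, p', fun j => e.symm j, ?_, fun j => (e.symm j).2, fun j => ?_⟩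
  swap
  · rw [PMF.mem_support_iff, hp']; exact (e.symm j).2
  ext i
  rw [PMF.map_apply]
  simp only [hp']
  rw [e.symm.tsum_eq (fun x : p.support => if i = x then p x else 0)]
  by_cases hi : i ∈ p.support
  · rw [tsum_eq_single (⟨i, hi⟩ : p.support)]
    · simp
    · intro b hb; rw [if_neg]; rintro rfl; exact hb rfl
  · rw [(PMF.apply_eq_zero_iff _ _).2 hi]
    symm
    rw [ENNReal.tsum_eq_zero]
    intro b
    rw [if_neg]; rintro rfl; exact hi b.2

end Reweight

/-! ### Liftings of relations to distributions -/

section Lifting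
variable {S T U ι : Type*}

/-- The closure under convex combinations indexed by some `Fin n` extends to arbitrary finitely
supported mixtures, and the hypothesis is needed only for indices of positive weight. -/
theorem Lift.bind {R : S → PMF S → Prop} {p : PMF ι} (hp : p.support.Finite) {Δ Θ : ι → PMF S}
    (h : ∀ i ∈ p.support, Lift R (Δ i) (Θ i)) : Lift R (p.bind Δ) (p.bind Θ) := by
  obtain ⟨n, p', e, rfl, he, -⟩ := exists_map_fin p hp
  rw [PMF.bind_map, PMF.bind_map]
  exact Lift.linear n p' _ _ fun j => h _ (he j)

theorem finite_support_bind {p : PMF ι} (hp : p.support.Finite) {Δ : ι → PMF S}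
    (h : ∀ i ∈ p.support, (Δ i).support.Finite) : (p.bind Δ).support.Finite := by
  rw [PMF.support_bind]
  exact hp.biUnion h

theorem finite_support_map {p : PMF ι} (hp : p.support.Finite) (f : ι → S) :
    (p.map f).support.Finite := by
  rw [PMF.support_map]
  exact hp.image f

theorem Lift.finite_left {R : S → PMF S → Prop} {Δ Θ : PMF S} (h : Lift R Δ Θ) :
    Δ.support.Finite := by
  induction h with
  | point s Θ _ => simp
  | linear n p Δ Θ _ ih => exact finite_support_bind (Set.toFinite _) fun i _ => ih i

theorem Lift.finite_right {R : S → PMF S → Prop} (hR : ∀ s Θ, R s Θ → Θ.support.Finite)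
    {Δ Θ : PMF S} (h : Lift R Δ Θ) : Θ.support.Finite := by
  induction h with
  | point s Θ h => exact hR s Θ h
  | linear n p Δ Θ _ ih => exact finite_support_bind (Set.toFinite _) fun i _ => ih i

/-- Left-decomposability of the lifting. -/
theorem Lift.decompose {R : S → PMF S → Prop} {Δ Θ : PMF S} (h : Lift R Δ Θ) :
    ∃ f : S → PMF S, (∀ s ∈ Δ.support, Lift R (PMF.pure s) (f s)) ∧ Θ = Δ.bind f := by
  induction h with
  | point s Θ h =>
    refine ⟨fun _ => Θ, fun t ht => ?_, by simp⟩
    rw [PMF.mem_support_pure_iff] at ht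
    subst ht; exact .point _ _ h
  | linear n p Δ Θ _ ih =>
    choose f hf e using ih
    -- A state may occur in several components, each with its own answer. The answers are mixed
    -- according to the posterior probability that `s` came from component `i`; only components
    -- containing `s` then contribute.
    refine ⟨fun s => (reweight (fun i => Δ i s) p).bind fun i => f i s, fun s hs => ?_, ?_⟩
    · rw [← PMF.bind_const (reweight (fun i => Δ i s) p) (PMF.pure s)]
      refine Lift.bind (Set.toFinite _) fun i hi => hf i s ?_
      exact ((mem_support_reweight hs (mass_ne_top (fun i => PMF.coe_le_one _ _) _)).1 hi).2
    · rw [bind_posterior]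
      exact congrArg _ (funext e)

theorem Lift.of_bind {R : S → PMF S → Prop} {Δ : PMF S} (hΔ : Δ.support.Finite) {f : S → PMF S}
    (h : ∀ s ∈ Δ.support, Lift R (PMF.pure s) (f s)) : Lift R Δ (Δ.bind f) := by
  conv_lhs => rw [← PMF.bind_pure Δ]
  exact Lift.bind hΔ h

theorem Lift.map_of {R : S → PMF S → Prop} {R' : T → PMF T → Prop} {f : S → T} {g : S → T}
    {Δ Θ : PMF S} (h : Lift R Δ Θ)
    (hR : ∀ s ∈ Δ.support, ∀ Ξ, R s Ξ → Lift R' (PMF.pure (f s)) (Ξ.map g)) :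
    Lift R' (Δ.map f) (Θ.map g) := by
  induction h with
  | point s Θ h => rw [PMF.pure_map]; exact hR s (by simp) Θ h
  | linear n p Δ Θ _ ih =>
    rw [PMF.map_bind, PMF.map_bind]
    refine Lift.bind (Set.toFinite _) fun i hi => ih i fun s hs => hR s ?_
    exact (PMF.mem_support_bind_iff _ _ _).2 ⟨i, hi, hs⟩

theorem LiftRel.point {R : S → S → Prop} {s t : S} (h : R s t) :
    LiftRel R (PMF.pure s) (PMF.pure t) := Lift.point s _ ⟨t, h, rfl⟩

theorem LiftRel.bind {R : S → S → Prop} {p : PMF ι} (hp : p.support.Finite) {Δ Θ : ι → PMF S}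
    (h : ∀ i ∈ p.support, LiftRel R (Δ i) (Θ i)) : LiftRel R (p.bind Δ) (p.bind Θ) :=
  Lift.bind hp h

theorem LiftRel.symm {R : S → S → Prop} {Δ Θ : PMF S} (h : LiftRel R Δ Θ) :
    LiftRel (fun s t => R t s) Θ Δ := by
  induction h with
  | point s Θ h => obtain ⟨t, h, rfl⟩ := h; exact .point h
  | linear n p Δ Θ _ ih => exact .bind (Set.toFinite _) fun i _ => ih i

theorem LiftRel.finite_left {R : S → S → Prop} {Δ Θ : PMF S} (h : LiftRel R Δ Θ) :
    Δ.support.Finite := Lift.finite_left h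

theorem LiftRel.finite_right {R : S → S → Prop} {Δ Θ : PMF S} (h : LiftRel R Δ Θ) :
    Θ.support.Finite := h.symm.finite_left

theorem LiftRel.map_of {R : S → S → Prop} {R' : T → T → Prop} {f g : S → T} {Δ Θ : PMF S}
    (h : LiftRel R Δ Θ) (hR : ∀ s ∈ Δ.support, ∀ t ∈ Θ.support, R s t → R' (f s) (g t)) :
    LiftRel R' (Δ.map f) (Θ.map g) := by
  induction h with
  | point s Θ h =>
    obtain ⟨t, h, rfl⟩ := h
    rw [PMF.pure_map, PMF.pure_map]; exact .point (hR s (by simp) t (by simp) h)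
  | linear n p Δ Θ _ ih =>
    rw [PMF.map_bind, PMF.map_bind]
    refine LiftRel.bind (Set.toFinite _) fun i hi => ih i fun s hs t ht => hR s ?_ t ?_
    · exact (PMF.mem_support_bind_iff _ _ _).2 ⟨i, hi, hs⟩
    · exact (PMF.mem_support_bind_iff _ _ _).2 ⟨i, hi, ht⟩

theorem LiftRel.mono {R R' : S → S → Prop} {Δ Θ : PMF S} (h : LiftRel R Δ Θ)
    (hR : ∀ s ∈ Δ.support, ∀ t ∈ Θ.support, R s t → R' s t) : LiftRel R' Δ Θ := by
  have := h.map_of (R' := R') (f := id) (g := id) hR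
  rwa [PMF.map_id, PMF.map_id] at this

theorem LiftRel.exists_right {R : S → S → Prop} {Δ Θ : PMF S} (h : LiftRel R Δ Θ) :
    ∀ s ∈ Δ.support, ∃ t ∈ Θ.support, R s t := by
  induction h with
  | point s Θ h =>
    obtain ⟨t, h, rfl⟩ := h
    intro s' hs'
    rw [PMF.mem_support_pure_iff] at hs'
    exact ⟨t, by simp, hs' ▸ h⟩
  | linear n p Δ Θ _ ih =>
    intro s hs
    obtain ⟨i, hi, hs⟩ := (PMF.mem_support_bind_iff _ _ _).1 hs
    obtain ⟨t, ht, h⟩ := ih i s hs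
    exact ⟨t, (PMF.mem_support_bind_iff _ _ _).2 ⟨i, hi, ht⟩, h⟩

/-- The independent coupling witnesses the lifting when all pairs are related. -/
theorem LiftRel.of_product {R : S → S → Prop} {Δ Θ : PMF S} (hΔ : Δ.support.Finite)
    (hΘ : Θ.support.Finite) (h : ∀ s ∈ Δ.support, ∀ t ∈ Θ.support, R s t) : LiftRel R Δ Θ := by
  have e1 : Δ = Δ.bind fun s => Θ.bind fun _ => PMF.pure s := by simp
  have e2 : Θ = Δ.bind fun _ => Θ.bind fun t => PMF.pure t := by simp
  rw [e1]
  conv_rhs => rw [e2]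
  exact .bind hΔ fun s hs => .bind hΘ fun t ht => .point (h s hs t ht)

/-- Both liftings are decomposed over the middle distribution. Over a single middle state `t`, one
side consists of predecessors of `t` and the other of successors, so all pairs are related and the
independent coupling serves. -/
theorem LiftRel.trans {R R' R'' : S → S → Prop} (hR : ∀ s t u, R s t → R' t u → R'' s u)
    {Δ Θ Ξ : PMF S} (h : LiftRel R Δ Θ) (h' : LiftRel R' Θ Ξ) : LiftRel R'' Δ Ξ := by
  have hf := h.finite_right
  obtain ⟨f, hfR, rfl⟩ := Lift.decompose h.symm
  obtain ⟨g, hgR, rfl⟩ := Lift.decompose h'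
  refine LiftRel.bind hf fun t ht => ?_
  have h1 : LiftRel (fun s t => R t s) (PMF.pure t) (f t) := hfR t ht
  have h2 : LiftRel R' (PMF.pure t) (g t) := hgR t ht
  refine .of_product h1.finite_right h2.finite_right fun s hs u hu => ?_
  obtain ⟨t1, ht1, r1⟩ := h1.symm.exists_right s hs
  obtain ⟨t2, ht2, r2⟩ := h2.symm.exists_right u hu
  rw [PMF.mem_support_pure_iff] at ht1 ht2
  subst ht1; subst ht2
  exact hR _ _ _ r1 r2

/-- A lifted relation is given by a coupling with finite support. -/
theorem LiftRel.exists_coupling {R : S → S → Prop} {Δ Θ : PMF S} (h : LiftRel R Δ Θ) :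
    ∃ p : PMF (S × S), p.support.Finite ∧ (∀ x ∈ p.support, R x.1 x.2) ∧
      Δ = p.map Prod.fst ∧ Θ = p.map Prod.snd := by
  induction h with
  | point s Θ h =>
    obtain ⟨t, h, rfl⟩ := h
    exact ⟨PMF.pure (s, t), by simp, by simpa using h, by simp [PMF.pure_map], by simp [PMF.pure_map]⟩
  | linear n p Δ Θ _ ih =>
    choose q hq hR e1 e2 using ih
    refine ⟨p.bind q, finite_support_bind (Set.toFinite _) fun i _ => hq i, fun x hx => ?_, ?_, ?_⟩
    · obtain ⟨i, -, hi⟩ := (PMF.mem_support_bind_iff _ _ _).1 hx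
      exact hR i x hi
    · rw [PMF.map_bind]; exact congrArg _ (funext e1)
    · rw [PMF.map_bind]; exact congrArg _ (funext e2)

/-- Invariants of single states are carried along lifted transitions; `I` and `J` differ when the
transition changes the invariant. -/
theorem Lift.forall_support {R : S → PMF S → Prop} {I J : S → Prop}
    (hR : ∀ s Θ, I s → R s Θ → ∀ t ∈ Θ.support, J t) {Δ Θ : PMF S} (h : Lift R Δ Θ)
    (hΔ : ∀ s ∈ Δ.support, I s) : ∀ t ∈ Θ.support, J t := by
  induction h with
  | point s Θ h => exact hR s Θ (hΔ s (by simp)) h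
  | linear n p Δ Θ _ ih =>
    intro t ht
    obtain ⟨i, hi, ht⟩ := (PMF.mem_support_bind_iff _ _ _).1 ht
    exact ih i (fun s hs => hΔ s ((PMF.mem_support_bind_iff _ _ _).2 ⟨i, hi, hs⟩)) t ht

/-- Conditioning and then mapping preserves liftings. -/
theorem Lift.reweight_map {R : S → PMF S → Prop} {R' : T → PMF T → Prop} {g : S → ℝ≥0∞}
    (hg : ∀ s, g s ≤ 1) {f : S → T} {Δ Θ : PMF S} (h : Lift R Δ Θ)
    (hR : ∀ s ∈ Δ.support, ∀ Ξ, R s Ξ → mass g Ξ = g s ∧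
      (g s ≠ 0 → Lift R' (PMF.pure (f s)) ((reweight g Ξ).map f))) :
    mass g Θ = mass g Δ ∧
      (mass g Δ ≠ 0 → Lift R' ((reweight g Δ).map f) ((reweight g Θ).map f)) := by
  induction h with
  | point s Θ h =>
    rw [mass_pure, reweight_pure, PMF.pure_map]
    exact hR s (by simp) Θ h
  | linear n p Δ Θ _ ih =>
    have ih' := fun i (hi : i ∈ p.support) => ih i fun s hs => hR s
      ((PMF.mem_support_bind_iff _ _ _).2 ⟨i, hi, hs⟩)
    have e : mass g (p.bind Θ) = mass g (p.bind Δ) := by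
      rw [mass_bind, mass_bind]
      exact mass_congr fun i hi => (ih' i hi).1
    refine ⟨e, fun h0 => ?_⟩
    rw [reweight_bind hg _ _ h0, reweight_bind hg _ _ (e ▸ h0), PMF.map_bind, PMF.map_bind]
    -- Since related components give the event the same probability, both mixtures update their
    -- weights in the same way.
    have e2 : reweight (fun i => mass g (Θ i)) p = reweight (fun i => mass g (Δ i)) p := by
      have hm : mass (fun i => mass g (Θ i)) p = mass (fun i => mass g (Δ i)) p :=
        mass_congr fun i hi => (ih' i hi).1
      rw [mass_bind] at h0
      have ht := mass_ne_top (fun i => mass_le_one hg (Δ i)) p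
      ext i
      rw [reweight_apply h0 ht, reweight_apply (hm ▸ h0) (hm ▸ ht), hm]
      by_cases hi : p i = 0
      · simp [hi]
      · rw [(ih' i hi).1]
    rw [e2]
    rw [mass_bind] at h0
    refine Lift.bind (Set.toFinite _) fun i hi => ?_
    have := (mem_support_reweight h0 (mass_ne_top (fun i => mass_le_one hg _) _)).1 hi
    exact (ih' i this.1).2 this.2

end Lifting

/-! ### Matrix units and locality of operators -/

section Units

theorem conj_conj {E : Type*} [NormedAddCommGroup E] [InnerProductSpace ℂ E] [CompleteSpace E]
    (A B T : E →L[ℂ] E) :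
    A ∘L (B ∘L T ∘L B.adjoint) ∘L A.adjoint = (A ∘L B) ∘L T ∘L (A ∘L B).adjoint := by
  rw [ContinuousLinearMap.adjoint_comp]
  rfl

/-- The operator `|a⟩⟨b| ⊗ I`, where `a` and `b` are basis states of the qubits in `S`. -/
def unit (S a b : Finset QVar) : Env →L[ℂ] Env := ket S a ∘L (ket S b).adjoint

theorem adjoint_unit (S a b : Finset QVar) : (unit S a b).adjoint = unit S b a := by
  unfold unit
  rw [ContinuousLinearMap.adjoint_comp, ContinuousLinearMap.adjoint_adjoint]

theorem basis_eq_ket (S u : Finset QVar) :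
    basis u = ket S (u ∩ S) (basis ⟨u \ S, Finset.sdiff_disjoint⟩) := by
  rw [ket_basis Finset.inter_subset_right]
  congr 1
  exact (Finset.sdiff_union_inter u S).symm

theorem unit_basis {S a b : Finset QVar} (ha : a ⊆ S) (hb : b ⊆ S) (u : Finset QVar) :
    unit S a b (basis u) = if u ∩ S = b then basis (u \ S ∪ a) else 0 := by
  unfold unit
  rw [basis_eq_ket S u, ContinuousLinearMap.comp_apply,
    ← ContinuousLinearMap.comp_apply (ket S b).adjoint,
    adjoint_ket_ket hb Finset.inter_subset_right]
  by_cases h : u ∩ S = b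
  · rw [if_pos h.symm, if_pos h, one_apply_eq_self, ket_basis ha]
  · rw [if_neg (Ne.symm h), if_neg h]; simp

/-- The identity on the qubits of `T \ S` is resolved into its diagonal matrix units. -/
theorem unit_eq_sum {S T a b : Finset QVar} (h : S ⊆ T) (ha : a ⊆ S) (hb : b ⊆ S) :
    unit S a b = ∑ c ∈ (T \ S).powerset, unit T (a ∪ c) (b ∪ c) := by
  refine ext_basis fun u => ?_
  rw [unit_basis ha hb, _root_.sum_apply]
  have hc : ∀ c ∈ (T \ S).powerset, unit T (a ∪ c) (b ∪ c) (basis u) =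
      if u ∩ T = b ∪ c then basis (u \ T ∪ (a ∪ c)) else 0 := by
    intro c hc
    rw [Finset.mem_powerset] at hc
    have := hc.trans Finset.sdiff_subset
    exact unit_basis (Finset.union_subset (ha.trans h) this) (Finset.union_subset (hb.trans h) this) u
  rw [Finset.sum_congr rfl hc, Finset.sum_eq_single (u ∩ (T \ S))]
  · have h1 : u ∩ T = b ∪ u ∩ (T \ S) ↔ u ∩ S = b := by
      constructor
      · intro e
        ext x
        have e' := Finset.ext_iff.1 e x
        have h1 := @h x
        have h2 := @hb x
        simp only [Finset.mem_inter, Finset.mem_union, Finset.mem_sdiff] at e' ⊢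
        tauto
      · rintro rfl
        ext x
        have h1 := @h x
        simp only [Finset.mem_inter, Finset.mem_union, Finset.mem_sdiff]
        tauto
    have h2 : u \ T ∪ (a ∪ u ∩ (T \ S)) = u \ S ∪ a := by
      ext x
      have h1 := @h x
      have h2 := @ha x
      simp only [Finset.mem_inter, Finset.mem_union, Finset.mem_sdiff]
      tauto
    rw [h2]
    simp only [h1]
  · intro c hc hne
    rw [if_neg]
    intro e
    refine hne ?_
    rw [Finset.mem_powerset] at hc
    ext x
    have e' := Finset.ext_iff.1 e x
    have h1 := @hc x
    have h2 := @hb x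
    simp only [Finset.mem_inter, Finset.mem_union, Finset.mem_sdiff] at e' h1 ⊢
    tauto
  · intro hn
    exact absurd (Finset.mem_powerset.2 Finset.inter_subset_right) hn

theorem unit_comm {S T a b c d : Finset QVar} (h : Disjoint S T) (ha : a ⊆ S) (hb : b ⊆ S)
    (hc : c ⊆ T) (hd : d ⊆ T) :
    unit S a b ∘L unit T c d = unit T c d ∘L unit S a b := by
  refine ext_basis fun u => ?_
  have hST := Finset.disjoint_left.1 h
  rw [ContinuousLinearMap.comp_apply, ContinuousLinearMap.comp_apply, unit_basis hc hd,
    unit_basis ha hb]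
  have e1 : (u \ T ∪ c) ∩ S = u ∩ S := by
    ext x
    have h1 := @hST x
    have h2 := @hc x
    simp only [Finset.mem_inter, Finset.mem_union, Finset.mem_sdiff]
    tauto
  have e2 : (u \ S ∪ a) ∩ T = u ∩ T := by
    ext x
    have h1 := @hST x
    have h2 := @ha x
    simp only [Finset.mem_inter, Finset.mem_union, Finset.mem_sdiff]
    tauto
  have e3 : (u \ T ∪ c) \ S ∪ a = (u \ S ∪ a) \ T ∪ c := by
    ext x
    have h1 := @hST x
    have h2 := @ha x
    have h3 := @hc x
    simp only [Finset.mem_union, Finset.mem_sdiff]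
    tauto
  by_cases h1 : u ∩ T = d <;> by_cases h2 : u ∩ S = b
  · rw [if_pos h1, if_pos h2, unit_basis ha hb, unit_basis hc hd, e1, e2, if_pos h1, if_pos h2, e3]
  · rw [if_pos h1, if_neg h2, unit_basis ha hb, e1, if_neg h2, map_zero]
  · rw [if_neg h1, if_pos h2, unit_basis hc hd, e2, if_neg h1, map_zero]
  · rw [if_neg h1, if_neg h2, map_zero, map_zero]

/-- The operators on the qubits outside `S`. -/
def Outside (S : Finset QVar) (B : Env →L[ℂ] Env) : Prop :=
  ∀ a b, a ⊆ S → b ⊆ S → unit S a b ∘L B = B ∘L unit S a b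

/-- The matrix units of the smaller set are sums of those of the larger one. -/
theorem Outside.anti {S T : Finset QVar} (h : S ⊆ T) {B : Env →L[ℂ] Env} (hB : Outside T B) :
    Outside S B := by
  intro a b ha hb
  rw [unit_eq_sum h ha hb, ContinuousLinearMap.finsetSum_comp, ContinuousLinearMap.comp_finsetSum]
  refine Finset.sum_congr rfl fun c hc => ?_
  have := (Finset.mem_powerset.1 hc).trans Finset.sdiff_subset
  exact hB _ _ (Finset.union_subset (ha.trans h) this) (Finset.union_subset (hb.trans h) this)

theorem Outside.comp {S : Finset QVar} {A B : Env →L[ℂ] Env} (hA : Outside S A)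
    (hB : Outside S B) : Outside S (A ∘L B) := by
  intro a b ha hb
  rw [← ContinuousLinearMap.comp_assoc, hA a b ha hb, ContinuousLinearMap.comp_assoc, hB a b ha hb,
    ContinuousLinearMap.comp_assoc]

theorem Outside.adjoint {S : Finset QVar} {B : Env →L[ℂ] Env} (hB : Outside S B) :
    Outside S B.adjoint := by
  intro a b ha hb
  have := congrArg ContinuousLinearMap.adjoint (hB b a hb ha)
  rw [ContinuousLinearMap.adjoint_comp, ContinuousLinearMap.adjoint_comp, adjoint_unit] at this
  exact this.symm

theorem Outside.zero (S : Finset QVar) : Outside S 0 := fun a b _ _ => by simp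

theorem Outside.onRest (S : Finset QVar) (A : Rest S →L[ℂ] Rest S) : Outside S (onRest S A) := by
  intro a b ha hb
  unfold QCCS.onRest unit
  rw [ContinuousLinearMap.comp_finsetSum, ContinuousLinearMap.finsetSum_comp,
    Finset.sum_eq_single b, Finset.sum_eq_single a]
  · ext1 x
    have h1 := adjoint_ket_ket ha ha
    have h2 := adjoint_ket_ket hb hb
    rw [if_pos rfl] at h1 h2
    have h1' := fun y => DFunLike.congr_fun h1 y
    have h2' := fun y => DFunLike.congr_fun h2 y
    simp only [ContinuousLinearMap.comp_apply, one_apply_eq_self] at h1' h2' ⊢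
    rw [h1', h2']
  · intro c hc hne
    ext1 x
    have h1 := adjoint_ket_ket (Finset.mem_powerset.1 hc) ha
    rw [if_neg hne] at h1
    have h1' := fun y => DFunLike.congr_fun h1 y
    simp only [ContinuousLinearMap.comp_apply, _root_.zero_apply] at h1' ⊢
    rw [h1', map_zero, map_zero]
  · exact fun h => absurd (Finset.mem_powerset.2 ha) h
  · intro c hc hne
    ext1 x
    have h1 := adjoint_ket_ket hb (Finset.mem_powerset.1 hc)
    rw [if_neg (Ne.symm hne)] at h1
    have h1' := fun y => DFunLike.congr_fun h1 y
    simp only [ContinuousLinearMap.comp_apply, _root_.zero_apply] at h1' ⊢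
    rw [h1', map_zero]
  · exact fun h => absurd (Finset.mem_powerset.2 hb) h

theorem onRest_ket {S a : Finset QVar} (ha : a ⊆ S) (A : Rest S →L[ℂ] Rest S) (x : Rest S) :
    onRest S A (ket S a x) = ket S a (A x) := by
  unfold onRest
  rw [_root_.sum_apply, Finset.sum_eq_single a]
  · have h1 := adjoint_ket_ket ha ha
    rw [if_pos rfl] at h1
    have h1' := fun y => DFunLike.congr_fun h1 y
    simp only [ContinuousLinearMap.comp_apply, one_apply_eq_self] at h1' ⊢
    rw [h1']
  · intro c hc hne
    have h1 := adjoint_ket_ket (Finset.mem_powerset.1 hc) ha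
    rw [if_neg hne] at h1
    have h1' := fun y => DFunLike.congr_fun h1 y
    simp only [ContinuousLinearMap.comp_apply, _root_.zero_apply] at h1' ⊢
    rw [h1', map_zero, map_zero]
  · exact fun h => absurd (Finset.mem_powerset.2 ha) h

theorem ext_ket (S : Finset QVar) {A B : Env →L[ℂ] Env}
    (h : ∀ a, a ⊆ S → ∀ x, A (ket S a x) = B (ket S a x)) : A = B := by
  refine ext_basis fun u => ?_
  rw [basis_eq_ket S u]
  exact h _ Finset.inter_subset_right _

theorem onRest_comp (S : Finset QVar) (A B : Rest S →L[ℂ] Rest S) :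
    onRest S A ∘L onRest S B = onRest S (A ∘L B) := by
  refine ext_ket S fun a ha x => ?_
  rw [ContinuousLinearMap.comp_apply, onRest_ket ha, onRest_ket ha, onRest_ket ha]
  rfl

theorem onRest_one (S : Finset QVar) : onRest S 1 = 1 :=
  ext_ket S fun a ha x => by rw [onRest_ket ha]; rfl

theorem onRest_zero (S : Finset QVar) : onRest S 0 = 0 :=
  ext_ket S fun a ha x => by rw [onRest_ket ha]; simp

theorem onRest_add (S : Finset QVar) (A B : Rest S →L[ℂ] Rest S) :
    onRest S (A + B) = onRest S A + onRest S B :=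
  ext_ket S fun a ha x => by
    rw [onRest_ket ha, _root_.add_apply, _root_.add_apply, onRest_ket ha, onRest_ket ha, map_add]

theorem onRest_adjoint (S : Finset QVar) (A : Rest S →L[ℂ] Rest S) :
    (onRest S A).adjoint = onRest S A.adjoint := by
  unfold onRest
  simp only [map_sum, ContinuousLinearMap.adjoint_comp, ContinuousLinearMap.adjoint_adjoint]
  rfl

/-- The operator on the qubits outside `S` that a given operator on the environment induces. -/
def compress (S : Finset QVar) (B : Env →L[ℂ] Env) : Rest S →L[ℂ] Rest S :=
  (ket S ∅).adjoint ∘L B ∘L ket S ∅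

/-- The commutant of the matrix units on `S` consists of the operators `I ⊗ A`. To find `B` on the
sector `|a⟩`, write `|a⟩ = |a⟩⟨∅| |∅⟩` and move `B` past the unit, so that everything is determined
on the sector `|∅⟩`. -/
theorem Outside.onRest_compress {S : Finset QVar} {B : Env →L[ℂ] Env} (hB : Outside S B) :
    QCCS.onRest S (compress S B) = B := by
  refine ext_ket S fun a ha x => ?_
  rw [onRest_ket ha]
  have h := DFunLike.congr_fun (hB a ∅ ha (Finset.empty_subset _)) (ket S ∅ x)
  have h1 := DFunLike.congr_fun
    (adjoint_ket_ket (Finset.empty_subset S) (Finset.empty_subset S)) x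
  rw [if_pos rfl] at h1
  unfold unit at h
  simp only [ContinuousLinearMap.comp_apply, one_apply_eq_self] at h h1
  rw [h1] at h
  exact h

theorem norm_ket (S a : Finset QVar) (x : Rest S) : ‖ket S a x‖ = ‖x‖ :=
  (basisMap _).norm_map x

theorem onVars_eq {n : ℕ} (q : Fin n ↪ QVar) (B : Matrix (Finset (Fin n)) (Finset (Fin n)) ℂ) :
    onVars q B = ∑ a, ∑ b, B a b • unit (Finset.univ.map q) (a.map q) (b.map q) := rfl

theorem map_subset_univ_map {n : ℕ} (q : Fin n ↪ QVar) (a : Finset (Fin n)) :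
    a.map q ⊆ Finset.univ.map q := Finset.map_subset_map.2 (Finset.subset_univ a)

/-- The operators on the qubits in `S`: they commute with all operators on the other qubits. -/
def Local (S : Finset QVar) (K : Env →L[ℂ] Env) : Prop :=
  (∀ B, Outside S B → K ∘L B = B ∘L K) ∧ ∀ T, Disjoint S T → Outside T K

theorem Local.onVars {n : ℕ} (q : Fin n ↪ QVar) {S : Finset QVar} (h : Finset.univ.map q ⊆ S)
    (M : Matrix (Finset (Fin n)) (Finset (Fin n)) ℂ) : Local S (onVars q M) := by
  refine ⟨fun B hB => ?_, fun T hT => ?_⟩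
  · rw [onVars_eq]
    simp only [ContinuousLinearMap.finsetSum_comp, ContinuousLinearMap.comp_finsetSum,
      ContinuousLinearMap.smul_comp, ContinuousLinearMap.comp_smul]
    refine Finset.sum_congr rfl fun a _ => Finset.sum_congr rfl fun b _ => ?_
    rw [hB.anti h _ _ (map_subset_univ_map q a) (map_subset_univ_map q b)]
  · intro c d hc hd
    rw [onVars_eq]
    simp only [ContinuousLinearMap.finsetSum_comp, ContinuousLinearMap.comp_finsetSum,
      ContinuousLinearMap.smul_comp, ContinuousLinearMap.comp_smul]
    refine Finset.sum_congr rfl fun a _ => Finset.sum_congr rfl fun b _ => ?_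
    rw [unit_comm (Disjoint.mono_left h hT).symm hc hd (map_subset_univ_map q a)
      (map_subset_univ_map q b)]

theorem Local.one (S : Finset QVar) : Local S 1 :=
  ⟨fun _ _ => rfl, fun _ _ _ _ _ _ => rfl⟩

theorem Local.mono {S T : Finset QVar} (h : S ⊆ T) {K : Env →L[ℂ] Env} (hK : Local S K) :
    Local T K :=
  ⟨fun B hB => hK.1 B (hB.anti h), fun U hU => hK.2 U (Disjoint.mono_left h hU)⟩

end Units

/-! ### Partial traces -/

section PartialTrace

theorem inner_ptr {S : Finset QVar} (T : Env →L[ℂ] Env) (u v : {u : Finset QVar // Disjoint u S}) :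
    ⟪basis u, ptr S T (basis v)⟫_ℂ =
      ∑ a ∈ S.powerset, ⟪basis (u.1 ∪ a), T (basis (v.1 ∪ a))⟫_ℂ := by
  unfold ptr
  rw [_root_.sum_apply, inner_sum]
  refine Finset.sum_congr rfl fun a ha => ?_
  rw [Finset.mem_powerset] at ha
  rw [ContinuousLinearMap.comp_apply, ContinuousLinearMap.adjoint_inner_right,
    ContinuousLinearMap.comp_apply, ket_basis ha, ket_basis ha]

theorem ext_inner_basis {ι κ : Type*} {A B : Ell ι →L[ℂ] Ell κ}
    (h : ∀ u v, ⟪basis u, A (basis v)⟫_ℂ = ⟪basis u, B (basis v)⟫_ℂ) : A = B := by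
  refine ext_basis fun v => lp.ext (funext fun u => ?_)
  rw [← basis_inner, ← basis_inner, h]

/-- In terms of matrix elements the dependence of the space `Rest S` on `S` disappears, which allows
different sets of qubits to be compared. -/
theorem ptr_eq_iff {S : Finset QVar} {T T' : Env →L[ℂ] Env} : ptr S T = ptr S T' ↔
    ∀ u v : Finset QVar, Disjoint u S → Disjoint v S →
      ∑ a ∈ S.powerset, ⟪basis (u ∪ a), T (basis (v ∪ a))⟫_ℂ =
        ∑ a ∈ S.powerset, ⟪basis (u ∪ a), T' (basis (v ∪ a))⟫_ℂ := by
  constructor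
  · intro h u v hu hv
    rw [← inner_ptr T ⟨u, hu⟩ ⟨v, hv⟩, h, inner_ptr]
  · intro h
    refine ext_inner_basis fun u v => ?_
    rw [inner_ptr, inner_ptr]
    exact h _ _ u.2 v.2

theorem sum_powerset_of_subset {M : Type*} [AddCommMonoid M] {S T : Finset QVar} (h : S ⊆ T)
    (f : Finset QVar → M) :
    ∑ b ∈ T.powerset, f b = ∑ c ∈ (T \ S).powerset, ∑ a ∈ S.powerset, f (c ∪ a) := by
  rw [← Finset.sum_product']
  symm
  refine Finset.sum_bij (fun x _ => x.1 ∪ x.2) ?_ ?_ ?_ (fun _ _ => rfl)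
  · intro x hx
    simp only [Finset.mem_product, Finset.mem_powerset] at hx ⊢
    exact Finset.union_subset (hx.1.trans Finset.sdiff_subset) (hx.2.trans h)
  · intro x hx y hy e
    simp only [Finset.mem_product, Finset.mem_powerset] at hx hy
    refine Prod.ext ?_ ?_ <;> ext z <;> have e' := Finset.ext_iff.1 e z <;>
      have h1 := @hx.1 z <;> have h2 := @hx.2 z <;> have h3 := @hy.1 z <;> have h4 := @hy.2 z <;>
      simp only [Finset.mem_union, Finset.mem_sdiff] at e' h1 h3 <;> tauto
  · intro b hb
    rw [Finset.mem_powerset] at hb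
    refine ⟨(b \ S, b ∩ S), ?_, Finset.sdiff_union_inter b S⟩
    simp only [Finset.mem_product, Finset.mem_powerset]
    exact ⟨Finset.sdiff_subset_sdiff hb subset_rfl, Finset.inter_subset_right⟩

/-- Tracing out `T` amounts to tracing out `S` and then the qubits in `T \ S`. -/
theorem ptr_mono {S T : Finset QVar} (h : S ⊆ T) {X Y : Env →L[ℂ] Env}
    (e : ptr S X = ptr S Y) : ptr T X = ptr T Y := by
  rw [ptr_eq_iff] at e ⊢
  intro u v hu hv
  rw [sum_powerset_of_subset h, sum_powerset_of_subset h]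
  refine Finset.sum_congr rfl fun c hc => ?_
  rw [Finset.mem_powerset] at hc
  have hcS : Disjoint c S := Disjoint.mono_left hc Finset.sdiff_disjoint
  have := e (u ∪ c) (v ∪ c) (Finset.disjoint_union_left.2 ⟨Disjoint.mono_right h hu, hcS⟩)
    (Finset.disjoint_union_left.2 ⟨Disjoint.mono_right h hv, hcS⟩)
  simpa only [Finset.union_assoc] using this

/-- As `B` is `I ⊗ A`, the bras `⟨a|` over `S` can be moved past it. Hence an operation outside `S`
acts on the reduced state alone. -/
theorem ptr_conj {S : Finset QVar} {B : Env →L[ℂ] Env} (hB : Outside S B) (T : Env →L[ℂ] Env) :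
    ptr S (B ∘L T ∘L B.adjoint) = compress S B ∘L ptr S T ∘L (compress S B).adjoint := by
  have key : ∀ a ∈ S.powerset, (ket S a).adjoint ∘L B = compress S B ∘L (ket S a).adjoint := by
    intro a ha
    rw [Finset.mem_powerset] at ha
    have h : B.adjoint ∘L ket S a = ket S a ∘L (compress S B).adjoint := by
      ext1 x
      conv_lhs => rw [← hB.onRest_compress]
      rw [ContinuousLinearMap.comp_apply, onRest_adjoint, onRest_ket ha]
      rfl
    have h' := congrArg ContinuousLinearMap.adjoint h
    rwa [ContinuousLinearMap.adjoint_comp, ContinuousLinearMap.adjoint_comp,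
      ContinuousLinearMap.adjoint_adjoint, ContinuousLinearMap.adjoint_adjoint] at h'
  unfold ptr
  rw [ContinuousLinearMap.finsetSum_comp, ContinuousLinearMap.comp_finsetSum]
  refine Finset.sum_congr rfl fun a ha => ?_
  have h' := congrArg ContinuousLinearMap.adjoint (key a ha)
  rw [ContinuousLinearMap.adjoint_comp, ContinuousLinearMap.adjoint_comp,
    ContinuousLinearMap.adjoint_adjoint] at h'
  rw [← ContinuousLinearMap.comp_assoc, ← ContinuousLinearMap.comp_assoc, key a ha]
  simp only [ContinuousLinearMap.comp_assoc]
  rw [h']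

/-- The partial trace as a continuous linear map. -/
def ptrL (S : Finset QVar) : (Env →L[ℂ] Env) →L[ℂ] (Rest S →L[ℂ] Rest S) :=
  ∑ a ∈ S.powerset, (ContinuousLinearMap.compL ℂ (Rest S) Env (Rest S) (ket S a).adjoint) ∘L
    ((ContinuousLinearMap.compL ℂ (Rest S) Env Env).flip (ket S a))

theorem ptrL_apply (S : Finset QVar) (T : Env →L[ℂ] Env) : ptrL S T = ptr S T := by
  unfold ptrL ptr
  rw [_root_.sum_apply]
  rfl

end PartialTrace

/-! ### Density operators and super-operators -/

section Densities
variable {ι : Type*}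

/-- Taking traces compares the coefficients. Hence an unnormalised state determines its probability,
and also the normalised state unless the probability vanishes. -/
theorem Density.eq_of_smul {ρ σ : Density ι} {p q : ℝ}
    (h : (p : ℂ) • ρ.op = (q : ℂ) • σ.op) : p = q ∧ (p ≠ 0 → ρ = σ) := by
  have h1 := ρ.trace_one.mul_left (p : ℂ)
  have h2 := σ.trace_one.mul_left (q : ℂ)
  have e : (fun i => (p : ℂ) * ⟪basis i, ρ.op (basis i)⟫_ℂ) =
      fun i => (q : ℂ) * ⟪basis i, σ.op (basis i)⟫_ℂ := by
    funext i
    rw [← inner_smul_right, ← inner_smul_right, ← _root_.smul_apply, ← _root_.smul_apply, h]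
  rw [e] at h1
  have hpq := h1.unique h2
  simp only [mul_one, Complex.ofReal_inj] at hpq
  refine ⟨hpq, fun hp => ?_⟩
  subst hpq
  exact Density.ext (smul_right_injective _ (Complex.ofReal_ne_zero.2 hp) h)

/-- The partial trace preserves the trace. -/
theorem trace_eq_of_ptr_eq {S : Finset QVar} {ρ σ : QState} {p q : ℝ}
    (h : ptr S ((p : ℂ) • ρ.op) = ptr S ((q : ℂ) • σ.op)) : p = q := by
  -- A basis state of all the qubits is a pair of one outside `S` and one on `S`, so the full trace
  -- is an iterated sum.
  let e : {v : Finset QVar // Disjoint v S} × S.powerset ≃ Finset QVar :=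
    { toFun := fun x => x.1.1 ∪ x.2.1
      invFun := fun u => (⟨u \ S, Finset.sdiff_disjoint⟩,
        ⟨u ∩ S, Finset.mem_powerset.2 Finset.inter_subset_right⟩)
      left_inv := by
        rintro ⟨⟨v, hv⟩, a, ha⟩
        rw [Finset.mem_powerset] at ha
        have hv' := Finset.disjoint_left.1 hv
        refine Prod.ext (Subtype.ext ?_) (Subtype.ext ?_) <;> ext x <;> have h1 := @ha x <;>
          have h2 := @hv' x <;> simp only [Finset.mem_sdiff, Finset.mem_inter, Finset.mem_union] <;>
          tauto
      right_inv := fun u => Finset.sdiff_union_inter u S }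
  have key : ∀ (ρ : QState) (p : ℝ), HasSum (fun v : {v : Finset QVar // Disjoint v S} =>
      ⟪basis v, ptr S ((p : ℂ) • ρ.op) (basis v)⟫_ℂ) (p : ℂ) := by
    intro ρ p
    have h1 := ρ.trace_one.mul_left (p : ℂ)
    rw [mul_one, ← e.hasSum_iff] at h1
    refine (h1.prod_fiberwise fun v => hasSum_fintype _).congr_fun ?_
    intro v
    rw [inner_ptr, ← Finset.sum_coe_sort]
    refine Finset.sum_congr rfl fun a _ => ?_
    rw [_root_.smul_apply, inner_smul_right]
    rfl
  have h1 := key ρ p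
  rw [h] at h1
  exact_mod_cast h1.unique (key σ q)

variable {τ : Type*} {A : τ → Ell ι →L[ℂ] Ell ι}

theorem IsKraus.hasSum_apply (hA : IsKraus A) (ρ : Density ι) :
    HasSum (fun k => A k ∘L ρ.op ∘L (A k).adjoint) (hA.apply ρ).op :=
  (hA.summable ρ).hasSum

theorem IsKraus.hasSum_conj (hA : IsKraus A) (ρ : Density ι) (B : Ell ι →L[ℂ] Ell ι) :
    HasSum (fun k => (B ∘L A k) ∘L ρ.op ∘L (B ∘L A k).adjoint)
      (B ∘L (hA.apply ρ).op ∘L B.adjoint) := by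
  have h := ((hA.hasSum_apply ρ).mapL
    ((ContinuousLinearMap.compL ℂ (Ell ι) (Ell ι) (Ell ι)).flip B.adjoint)).mapL
      (ContinuousLinearMap.compL ℂ (Ell ι) (Ell ι) (Ell ι) B)
  refine h.congr_fun fun k => ?_
  rw [← conj_conj]
  rfl

theorem isKraus_of_sum_eq_one [Fintype τ] (h : ∑ k, (A k).adjoint ∘L A k = 1) : IsKraus A := by
  intro ψ
  have e : ‖ψ‖ ^ 2 = ∑ k, ‖A k ψ‖ ^ 2 := by
    have e2 : ((‖ψ‖ ^ 2 : ℝ) : ℂ) = ((∑ k, ‖A k ψ‖ ^ 2 : ℝ) : ℂ) := by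
      have h1 := congrArg (fun B : Ell ι →L[ℂ] Ell ι => ⟪ψ, B ψ⟫_ℂ) h
      simp only [_root_.sum_apply, inner_sum, ContinuousLinearMap.comp_apply,
        ContinuousLinearMap.adjoint_inner_right, one_apply_eq_self] at h1
      simp only [inner_self_eq_norm_sq_to_K, Complex.coe_algebraMap] at h1
      push_cast
      exact h1.symm
    exact_mod_cast e2
  rw [e]
  exact hasSum_fintype _

theorem ptr_apply_eq {S : Finset QVar} {A : τ → Env →L[ℂ] Env} (hA : IsKraus A)
    (hS : ∀ k, Outside S (A k)) {ρ σ : QState} (h : ptr S ρ.op = ptr S σ.op) :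
    ptr S (hA.apply ρ).op = ptr S (hA.apply σ).op := by
  have h1 := (hA.hasSum_apply ρ).mapL (ptrL S)
  have h2 := (hA.hasSum_apply σ).mapL (ptrL S)
  simp only [ptrL_apply, ptr_conj (hS _), h] at h1 h2
  exact h1.unique h2

theorem RestOp.outside {S : Finset QVar} (E : RestOp S) (k : ℕ) : Outside S (onRest S (E.kraus k)) :=
  Outside.onRest S _

/-- Every trace-preserving super-operator on the qubits outside `S` is of the form considered in
the definition of open bisimulations. -/
theorem IsKraus.exists_restOp [Countable τ] {S : Finset QVar} {A : τ → Env →L[ℂ] Env}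
    (hA : IsKraus A) (hS : ∀ k, Outside S (A k)) : ∃ E : RestOp S, ∀ ρ, E.app ρ = hA.apply ρ := by
  classical
  obtain ⟨e, he⟩ := exists_injective_nat τ
  -- Kraus families in a `RestOp` are indexed by `ℕ`; the given family is padded with zero
  -- operators.
  set A' : ℕ → Env →L[ℂ] Env := Function.extend e A 0 with hA'
  have h0 : ∀ n, n ∉ Set.range e → A' n = 0 := fun n hn => by
    rw [hA', Function.extend_apply']; rfl
    simpa using hn
  have h1 : ∀ k, A' (e k) = A k := fun k => he.extend_apply _ _ _
  have hout : ∀ n, Outside S (A' n) := by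
    intro n
    by_cases hn : n ∈ Set.range e
    · obtain ⟨k, rfl⟩ := hn
      rw [h1]; exact hS k
    · rw [h0 n hn]; exact Outside.zero S
  have hk : ∀ n, QCCS.onRest S (compress S (A' n)) = A' n := fun n => (hout n).onRest_compress
  refine ⟨⟨fun n => compress S (A' n), fun ψ => ?_⟩, fun ρ => ?_⟩
  -- Trace preservation of the compressed operators is read off on the sector `|∅⟩`, into which
  -- `ket` is isometric.
  · have h2 : ∀ n, ‖compress S (A' n) ψ‖ = ‖A' n (ket S ∅ ψ)‖ := by
      intro n
      rw [← norm_ket S ∅, ← onRest_ket (Finset.empty_subset S), hk]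
    simp only [h2]
    rw [← norm_ket S ∅ ψ, ← he.hasSum_iff]
    · simpa only [Function.comp_def, h1] using hA (ket S ∅ ψ)
    · intro n hn; simp [h0 n hn]
  · refine Density.ext ?_
    change ∑' n, QCCS.onRest S (compress S (A' n)) ∘L ρ.op ∘L (QCCS.onRest S (compress S (A' n))).adjoint =
      ∑' k, A k ∘L ρ.op ∘L (A k).adjoint
    simp only [hk]
    rw [← he.tsum_eq]
    · simp only [h1]
    · intro n hn
      by_contra hn'
      exact hn (by simp [h0 n hn'])

end Densities

/-! ### Storing a bit outside a finite set of qubits, and conditioning on it -/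

section Flags

instance (T : Finset QVar) : Infinite {u : Finset QVar // Disjoint u T} := by
  -- The singleton consists of a qubit whose number exceeds all those in `T`.
  refine Infinite.of_injective (fun n : ℕ => ⟨{n + T.sup id + 1}, ?_⟩) ?_
  · rw [Finset.disjoint_singleton_left]
    intro h
    have := Finset.le_sup (f := id) h
    simp only [id] at this
    omega
  · intro m n h
    simpa using h

/-- Both sides are countably infinite. Thus `ℂ² ⊗ Rest T` is isomorphic to `Rest T`: there is always
room for one more bit outside `T`, with no qubit having to be unused. -/
theorem exists_flagEquiv (T : Finset QVar) :
    Nonempty (Bool × {u : Finset QVar // Disjoint u T} ≃ {u : Finset QVar // Disjoint u T}) :=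
  nonempty_equiv_of_countable

/-- The embedding of the basis states outside `T` that makes room for the bit `b`. -/
def flagEmb (T : Finset QVar) (b : Bool) :
    {u : Finset QVar // Disjoint u T} ↪ {u : Finset QVar // Disjoint u T} :=
  (Function.Embedding.sectR b _).trans (exists_flagEquiv T).some.toEmbedding

theorem flagEmb_apply (T : Finset QVar) (b : Bool) (u : {u : Finset QVar // Disjoint u T}) :
    flagEmb T b u = (exists_flagEquiv T).some (b, u) := rfl

/-- The isometry that stores the bit `b` in the qubits outside `T`. -/
def flagRest (T : Finset QVar) (b : Bool) : Rest T →L[ℂ] Rest T :=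
  (basisMap (flagEmb T b)).toContinuousLinearMap

theorem flagRest_basis (T : Finset QVar) (b : Bool) (u : {u : Finset QVar // Disjoint u T}) :
    flagRest T b (basis u) = basis (flagEmb T b u) := basisMap_basis _ _

/-- The two values of the bit give isometries with orthogonal ranges. Together with
`sum_flag_adjoint`, which says that the ranges fill the space, these are the Cuntz relations. -/
theorem adjoint_flagRest (T : Finset QVar) (b c : Bool) :
    (flagRest T b).adjoint ∘L flagRest T c = if b = c then 1 else 0 := by
  refine ext_inner_basis fun u v => ?_
  rw [ContinuousLinearMap.comp_apply, ContinuousLinearMap.adjoint_inner_right, flagRest_basis,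
    flagRest_basis, orthonormal_iff_ite.1 basis_orthonormal]
  have : flagEmb T b u = flagEmb T c v ↔ b = c ∧ u = v := by
    rw [flagEmb_apply, flagEmb_apply, (exists_flagEquiv T).some.injective.eq_iff, Prod.mk.injEq]
  simp only [this]
  by_cases h : b = c
  · rw [if_pos h, one_apply_eq_self, orthonormal_iff_ite.1 basis_orthonormal]
    simp only [h, true_and]
  · rw [if_neg h, if_neg (fun h' => h h'.1)]; simp

/-- The extension of `flagRest` to the environment. -/
def flag (T : Finset QVar) (b : Bool) : Env →L[ℂ] Env := onRest T (flagRest T b)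

theorem Outside.flag {S T : Finset QVar} (h : S ⊆ T) (b : Bool) : Outside S (flag T b) :=
  (Outside.onRest T _).anti h

theorem adjoint_flag_flag (T : Finset QVar) (b c : Bool) :
    (flag T b).adjoint ∘L flag T c = if b = c then 1 else 0 := by
  unfold flag
  rw [onRest_adjoint, onRest_comp, adjoint_flagRest]
  split_ifs
  · exact onRest_one T
  · exact onRest_zero T

theorem sum_flag_adjoint (T : Finset QVar) : ∑ b, flag T b ∘L (flag T b).adjoint = 1 := by
  unfold flag
  rw [Fintype.sum_bool]
  simp only [onRest_adjoint, onRest_comp]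
  rw [← onRest_add]
  suffices h : flagRest T true ∘L (flagRest T true).adjoint +
      flagRest T false ∘L (flagRest T false).adjoint = 1 by
    rw [h, onRest_one]
  refine ext_basis fun v => ?_
  obtain ⟨⟨b, u⟩, rfl⟩ := (exists_flagEquiv T).some.surjective v
  rw [← flagEmb_apply, ← flagRest_basis]
  have h := fun c => DFunLike.congr_fun (adjoint_flagRest T c b) (basis u)
  simp only [ContinuousLinearMap.comp_apply] at h
  rw [_root_.add_apply, ContinuousLinearMap.comp_apply, ContinuousLinearMap.comp_apply, h, h]
  cases b <;> simp

/-- Reading and erasing the bit is a measurement with two outcomes. -/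
theorem isKraus_adjoint_flag (T : Finset QVar) : IsKraus fun b => (flag T b).adjoint :=
  isKraus_of_sum_eq_one (by
    simp only [ContinuousLinearMap.adjoint_adjoint]
    exact sum_flag_adjoint T)

/-- The probability of finding the bit `false`. -/
def condMass (T : Finset QVar) (ρ : QState) : ℝ≥0∞ :=
  ((isKraus_adjoint_flag T).exists_select ρ).choose false

/-- The state after the bit `false` has been found and removed. -/
def cond (T : Finset QVar) (ρ : QState) : QState :=
  ((isKraus_adjoint_flag T).exists_select ρ).choose_spec.choose false

theorem condMass_le_one (T : Finset QVar) (ρ : QState) : condMass T ρ ≤ 1 := PMF.coe_le_one _ _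

theorem condMass_ne_top (T : Finset QVar) (ρ : QState) : condMass T ρ ≠ ∞ := PMF.apply_ne_top _ _

theorem condMass_smul_cond (T : Finset QVar) (ρ : QState) :
    ((condMass T ρ).toReal : ℂ) • (cond T ρ).op =
      (flag T false).adjoint ∘L ρ.op ∘L (flag T false).adjoint.adjoint :=
  ((isKraus_adjoint_flag T).exists_select ρ).choose_spec.choose_spec false

/-- This characterises the chosen probability and conditioned state by the unnormalised state; later
arguments need no other access to the choice. -/
theorem condMass_eq {T : Finset QVar} {ρ σ : QState} {p : ℝ≥0∞} (hp : p ≠ ∞)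
    (h : (p.toReal : ℂ) • σ.op =
      (flag T false).adjoint ∘L ρ.op ∘L (flag T false).adjoint.adjoint) :
    condMass T ρ = p ∧ (p ≠ 0 → cond T ρ = σ) := by
  rw [← condMass_smul_cond] at h
  obtain ⟨h1, h2⟩ := Density.eq_of_smul h.symm
  have e := (ENNReal.toReal_eq_toReal_iff' (condMass_ne_top T ρ) hp).1 h1
  refine ⟨e, fun h0 => h2 ?_⟩
  rw [e]
  exact (ENNReal.toReal_pos h0 hp).ne'

/-- The bit lies outside `S`, so its distribution is determined by the reduced state there. -/
theorem condMass_congr {S T : Finset QVar} (hS : S ⊆ T) {ρ σ : QState}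
    (h : ptr S ρ.op = ptr S σ.op) : condMass T ρ = condMass T σ := by
  refine (ENNReal.toReal_eq_toReal_iff' (condMass_ne_top T ρ) (condMass_ne_top T σ)).1
    (trace_eq_of_ptr_eq (S := S) (ρ := cond T ρ) (σ := cond T σ) ?_)
  rw [condMass_smul_cond, condMass_smul_cond, ptr_conj (Outside.flag hS _).adjoint,
    ptr_conj (Outside.flag hS _).adjoint, h]

theorem ptr_cond_eq {S T : Finset QVar} (hS : S ⊆ T) {ρ σ : QState}
    (h : ptr S ρ.op = ptr S σ.op) (h0 : condMass T ρ ≠ 0) :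
    ptr S (cond T ρ).op = ptr S (cond T σ).op := by
  have h1 : ∀ ρ : QState, ((condMass T ρ).toReal : ℂ) • ptr S (cond T ρ).op =
      compress S (flag T false).adjoint ∘L ptr S ρ.op ∘L
        (compress S (flag T false).adjoint).adjoint := by
    intro ρ
    rw [← ptr_conj (Outside.flag hS _).adjoint, ← condMass_smul_cond, ← ptrL_apply, ← ptrL_apply,
      map_smul]
  have h2 := h1 ρ
  rw [h, ← h1 σ, ← condMass_congr hS h] at h2
  exact smul_right_injective _ (Complex.ofReal_ne_zero.2
    (ENNReal.toReal_pos h0 (condMass_ne_top T ρ)).ne') h2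

end Flags

/-! ### Permuting the qubits in operators and states -/

section Permutations

/-- The image of a set of qubits under a permutation. -/
abbrev permS (π : Equiv.Perm QVar) (S : Finset QVar) : Finset QVar := S.map π.toEmbedding

theorem permS_permS (π π' : Equiv.Perm QVar) (S : Finset QVar) :
    permS π (permS π' S) = permS (π * π') S := by
  unfold permS
  rw [Finset.map_map]; rfl

theorem permS_one (S : Finset QVar) : permS 1 S = S := by
  ext x
  rw [Finset.mem_map_equiv]; rfl

theorem permS_inter (π : Equiv.Perm QVar) (S T : Finset QVar) :
    permS π (S ∩ T) = permS π S ∩ permS π T := Finset.map_inter _ _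

theorem permS_union (π : Equiv.Perm QVar) (S T : Finset QVar) :
    permS π (S ∪ T) = permS π S ∪ permS π T := Finset.map_union _ _

theorem permS_sdiff (π : Equiv.Perm QVar) (S T : Finset QVar) :
    permS π (S \ T) = permS π S \ permS π T := Finset.map_sdiff _ _

theorem permS_injective (π : Equiv.Perm QVar) : Function.Injective (permS π) :=
  Finset.map_injective _

/-- The unitary operator that permutes the qubits. -/
def permU (π : Equiv.Perm QVar) : Env →L[ℂ] Env :=
  (basisMap ⟨permS π, permS_injective π⟩).toContinuousLinearMap

theorem permU_basis (π : Equiv.Perm QVar) (u : Finset QVar) :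
    permU π (basis u) = basis (permS π u) := basisMap_basis _ _

theorem permU_comp (π π' : Equiv.Perm QVar) : permU π ∘L permU π' = permU (π * π') :=
  ext_basis fun u => by
    rw [ContinuousLinearMap.comp_apply, permU_basis, permU_basis, permU_basis, permS_permS]

theorem permU_one : permU 1 = 1 :=
  ext_basis fun u => by rw [permU_basis, permS_one]; rfl

theorem permU_adjoint (π : Equiv.Perm QVar) : (permU π).adjoint = permU π⁻¹ := by
  refine ext_inner_basis fun u v => ?_
  rw [ContinuousLinearMap.adjoint_inner_right, permU_basis, permU_basis,
    orthonormal_iff_ite.1 basis_orthonormal, orthonormal_iff_ite.1 basis_orthonormal]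
  have : permS π u = v ↔ u = permS π⁻¹ v := by
    constructor
    · rintro rfl; rw [permS_permS, inv_mul_cancel, permS_one]
    · rintro rfl; rw [permS_permS, mul_inv_cancel, permS_one]
  simp only [this]

theorem norm_permU (π : Equiv.Perm QVar) (ψ : Env) : ‖permU π ψ‖ = ‖ψ‖ :=
  (basisMap _).norm_map ψ

theorem isKraus_permU (π : Equiv.Perm QVar) : IsKraus fun _ : Unit => permU π := fun ψ => by
  simp only [norm_permU]
  exact hasSum_unique _

/-- The state in which the qubits have been permuted. -/
def permSt (π : Equiv.Perm QVar) (ρ : QState) : QState := (isKraus_permU π).apply ρ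

theorem permSt_op (π : Equiv.Perm QVar) (ρ : QState) :
    (permSt π ρ).op = permU π ∘L ρ.op ∘L (permU π).adjoint :=
  ((isKraus_permU π).hasSum_apply ρ).unique (hasSum_unique _)

theorem permSt_permSt (π π' : Equiv.Perm QVar) (ρ : QState) :
    permSt π (permSt π' ρ) = permSt (π * π') ρ := by
  refine Density.ext ?_
  rw [permSt_op, permSt_op, permSt_op, ← permU_comp, conj_conj]

theorem permSt_one (ρ : QState) : permSt 1 ρ = ρ := by
  refine Density.ext ?_
  rw [permSt_op, permU_adjoint, inv_one, permU_one]
  exact (ContinuousLinearMap.id_comp _).trans (ContinuousLinearMap.comp_id _)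

theorem permU_unit (π : Equiv.Perm QVar) {S a b : Finset QVar} (ha : a ⊆ S) (hb : b ⊆ S) :
    permU π ∘L unit S a b = unit (permS π S) (permS π a) (permS π b) ∘L permU π := by
  refine ext_basis fun u => ?_
  rw [ContinuousLinearMap.comp_apply, ContinuousLinearMap.comp_apply, unit_basis ha hb, permU_basis,
    unit_basis (Finset.map_subset_map.2 ha) (Finset.map_subset_map.2 hb)]
  have h : permS π u ∩ permS π S = permS π b ↔ u ∩ S = b := by
    rw [← permS_inter, (permS_injective π).eq_iff]
  by_cases h' : u ∩ S = b
  · rw [if_pos h', if_pos (h.2 h'), permU_basis, permS_union, permS_sdiff]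
  · rw [if_neg h', if_neg (mt h.1 h'), map_zero]

theorem permU_onVars (π : Equiv.Perm QVar) {n : ℕ} (q : Fin n ↪ QVar)
    (M : Matrix (Finset (Fin n)) (Finset (Fin n)) ℂ) :
    permU π ∘L onVars q M = onVars (q.trans π.toEmbedding) M ∘L permU π := by
  rw [onVars_eq, onVars_eq]
  simp only [ContinuousLinearMap.finsetSum_comp, ContinuousLinearMap.comp_finsetSum,
      ContinuousLinearMap.smul_comp, ContinuousLinearMap.comp_smul]
  refine Finset.sum_congr rfl fun a _ => Finset.sum_congr rfl fun b _ => ?_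
  rw [permU_unit π (map_subset_univ_map q a) (map_subset_univ_map q b)]
  unfold permS
  rw [Finset.map_map, Finset.map_map, Finset.map_map]

theorem Outside.perm (π : Equiv.Perm QVar) {S : Finset QVar} {B : Env →L[ℂ] Env}
    (hB : Outside S B) : Outside (permS π S) (permU π ∘L B ∘L (permU π).adjoint) := by
  have inv : ∀ ψ, permU π⁻¹ (permU π ψ) = ψ := fun ψ => by
    rw [← ContinuousLinearMap.comp_apply, permU_comp, inv_mul_cancel, permU_one]; rfl
  have inv' : ∀ ψ, permU π (permU π⁻¹ ψ) = ψ := fun ψ => by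
    rw [← ContinuousLinearMap.comp_apply, permU_comp, mul_inv_cancel, permU_one]; rfl
  have hs : ∀ a, a ⊆ permS π S → ∃ a', a' ⊆ S ∧ a = permS π a' := by
    intro a ha
    obtain ⟨u, hu, hu'⟩ := Finset.subset_map_iff.1 ha
    exact ⟨u, hu, hu'⟩
  intro a b ha hb
  obtain ⟨a, ha', rfl⟩ := hs a ha
  obtain ⟨b, hb', rfl⟩ := hs b hb
  have h1 := fun ψ => DFunLike.congr_fun (permU_unit π ha' hb') ψ
  have h2 := fun ψ => DFunLike.congr_fun (hB a b ha' hb') ψ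
  rw [permU_adjoint]
  ext1 ψ
  simp only [ContinuousLinearMap.comp_apply] at h1 h2 ⊢
  obtain ⟨φ, rfl⟩ : ∃ φ, ψ = permU π φ := ⟨_, (inv' ψ).symm⟩
  rw [← h1, h2, ← h1, inv, inv]

theorem ptr_perm (π : Equiv.Perm QVar) {S : Finset QVar} {ρ σ : QState}
    (h : ptr S ρ.op = ptr S σ.op) : ptr (permS π S) (permSt π ρ).op =
      ptr (permS π S) (permSt π σ).op := by
  rw [ptr_eq_iff] at h ⊢
  have key : ∀ (ρ : QState) (u v : Finset QVar),
      ∑ a ∈ (permS π S).powerset, ⟪basis (u ∪ a), (permSt π ρ).op (basis (v ∪ a))⟫_ℂ =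
        ∑ a ∈ S.powerset, ⟪basis (permS π⁻¹ u ∪ a), ρ.op (basis (permS π⁻¹ v ∪ a))⟫_ℂ := by
    intro ρ u v
    symm
    refine Finset.sum_bij (fun a _ => permS π a) ?_ ?_ ?_ ?_
    · intro a ha
      exact Finset.mem_powerset.2 (Finset.map_subset_map.2 (Finset.mem_powerset.1 ha))
    · intro a _ b _ e
      exact permS_injective π e
    · intro b hb
      obtain ⟨a, ha, hu'⟩ := Finset.subset_map_iff.1 (Finset.mem_powerset.1 hb)
      exact ⟨a, Finset.mem_powerset.2 ha, hu'.symm⟩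
    · intro a _
      have e : ∀ u, permS π⁻¹ (u ∪ permS π a) = permS π⁻¹ u ∪ a := fun u => by
        rw [permS_union, permS_permS, inv_mul_cancel, permS_one]
      rw [permSt_op, ContinuousLinearMap.comp_apply, ContinuousLinearMap.comp_apply,
        ← ContinuousLinearMap.adjoint_inner_left (permU π), permU_adjoint, permU_basis,
        permU_basis, e, e]
  intro u v hu hv
  rw [key, key]
  have hd : ∀ u, Disjoint u (permS π S) → Disjoint (permS π⁻¹ u) S := by
    intro u hu
    rw [← Finset.disjoint_map π.toEmbedding]
    change Disjoint (permS π (permS π⁻¹ u)) (permS π S)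
    rwa [permS_permS, mul_inv_cancel, permS_one]
  exact h _ _ (hd u hu) (hd v hv)

end Permutations

/-! ### Substitution, renaming and replacement of constants in terms -/

section Substitution

/-- First `s`, then `t`. -/
def CSubst.seq (s t : CSubst) : CSubst := fun x => (s x).or (t x)

theorem CSubst.erase_seq (s t : CSubst) (x : CVar) :
    (s.seq t).erase x = (s.erase x).seq (t.erase x) := by
  funext y
  unfold seq erase
  split_ifs <;> rfl

theorem CExp.subst_subst (s t : CSubst) (e : CExp) : (e.subst s).subst t = e.subst (s.seq t) := by
  refine CExp.ext ?_ (funext fun η => congrArg e.eval (funext fun x => ?_))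
  · ext x
    simp [CExp.subst, CSubst.seq, and_assoc]
  · unfold CSubst.seq
    cases s x <;> rfl

theorem BExp.subst_subst (s t : CSubst) (b : BExp) : (b.subst s).subst t = b.subst (s.seq t) := by
  refine BExp.ext ?_ (funext fun η => congrArg b.eval (funext fun x => ?_))
  · ext x
    simp [BExp.subst, CSubst.seq, and_assoc]
  · unfold CSubst.seq
    cases s x <;> rfl

theorem CExp.subst_congr {s t : CSubst} {e : CExp} (h : ∀ x ∈ e.fv, s x = t x) :
    e.subst s = e.subst t := by
  refine CExp.ext ?_ (funext fun η => e.eval_congr _ _ fun x hx => ?_)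
  · exact Finset.filter_congr fun x hx => by rw [h x hx]
  · rw [h x hx]

theorem BExp.subst_congr {s t : CSubst} {b : BExp} (h : ∀ x ∈ b.fv, s x = t x) :
    b.subst s = b.subst t := by
  refine BExp.ext ?_ (funext fun η => propext (b.eval_congr _ _ fun x hx => ?_))
  · exact Finset.filter_congr fun x hx => by rw [h x hx]
  · rw [h x hx]

theorem CExp.mem_fv_subst {s : CSubst} {e : CExp} {x : CVar} :
    x ∈ (e.subst s).fv ↔ x ∈ e.fv ∧ s x = none := Finset.mem_filter

theorem BExp.mem_fv_subst {s : CSubst} {b : BExp} {x : CVar} :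
    x ∈ (b.subst s).fv ↔ x ∈ b.fv ∧ s x = none := Finset.mem_filter

namespace Proc
variable {CC QC K K' : Type*}

theorem subst_subst (P : Proc CC QC K) (s t : CSubst) :
    (P.subst s).subst t = P.subst (s.seq t) := by
  induction P generalizing s t <;>
    simp_all [subst, CExp.subst_subst, BExp.subst_subst, CSubst.erase_seq]

theorem subst_congr {P : Proc CC QC K} {s t : CSubst} (h : ∀ x ∈ P.fv, s x = t x) :
    P.subst s = P.subst t := by
  induction P generalizing s t with
  | nil => rfl
  | tau P ih | qin c q P ih | qout c q P ih | oper E q P ih | rel P f ih | res P L ih =>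
    simp only [subst, ih h]
  | cin c x P ih | meas M q x P ih =>
    simp only [subst]
    rw [ih fun y hy => ?_]
    unfold CSubst.erase
    split_ifs with hyx
    · rfl
    · exact h y ⟨hy, hyx⟩
  | cout c e P ih =>
    simp only [subst]
    rw [ih fun y hy => h y (Or.inl hy), CExp.subst_congr fun y hy => h y (Or.inr hy)]
  | ite b P ih =>
    simp only [subst]
    rw [ih fun y hy => h y (Or.inl hy), BExp.subst_congr fun y hy => h y (Or.inr hy)]
  | sum P Q ih1 ih2 | par P Q ih1 ih2 =>
    simp only [subst]
    rw [ih1 fun y hy => h y (Or.inl hy), ih2 fun y hy => h y (Or.inr hy)]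
  | const A qs es =>
    simp only [subst]
    congr 1
    exact List.map_congr_left fun e he => CExp.subst_congr fun x hx => h x ⟨e, he, hx⟩

theorem mem_fv_subst {P : Proc CC QC K} {s : CSubst} {x : CVar} :
    x ∈ (P.subst s).fv ↔ x ∈ P.fv ∧ s x = none := by
  induction P generalizing s <;>
    simp_all [subst, fv, CExp.mem_fv_subst, BExp.mem_fv_subst, or_and_right, CSubst.erase]
  case cin => grind
  case meas => grind
  case const es => grind

theorem qv_subst (P : Proc CC QC K) (s : CSubst) : (P.subst s).qv = P.qv := by
  induction P generalizing s <;> simp_all [subst, qv]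

theorem qv_perm (P : Proc CC QC K) (π : Equiv.Perm QVar) : (P.perm π).qv = permS π P.qv := by
  induction P <;> simp_all [perm, qv, permS_union, permS_sdiff]
  case oper => simp [permS, Finset.map_map]
  case meas => simp [permS, Finset.map_map]
  case const qs es =>
    ext x
    rw [Finset.mem_map_equiv, List.mem_toFinset, List.mem_toFinset, List.mem_map]
    exact ⟨fun ⟨a, ha, e⟩ => by rw [← e]; simpa using ha, fun h => ⟨_, h, by simp⟩⟩

theorem qv_mapConst (g : K → K') (P : Proc CC QC K) : (P.mapConst g).qv = P.qv := by
  induction P <;> simp_all [mapConst, qv]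

theorem fv_perm (P : Proc CC QC K) (π : Equiv.Perm QVar) : (P.perm π).fv = P.fv := by
  induction P <;> simp_all [perm, fv]

theorem fv_mapConst (g : K → K') (P : Proc CC QC K) : (P.mapConst g).fv = P.fv := by
  induction P <;> simp_all [mapConst, fv]

theorem subst_perm (P : Proc CC QC K) (π : Equiv.Perm QVar) (s : CSubst) :
    (P.perm π).subst s = (P.subst s).perm π := by
  induction P generalizing s <;> simp_all [perm, subst]

theorem perm_perm (P : Proc CC QC K) (π π' : Equiv.Perm QVar) :
    (P.perm π').perm π = P.perm (π * π') := by
  induction P <;> simp_all [perm] <;> rfl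

theorem perm_one (P : Proc CC QC K) : P.perm 1 = P := by
  induction P <;> simp_all [perm] <;> rfl

theorem subst_mapConst (g : K → K') (P : Proc CC QC K) (s : CSubst) :
    (P.mapConst g).subst s = (P.subst s).mapConst g := by
  induction P generalizing s <;> simp_all [mapConst, subst]

theorem perm_mapConst (g : K → K') (P : Proc CC QC K) (π : Equiv.Perm QVar) :
    (P.mapConst g).perm π = (P.perm π).mapConst g := by
  induction P <;> simp_all [mapConst, perm]

theorem mapConst_mapConst {K'' : Type*} (g : K → K') (g' : K' → K'') (P : Proc CC QC K) :
    (P.mapConst g).mapConst g' = P.mapConst (g' ∘ g) := by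
  induction P <;> simp_all [mapConst]

theorem mapConst_id (P : Proc CC QC K) : P.mapConst id = P := by
  induction P <;> simp_all [mapConst]

theorem mapConst_congr {g g' : K → K'} {P : Proc CC QC K} (h : ∀ A ∈ P.consts, g A = g' A) :
    P.mapConst g = P.mapConst g' := by
  induction P <;> simp_all [mapConst, consts]

theorem consts_subst (P : Proc CC QC K) (s : CSubst) : (P.subst s).consts = P.consts := by
  induction P generalizing s <;> simp_all [subst, consts]

theorem consts_perm (P : Proc CC QC K) (π : Equiv.Perm QVar) : (P.perm π).consts = P.consts := by
  induction P <;> simp_all [perm, consts]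

theorem consts_mapConst (g : K → K') (P : Proc CC QC K) :
    (P.mapConst g).consts = g '' P.consts := by
  induction P <;> simp_all [mapConst, consts, Set.image_union]

variable {qa ca : K → ℕ}

theorem legal_subst {P : Proc CC QC K} {s : CSubst} :
    (P.subst s).Legal qa ca ↔ P.Legal qa ca := by
  induction P generalizing s <;> simp_all [subst, Legal, qv_subst]

theorem legal_perm {P : Proc CC QC K} {π : Equiv.Perm QVar} :
    (P.perm π).Legal qa ca ↔ P.Legal qa ca := by
  induction P <;> simp_all [perm, Legal, qv_perm]
  case const => exact fun _ _ => List.nodup_map_iff π.injective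

theorem legal_mapConst {qa ca : K' → ℕ} {g : K → K'} {P : Proc CC QC K} :
    (P.mapConst g).Legal qa ca ↔ P.Legal (qa ∘ g) (ca ∘ g) := by
  induction P <;> simp_all [mapConst, Legal, qv_mapConst]

variable {I : Type*}

theorem noVarInSum_subst {P : Proc CC QC (K ⊕ I)} {s : CSubst} :
    (P.subst s).NoVarInSum ↔ P.NoVarInSum := by
  induction P generalizing s <;> simp_all [subst, NoVarInSum, PExp.NoVar, consts_subst]

theorem noVarInSum_perm {P : Proc CC QC (K ⊕ I)} {π : Equiv.Perm QVar} :
    (P.perm π).NoVarInSum ↔ P.NoVarInSum := by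
  induction P <;> simp_all [perm, NoVarInSum, PExp.NoVar, consts_perm]

theorem noVarInSum_of_noVar {P : Proc CC QC (K ⊕ I)} (h : PExp.NoVar P) : P.NoVarInSum := by
  induction P <;> simp_all [NoVarInSum, PExp.NoVar, consts]

end Proc
end Substitution

/-! ### Simultaneous substitution for the formal parameters -/

section Parameters

theorem CSubst.ofLists_eq_none {xs : List CVar} {vs : List ℝ} (h : xs.length = vs.length)
    {x : CVar} (hx : x ∈ xs) : CSubst.ofLists xs vs x ≠ none := by
  induction xs generalizing vs with
  | nil => simp at hx
  | cons y ys ih =>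
    cases vs with
    | nil => simp at h
    | cons v vs =>
      unfold ofLists
      rw [List.zip_cons_cons, List.lookup_cons]
      by_cases hxy : x = y
      · simp [hxy]
      · have : (x == y) = false := by simpa using hxy
        rw [this]
        exact ih (by simpa using h) ((List.mem_cons.1 hx).resolve_left hxy)

end Parameters

variable {CC QC K : Type*} {D : Defs CC QC K}

/-! ### What transitions preserve -/

section Invariants

theorem permS_toFinset (π : Equiv.Perm QVar) (l : List QVar) :
    permS π l.toFinset = (l.map π).toFinset := by
  ext x
  rw [Finset.mem_map_equiv, List.mem_toFinset, List.mem_toFinset, List.mem_map]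
  exact ⟨fun h => ⟨_, h, by simp⟩, fun ⟨a, ha, e⟩ => by rw [← e]; simpa using ha⟩

theorem Step.finite_support {C : Con CC QC K} {α : Act CC QC} {Δ : PMF (Con CC QC K)}
    (h : Step D C α Δ) : Δ.support.Finite := by
  induction h with
  | meas => exact finite_support_bind (Set.toFinite _) fun _ _ => by simp
  | int_left P Q ρ α Δ _ _ ih | int_right P Q ρ α Δ _ _ ih => exact finite_support_map ih _
  | rel P f ρ α Δ _ ih | res P L ρ α Δ _ _ ih => exact finite_support_map ih _
  | sum_left _ _ _ _ _ _ ih | sum_right _ _ _ _ _ _ ih => exact ih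
  | ite _ _ _ _ _ _ _ ih => exact ih
  | const _ _ _ _ _ _ _ _ _ ih => exact ih
  | _ => simp

theorem mem_support_meas {n : ℕ} {M : Meas n} {x : CVar} {P : Proc CC QC K}
    {p : PMF (Finset (Fin n))} {σ : Finset (Fin n) → QState} {C : Con CC QC K}
    (h : C ∈ (p.bind fun i => PMF.pure
      (⟨P.subst (CSubst.single x (M.value i)), σ i⟩ : Con CC QC K)).support) :
    ∃ v, C.proc = P.subst (CSubst.single x v) := by
  obtain ⟨i, -, hi⟩ := (PMF.mem_support_bind_iff _ _ _).1 h
  rw [PMF.mem_support_pure_iff] at hi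
  exact ⟨_, congrArg Con.proc hi⟩

theorem body_qv_subset {A : K} {qs : List QVar} {π : Equiv.Perm QVar} {s : CSubst}
    (h : (D.qpar A).map π = qs) : (((D.body A).perm π).subst s).qv ⊆ qs.toFinset := by
  rw [Proc.qv_subst, Proc.qv_perm, ← h, ← permS_toFinset]
  exact Finset.map_subset_map.2 (D.qv_body A)

/-- The only way to acquire a qubit is to input it, and only a qubit that is owned can be sent. The
first part is needed for the second in the case of a quantum communication, where the qubit received
was already owned by the partner. -/
theorem Step.qv_subset {C : Con CC QC K} {α : Act CC QC} {Δ : PMF (Con CC QC K)}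
    (h : Step D C α Δ) : (∀ c r, α = .qout c r → r ∈ C.proc.qv) ∧
      ∀ C' ∈ Δ.support, C'.proc.qv ⊆ C.proc.qv ∪ α.qbv := by
  induction h with
  | qinp c q r P ρ hr =>
    refine ⟨by simp, fun C' hC => ?_⟩
    rw [PMF.mem_support_pure_iff] at hC
    subst hC
    intro x hx
    rw [Proc.qv_perm, Finset.mem_map_equiv] at hx
    simp only [Proc.qv, Act.qbv, Finset.mem_union, Finset.mem_sdiff, Finset.mem_singleton] at hr ⊢
    rw [Equiv.symm_swap] at hx
    by_cases h1 : x = r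
    · exact Or.inr h1
    · by_cases h2 : x = q
      · subst h2
        rw [Equiv.swap_apply_left] at hx
        have hrx : r = x := by
          by_contra h; exact hr ⟨hx, h⟩
        exact absurd hrx.symm h1
      · rw [Equiv.swap_apply_of_ne_of_ne h2 h1] at hx
        exact Or.inl ⟨hx, h2⟩
  | meas M q x P ρ p σ _ =>
    refine ⟨by simp, fun C' hC => ?_⟩
    obtain ⟨v, e⟩ := mem_support_meas hC
    rw [e, Proc.qv_subst]
    simp only [Proc.qv]
    intro y hy; simp [hy]
  | ccom_left c v P P' Q Q' ρ _ _ ih1 ih2 | ccom_right c v P P' Q Q' ρ _ _ ih1 ih2 =>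
    refine ⟨by simp, fun C' hC => ?_⟩
    rw [PMF.mem_support_pure_iff] at hC
    subst hC
    have h1 := ih1.2 _ ((PMF.mem_support_pure_iff _ _).2 rfl)
    have h2 := ih2.2 _ ((PMF.mem_support_pure_iff _ _).2 rfl)
    simp only [Act.qbv, Finset.union_empty, Proc.qv] at h1 h2 ⊢
    exact Finset.union_subset_union h1 h2
  | qcom_left c r P P' Q Q' ρ _ _ ih1 ih2 =>
    refine ⟨by simp, fun C' hC => ?_⟩
    rw [PMF.mem_support_pure_iff] at hC
    subst hC
    have h1 := ih1.2 _ ((PMF.mem_support_pure_iff _ _).2 rfl)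
    have h2 := ih2.2 _ ((PMF.mem_support_pure_iff _ _).2 rfl)
    have h3 := ih2.1 c r rfl
    simp only [Act.qbv, Finset.union_empty, Proc.qv] at h1 h2 ⊢
    refine Finset.union_subset (h1.trans (Finset.union_subset_union subset_rfl ?_))
      (h2.trans Finset.subset_union_right)
    simpa using h3
  | qcom_right c r P P' Q Q' ρ _ _ ih1 ih2 =>
    refine ⟨by simp, fun C' hC => ?_⟩
    rw [PMF.mem_support_pure_iff] at hC
    subst hC
    have h1 := ih1.2 _ ((PMF.mem_support_pure_iff _ _).2 rfl)
    have h2 := ih2.2 _ ((PMF.mem_support_pure_iff _ _).2 rfl)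
    have h3 := ih1.1 c r rfl
    simp only [Act.qbv, Finset.union_empty, Proc.qv] at h1 h2 ⊢
    refine Finset.union_subset (h1.trans Finset.subset_union_left)
      (h2.trans (Finset.union_subset Finset.subset_union_right ?_))
    simpa using Or.inl h3
  | int_left P Q ρ α Δ _ hd ih =>
    refine ⟨fun c r e => ?_, fun C' hC => ?_⟩
    · exact Finset.mem_union_left _ (ih.1 c r e)
    · rw [PMF.mem_support_map_iff] at hC
      obtain ⟨C, hC, rfl⟩ := hC
      have := ih.2 C hC
      simp only [Con.mapProc, Proc.qv] at this ⊢
      rw [Finset.union_right_comm]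
      exact Finset.union_subset_union this subset_rfl
  | int_right P Q ρ α Δ _ hd ih =>
    refine ⟨fun c r e => ?_, fun C' hC => ?_⟩
    · exact Finset.mem_union_right _ (ih.1 c r e)
    · rw [PMF.mem_support_map_iff] at hC
      obtain ⟨C, hC, rfl⟩ := hC
      have := ih.2 C hC
      simp only [Con.mapProc, Proc.qv] at this ⊢
      rw [Finset.union_assoc]
      exact Finset.union_subset_union subset_rfl this
  | rel P f ρ α Δ _ ih =>
    refine ⟨fun c r e => ?_, fun C' hC => ?_⟩
    · cases α <;> simp [Act.relabel] at e
      obtain ⟨-, rfl⟩ := e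
      exact ih.1 _ _ rfl
    · rw [PMF.mem_support_map_iff] at hC
      obtain ⟨C, hC, rfl⟩ := hC
      have e : (α.relabel f).qbv = α.qbv := by cases α <;> rfl
      rw [e]
      exact ih.2 C hC
  | res P L ρ α Δ _ _ ih =>
    refine ⟨ih.1, fun C' hC => ?_⟩
    rw [PMF.mem_support_map_iff] at hC
    obtain ⟨C, hC, rfl⟩ := hC
    exact ih.2 C hC
  | ite b P ρ α Δ _ _ ih => exact ih
  | const A qs es π ρ α Δ hq hs ih =>
    have hsub := body_qv_subset (D := D) (s := CSubst.ofLists (D.cpar A) (es.map CExp.val)) hq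
    exact ⟨fun c r e => hsub (ih.1 c r e), fun C' hC =>
      (ih.2 C' hC).trans (Finset.union_subset_union hsub subset_rfl)⟩
  | sum_left P Q ρ α Δ _ ih =>
    exact ⟨fun c r e => Finset.mem_union_left _ (ih.1 c r e), fun C' hC =>
      (ih.2 C' hC).trans (Finset.union_subset_union Finset.subset_union_left subset_rfl)⟩
  | sum_right P Q ρ α Δ _ ih =>
    exact ⟨fun c r e => Finset.mem_union_right _ (ih.1 c r e), fun C' hC =>
      (ih.2 C' hC).trans (Finset.union_subset_union Finset.subset_union_right subset_rfl)⟩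
  | tau | cinp | coutp | qoutp | oper =>
    refine ⟨by simp [Proc.qv], fun C' hC => ?_⟩
    rw [PMF.mem_support_pure_iff] at hC
    subst hC
    simp only [Proc.qv, Proc.qv_subst]
    intro y hy; simp [hy]
theorem closed_body {A : K} {qs : List QVar} {es : List CExp} (π : Equiv.Perm QVar)
    (hl : D.Legal (.const A qs es)) :
    (((D.body A).perm π).subst (CSubst.ofLists (D.cpar A) (es.map CExp.val))).fv = ∅ := by
  ext x
  rw [Proc.mem_fv_subst, Proc.fv_perm]
  simp only [Set.mem_empty_iff_false, iff_false, not_and]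
  intro hx
  exact CSubst.ofLists_eq_none (by rw [List.length_map]; exact hl.2.2.symm) (D.fv_body A x hx)

theorem legal_body (A : K) (π : Equiv.Perm QVar) (s : CSubst) :
    D.Legal (((D.body A).perm π).subst s) :=
  Proc.legal_subst.2 (Proc.legal_perm.2 (D.legal_body A))

theorem closed_single {P : Proc CC QC K} {x : CVar} {v : ℝ} (h : P.fv \ {x} = ∅) :
    (P.subst (CSubst.single x v)).fv = ∅ := by
  ext y
  rw [Proc.mem_fv_subst]
  simp only [Set.mem_empty_iff_false, iff_false, not_and]
  intro hy
  have : y = x := by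
    by_contra hne
    exact (Set.ext_iff.1 h y).1 ⟨hy, hne⟩
  simp [CSubst.single, this]

/-- Transitions preserve closed legal terms, and quantum variables that are sent are given up. -/
theorem Step.preserves {C : Con CC QC K} {α : Act CC QC} {Δ : PMF (Con CC QC K)}
    (h : Step D C α Δ) (hl : D.Legal C.proc) :
    ∀ C' ∈ Δ.support, D.Legal C'.proc ∧ (C.proc.fv = ∅ → C'.proc.fv = ∅) ∧
      ∀ c r, α = .qout c r → r ∉ C'.proc.qv := by
  unfold Defs.Legal at hl ⊢
  induction h with
  | tau | coutp | oper =>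
    intro C' hC
    rw [PMF.mem_support_pure_iff] at hC
    subst hC
    simp_all [Proc.Legal, Proc.fv]
  | cinp c x P ρ v =>
    intro C' hC
    rw [PMF.mem_support_pure_iff] at hC
    subst hC
    exact ⟨Proc.legal_subst.2 hl, closed_single, by simp⟩
  | qinp c q r P ρ hr =>
    intro C' hC
    rw [PMF.mem_support_pure_iff] at hC
    subst hC
    exact ⟨Proc.legal_perm.2 hl, fun h => (Proc.fv_perm _ _).trans h, by simp⟩
  | qoutp c q P ρ =>
    intro C' hC
    rw [PMF.mem_support_pure_iff] at hC
    subst hC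
    refine ⟨hl.2, id, fun c r e => ?_⟩
    cases e
    exact hl.1
  | meas M q x P ρ p σ _ =>
    intro C' hC
    obtain ⟨v, e⟩ := mem_support_meas hC
    rw [e]
    exact ⟨Proc.legal_subst.2 hl, closed_single, by simp⟩
  | ccom_left c v P P' Q Q' ρ h1 h2 ih1 ih2 | ccom_right c v P P' Q Q' ρ h1 h2 ih1 ih2 =>
    intro C' hC
    rw [PMF.mem_support_pure_iff] at hC
    subst hC
    have i1 := ih1 hl.2.1 _ ((PMF.mem_support_pure_iff _ _).2 rfl)
    have i2 := ih2 hl.2.2 _ ((PMF.mem_support_pure_iff _ _).2 rfl)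
    have q1 := h1.qv_subset.2 _ ((PMF.mem_support_pure_iff _ _).2 rfl)
    have q2 := h2.qv_subset.2 _ ((PMF.mem_support_pure_iff _ _).2 rfl)
    simp only [Act.qbv, Finset.union_empty] at q1 q2
    refine ⟨⟨hl.1.mono q1 q2, i1.1, i2.1⟩, fun h => ?_, by simp⟩
    simp only [Proc.fv, Set.union_empty_iff] at h ⊢
    exact ⟨i1.2.1 h.1, i2.2.1 h.2⟩
  | qcom_left c r P P' Q Q' ρ h1 h2 ih1 ih2 =>
    intro C' hC
    rw [PMF.mem_support_pure_iff] at hC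
    subst hC
    have i1 := ih1 hl.2.1 _ ((PMF.mem_support_pure_iff _ _).2 rfl)
    have i2 := ih2 hl.2.2 _ ((PMF.mem_support_pure_iff _ _).2 rfl)
    have q1 := h1.qv_subset.2 _ ((PMF.mem_support_pure_iff _ _).2 rfl)
    have q2 := h2.qv_subset.2 _ ((PMF.mem_support_pure_iff _ _).2 rfl)
    simp only [Act.qbv, Finset.union_empty] at q1 q2
    -- The receiver gains `r`, which is harmless because the sender has given it up.
    refine ⟨⟨Disjoint.mono_left q1 (Finset.disjoint_union_left.2 ⟨hl.1.mono_right q2, ?_⟩), i1.1,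
      i2.1⟩, fun h => ?_, by simp⟩
    · simpa using i2.2.2 c r rfl
    · simp only [Proc.fv, Set.union_empty_iff] at h ⊢
      exact ⟨i1.2.1 h.1, i2.2.1 h.2⟩
  | qcom_right c r P P' Q Q' ρ h1 h2 ih1 ih2 =>
    intro C' hC
    rw [PMF.mem_support_pure_iff] at hC
    subst hC
    have i1 := ih1 hl.2.1 _ ((PMF.mem_support_pure_iff _ _).2 rfl)
    have i2 := ih2 hl.2.2 _ ((PMF.mem_support_pure_iff _ _).2 rfl)
    have q1 := h1.qv_subset.2 _ ((PMF.mem_support_pure_iff _ _).2 rfl)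
    have q2 := h2.qv_subset.2 _ ((PMF.mem_support_pure_iff _ _).2 rfl)
    simp only [Act.qbv, Finset.union_empty] at q1 q2
    refine ⟨⟨Disjoint.mono_right q2 (Finset.disjoint_union_right.2 ⟨hl.1.mono_left q1, ?_⟩), i1.1,
      i2.1⟩, fun h => ?_, by simp⟩
    · simpa using i1.2.2 c r rfl
    · simp only [Proc.fv, Set.union_empty_iff] at h ⊢
      exact ⟨i1.2.1 h.1, i2.2.1 h.2⟩
  | int_left P Q ρ α Δ h1 hd ih =>
    intro C' hC
    rw [PMF.mem_support_map_iff] at hC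
    obtain ⟨C, hC, rfl⟩ := hC
    have i1 := ih hl.2.1 _ hC
    have q1 := h1.qv_subset.2 _ hC
    refine ⟨⟨Disjoint.mono_left q1 (Finset.disjoint_union_left.2 ⟨hl.1, hd⟩), i1.1, hl.2.2⟩,
      fun h => ?_, fun c r e => ?_⟩
    · simp only [Proc.fv, Set.union_empty_iff, Con.mapProc] at h ⊢
      exact ⟨i1.2.1 h.1, h.2⟩
    · simp only [Con.mapProc, Proc.qv, Finset.mem_union, not_or]
      exact ⟨i1.2.2 c r e, Finset.disjoint_left.1 hl.1 (h1.qv_subset.1 c r e)⟩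
  | int_right P Q ρ α Δ h1 hd ih =>
    intro C' hC
    rw [PMF.mem_support_map_iff] at hC
    obtain ⟨C, hC, rfl⟩ := hC
    have i1 := ih hl.2.2 _ hC
    have q1 := h1.qv_subset.2 _ hC
    refine ⟨⟨Disjoint.mono_right q1 (Finset.disjoint_union_right.2 ⟨hl.1, hd.symm⟩), hl.2.1, i1.1⟩,
      fun h => ?_, fun c r e => ?_⟩
    · simp only [Proc.fv, Set.union_empty_iff, Con.mapProc] at h ⊢
      exact ⟨h.1, i1.2.1 h.2⟩
    · simp only [Con.mapProc, Proc.qv, Finset.mem_union, not_or]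
      exact ⟨Finset.disjoint_right.1 hl.1 (h1.qv_subset.1 c r e), i1.2.2 c r e⟩
  | sum_left P Q ρ α Δ _ ih =>
    intro C' hC
    have i1 := ih hl.1 _ hC
    refine ⟨i1.1, fun h => i1.2.1 ?_, i1.2.2⟩
    simp only [Proc.fv, Set.union_empty_iff] at h
    exact h.1
  | sum_right P Q ρ α Δ _ ih =>
    intro C' hC
    have i1 := ih hl.2 _ hC
    refine ⟨i1.1, fun h => i1.2.1 ?_, i1.2.2⟩
    simp only [Proc.fv, Set.union_empty_iff] at h
    exact h.2
  | rel P f ρ α Δ _ ih =>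
    intro C' hC
    rw [PMF.mem_support_map_iff] at hC
    obtain ⟨C, hC, rfl⟩ := hC
    have i1 := ih hl _ hC
    refine ⟨i1.1, i1.2.1, fun c r e => ?_⟩
    cases α <;> simp [Act.relabel] at e
    obtain ⟨-, rfl⟩ := e
    exact i1.2.2 _ _ rfl
  | res P L ρ α Δ _ _ ih =>
    intro C' hC
    rw [PMF.mem_support_map_iff] at hC
    obtain ⟨C, hC, rfl⟩ := hC
    have i1 := ih hl _ hC
    exact ⟨i1.1, i1.2.1, i1.2.2⟩
  | ite b P ρ α Δ _ _ ih =>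
    intro C' hC
    have i1 := ih hl _ hC
    refine ⟨i1.1, fun h => i1.2.1 ?_, i1.2.2⟩
    simp only [Proc.fv, Set.union_empty_iff] at h
    exact h.1
  | const A qs es π ρ α Δ hq hs ih =>
    intro C' hC
    have i1 := ih (legal_body A π _) _ hC
    exact ⟨i1.1, fun _ => i1.2.1 (closed_body π hl), i1.2.2⟩

/-- Visible actions have a single target and neither depend on the state nor change it. -/
theorem Step.visible {C : Con CC QC K} {α : Act CC QC} {Δ : PMF (Con CC QC K)}
    (h : Step D C α Δ) (hα : α ≠ .tau) :
    ∃ P', Δ = PMF.pure ⟨P', C.st⟩ ∧ ∀ ρ, Step D ⟨C.proc, ρ⟩ α (PMF.pure ⟨P', ρ⟩) := by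
  induction h with
  | tau | ccom_left | ccom_right | qcom_left | qcom_right | oper | meas => exact absurd rfl hα
  | cinp c x P ρ v => exact ⟨_, rfl, fun ρ => .cinp c x P ρ v⟩
  | coutp c e P ρ => exact ⟨_, rfl, fun ρ => .coutp c e P ρ⟩
  | qinp c q r P ρ hr => exact ⟨_, rfl, fun ρ => .qinp c q r P ρ hr⟩
  | qoutp c q P ρ => exact ⟨_, rfl, fun ρ => .qoutp c q P ρ⟩
  | int_left P Q ρ α Δ _ hd ih =>
    obtain ⟨P', rfl, h⟩ := ih hα
    refine ⟨_, PMF.pure_map _ _, fun ρ => ?_⟩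
    simpa [PMF.pure_map, Con.mapProc] using Step.int_left P Q ρ α _ (h ρ) hd
  | int_right P Q ρ α Δ _ hd ih =>
    obtain ⟨P', rfl, h⟩ := ih hα
    refine ⟨_, PMF.pure_map _ _, fun ρ => ?_⟩
    simpa [PMF.pure_map, Con.mapProc] using Step.int_right P Q ρ α _ (h ρ) hd
  | sum_left P Q ρ α Δ _ ih =>
    obtain ⟨P', e, h⟩ := ih hα
    exact ⟨P', e, fun ρ => .sum_left P Q ρ α _ (h ρ)⟩
  | sum_right P Q ρ α Δ _ ih =>
    obtain ⟨P', e, h⟩ := ih hα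
    exact ⟨P', e, fun ρ => .sum_right P Q ρ α _ (h ρ)⟩
  | rel P f ρ α Δ _ ih =>
    obtain ⟨P', rfl, h⟩ := ih (by rintro rfl; exact hα rfl)
    refine ⟨_, PMF.pure_map _ _, fun ρ => ?_⟩
    simpa [PMF.pure_map, Con.mapProc] using Step.rel P f ρ α _ (h ρ)
  | res P L ρ α Δ _ hd ih =>
    obtain ⟨P', rfl, h⟩ := ih hα
    refine ⟨_, PMF.pure_map _ _, fun ρ => ?_⟩
    simpa [PMF.pure_map, Con.mapProc] using Step.res P L ρ α _ (h ρ) hd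
  | ite b P ρ α Δ _ hb ih =>
    obtain ⟨P', e, h⟩ := ih hα
    exact ⟨P', e, fun ρ => .ite b P ρ α _ (h ρ) hb⟩
  | const A qs es π ρ α Δ hq hs ih =>
    obtain ⟨P', e, h⟩ := ih hα
    exact ⟨P', e, fun ρ => .const A qs es π ρ α _ hq (h ρ)⟩

end Invariants

/-! ### Transitions as instruments on the qubits of the process -/

section Instruments

/-- `Δ` is a possible result of applying an instrument to the state `ρ`; the outcome `i` has the
Kraus operators `X i j` and leads to the term `P i`. -/
def InstrResult {ι κ : Type} [Fintype κ] (X : ι → κ → Env →L[ℂ] Env) (P : ι → Proc CC QC K)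
    (ρ : QState) (Δ : PMF (Con CC QC K)) : Prop :=
  ∃ (p : PMF ι) (σ : ι → QState),
    (∀ i, ((p i).toReal : ℂ) • (σ i).op = ∑ j, X i j ∘L ρ.op ∘L (X i j).adjoint) ∧
    Δ = p.bind fun i => PMF.pure ⟨P i, σ i⟩

/-- An instrument with a single outcome is a super-operator, and its result is deterministic. -/
theorem instrResult_unit {κ : Type} [Fintype κ] {A : κ → Env →L[ℂ] Env} (hA : IsKraus A)
    (P : Proc CC QC K) (ρ : QState) (Δ : PMF (Con CC QC K)) :
    InstrResult (fun (_ : Unit) j => A j) (fun _ => P) ρ Δ ↔ Δ = PMF.pure ⟨P, hA.apply ρ⟩ := by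
  have e : (hA.apply ρ).op = ∑ j, A j ∘L ρ.op ∘L (A j).adjoint :=
    (hA.hasSum_apply ρ).unique (hasSum_fintype _)
  constructor
  · rintro ⟨p, σ, h, rfl⟩
    have hp : p = PMF.pure () := by
      ext i
      have := p.tsum_coe
      rw [tsum_eq_single () (by simp)] at this
      simpa using this
    have h1 := h ()
    subst hp
    rw [← e, PMF.pure_apply_self] at h1
    simp only [ENNReal.toReal_one, Complex.ofReal_one, one_smul] at h1
    rw [PMF.pure_bind, Density.ext h1]
  · rintro rfl
    refine ⟨PMF.pure (), fun _ => hA.apply ρ, fun i => ?_, by rw [PMF.pure_bind]⟩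
    rw [← e, show i = () from rfl, PMF.pure_apply_self]
    simp

theorem InstrResult.map {ι κ : Type} [Fintype κ] {X : ι → κ → Env →L[ℂ] Env}
    {P : ι → Proc CC QC K} {ρ : QState} {Δ : PMF (Con CC QC K)}
    (h : InstrResult X P ρ Δ) (g : Proc CC QC K → Proc CC QC K) :
    InstrResult X (fun i => g (P i)) ρ (Δ.map (Con.mapProc g)) := by
  obtain ⟨p, σ, h, rfl⟩ := h
  exact ⟨p, σ, h, by simp [PMF.map_bind, PMF.pure_map, Con.mapProc]⟩

theorem InstrResult.exists_of_map {ι κ : Type} [Fintype κ] {X : ι → κ → Env →L[ℂ] Env}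
    {P : ι → Proc CC QC K} {ρ : QState} {Δ : PMF (Con CC QC K)} {g : Proc CC QC K → Proc CC QC K}
    (h : InstrResult X (fun i => g (P i)) ρ Δ) :
    ∃ Δ', InstrResult X P ρ Δ' ∧ Δ = Δ'.map (Con.mapProc g) := by
  obtain ⟨p, σ, h, rfl⟩ := h
  exact ⟨_, ⟨p, σ, h, rfl⟩, by simp [PMF.map_bind, PMF.pure_map, Con.mapProc]⟩

/-- The term `P` can perform `α` by applying an instrument to its qubits. -/
structure IsInstr (D : Defs CC QC K) (P : Proc CC QC K) (α : Act CC QC) {ι κ : Type} [Fintype ι]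
    [Fintype κ] (X : ι → κ → Env →L[ℂ] Env) (P' : ι → Proc CC QC K) : Prop where
  isKraus : IsKraus fun x : ι × κ => X x.1 x.2
  isLocal : ∀ i j, Local P.qv (X i j)
  exists_result : ∀ ρ, ∃ Δ, InstrResult X P' ρ Δ
  step : ∀ ρ Δ, InstrResult X P' ρ Δ → Step D ⟨P, ρ⟩ α Δ

theorem IsInstr.lift {P P₁ : Proc CC QC K} {α α₁ : Act CC QC} {ι κ : Type} [Fintype ι] [Fintype κ]
    {X : ι → κ → Env →L[ℂ] Env} {P' : ι → Proc CC QC K} (h : IsInstr D P α X P')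
    (g : Proc CC QC K → Proc CC QC K) (hq : P.qv ⊆ P₁.qv)
    (hs : ∀ ρ Δ, Step D ⟨P, ρ⟩ α Δ → Step D ⟨P₁, ρ⟩ α₁ (Δ.map (Con.mapProc g))) :
    IsInstr D P₁ α₁ X fun i => g (P' i) where
  isKraus := h.isKraus
  isLocal i j := (h.isLocal i j).mono hq
  exists_result ρ := (h.exists_result ρ).imp' _ fun _ hΔ => hΔ.map g
  step ρ Δ hΔ := by
    obtain ⟨Δ', h', rfl⟩ := hΔ.exists_of_map
    exact hs ρ Δ' (h.step ρ Δ' h')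

theorem mapProc_id : Con.mapProc (CC := CC) (QC := QC) (K := K) id = id := rfl

theorem IsInstr.lift_id {P P₁ : Proc CC QC K} {α α₁ : Act CC QC} {ι κ : Type} [Fintype ι]
    [Fintype κ] {X : ι → κ → Env →L[ℂ] Env} {P' : ι → Proc CC QC K} (h : IsInstr D P α X P')
    (hq : P.qv ⊆ P₁.qv) (hs : ∀ ρ Δ, Step D ⟨P, ρ⟩ α Δ → Step D ⟨P₁, ρ⟩ α₁ Δ) :
    IsInstr D P₁ α₁ X P' :=
  h.lift id hq fun ρ Δ h => by rw [mapProc_id, PMF.map_id]; exact hs ρ Δ h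

theorem isKraus_unit {κ : Type} {A : κ → Env →L[ℂ] Env} (hA : IsKraus A) :
    IsKraus fun x : Unit × κ => A x.2 := fun ψ =>
  (Equiv.hasSum_iff (Equiv.uniqueProd κ Unit) (f := fun k => ‖A k ψ‖ ^ 2)).2 (hA ψ)

theorem isKraus_one : IsKraus fun _ : Unit => (1 : Env →L[ℂ] Env) := fun ψ =>
  hasSum_unique (fun _ : Unit => ‖(1 : Env →L[ℂ] Env) ψ‖ ^ 2)

theorem isKraus_one_apply (ρ : QState) : isKraus_one.apply ρ = ρ :=
  Density.ext <| ((isKraus_one.hasSum_apply ρ).unique (hasSum_unique _)).trans <| by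
    rw [← ContinuousLinearMap.star_eq_adjoint, star_one]
    exact (ContinuousLinearMap.id_comp _).trans (ContinuousLinearMap.comp_id _)

theorem IsInstr.of_kraus {P P' : Proc CC QC K} {α : Act CC QC} {κ : Type} [Fintype κ]
    {A : κ → Env →L[ℂ] Env} (hA : IsKraus A) (hl : ∀ j, Local P.qv (A j))
    (hs : ∀ ρ, Step D ⟨P, ρ⟩ α (PMF.pure ⟨P', hA.apply ρ⟩)) :
    IsInstr D P α (fun (_ : Unit) j => A j) fun _ => P' where
  isKraus := isKraus_unit hA
  isLocal _ j := hl j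
  exists_result ρ := ⟨_, (instrResult_unit hA P' ρ _).2 rfl⟩
  step ρ Δ h := by
    rw [(instrResult_unit hA P' ρ _).1 h]
    exact hs ρ

theorem IsInstr.of_pure {P P' : Proc CC QC K} {α : Act CC QC}
    (hs : ∀ ρ, Step D ⟨P, ρ⟩ α (PMF.pure ⟨P', ρ⟩)) :
    IsInstr D P α (fun (_ : Unit) (_ : Unit) => 1) fun _ => P' :=
  .of_kraus isKraus_one (fun _ => Local.one _) fun ρ => by rw [isKraus_one_apply]; exact hs ρ

theorem instrResult_pure (P' : Proc CC QC K) (ρ : QState) :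
    InstrResult (fun (_ : Unit) (_ : Unit) => 1) (fun _ => P') ρ (PMF.pure ⟨P', ρ⟩) :=
  (instrResult_unit isKraus_one P' ρ _).2 (by rw [isKraus_one_apply])

theorem Meas.result_iff {n : ℕ} (M : Meas n) (q : Fin n ↪ QVar) (ρ : QState)
    (p : PMF (Finset (Fin n))) (σ : Finset (Fin n) → QState) : M.Result q ρ p σ ↔
      ∀ i, ((p i).toReal : ℂ) • (σ i).op =
        ∑ _j : Unit, onVars q (M.proj i) ∘L ρ.op ∘L (onVars q (M.proj i)).adjoint := by
  unfold Meas.Result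
  simp [onVars_adjoint, M.proj_conjTranspose]

/-- Each transition arises from an instrument on the qubits of the term, which can be applied in
all states. -/
theorem Step.exists_instr {C : Con CC QC K} {α : Act CC QC} {Δ : PMF (Con CC QC K)}
    (h : Step D C α Δ) : ∃ (ι κ : Type) (_ : Fintype ι) (_ : Fintype κ)
      (X : ι → κ → Env →L[ℂ] Env) (P' : ι → Proc CC QC K),
      IsInstr D C.proc α X P' ∧ InstrResult X P' C.st Δ := by
  have of_pure : ∀ {P P' : Proc CC QC K} {ρ : QState} {α : Act CC QC},
      (∀ ρ, Step D ⟨P, ρ⟩ α (PMF.pure ⟨P', ρ⟩)) →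
      ∃ (ι κ : Type) (_ : Fintype ι) (_ : Fintype κ)
        (X : ι → κ → Env →L[ℂ] Env) (P₁ : ι → Proc CC QC K),
        IsInstr D P α X P₁ ∧ InstrResult X P₁ ρ (PMF.pure ⟨P', ρ⟩) := fun hs =>
    ⟨_, _, _, _, _, _, .of_pure hs, instrResult_pure _ _⟩
  -- The two halves of a communication are visible steps, hence available in every state; so is the
  -- communication.
  have vis : ∀ {P P' : Proc CC QC K} {ρ : QState} {α : Act CC QC}, α ≠ .tau →
      Step D ⟨P, ρ⟩ α (PMF.pure ⟨P', ρ⟩) → ∀ ρ', Step D ⟨P, ρ'⟩ α (PMF.pure ⟨P', ρ'⟩) := by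
    intro P P' ρ α hα h ρ'
    obtain ⟨P'', e, h''⟩ := h.visible hα
    have e' : (⟨P', ρ⟩ : Con CC QC K) ∈ (PMF.pure (⟨P'', ρ⟩ : Con CC QC K)).support := by
      rw [← e]; simp
    rw [PMF.mem_support_pure_iff, Con.mk.injEq] at e'
    rw [e'.1]
    exact h'' ρ'
  induction h with
  | tau P ρ => exact of_pure fun ρ => .tau P ρ
  | cinp c x P ρ v => exact of_pure fun ρ => .cinp c x P ρ v
  | coutp c e P ρ => exact of_pure fun ρ => .coutp c e P ρ
  | qinp c q r P ρ hr => exact of_pure fun ρ => .qinp c q r P ρ hr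
  | qoutp c q P ρ => exact of_pure fun ρ => .qoutp c q P ρ
  | ccom_left c v P P' Q Q' ρ h1 h2 =>
    exact of_pure fun ρ => .ccom_left c v P P' Q Q' ρ (vis (by simp) h1 ρ) (vis (by simp) h2 ρ)
  | ccom_right c v P P' Q Q' ρ h1 h2 =>
    exact of_pure fun ρ => .ccom_right c v P P' Q Q' ρ (vis (by simp) h1 ρ) (vis (by simp) h2 ρ)
  | qcom_left c v P P' Q Q' ρ h1 h2 =>
    exact of_pure fun ρ => .qcom_left c v P P' Q Q' ρ (vis (by simp) h1 ρ) (vis (by simp) h2 ρ)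
  | qcom_right c v P P' Q Q' ρ h1 h2 =>
    exact of_pure fun ρ => .qcom_right c v P P' Q Q' ρ (vis (by simp) h1 ρ) (vis (by simp) h2 ρ)
  | oper E q P ρ =>
    exact ⟨_, _, _, _, _, _, .of_kraus (IsKraus.onVars q E.sum_eq_one)
      (fun j => Local.onVars q Finset.subset_union_right _) (fun ρ => .oper E q P ρ),
      (instrResult_unit _ P ρ _).2 rfl⟩
  | @meas n M q x P ρ p σ hr =>
    refine ⟨Finset (Fin n), Unit, inferInstance, inferInstance, fun i _ => onVars q (M.proj i),
      fun i => P.subst (CSubst.single x (M.value i)), ⟨?_, ?_, ?_, ?_⟩, p, σ,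
        (M.result_iff q ρ p σ).1 hr, rfl⟩
    · exact fun ψ => (Equiv.hasSum_iff (Equiv.prodUnique _ Unit)
        (f := fun k => ‖onVars q (M.proj k) ψ‖ ^ 2)).2 (IsKraus.onVars q M.sum_proj ψ)
    · exact fun i j => Local.onVars q Finset.subset_union_right _
    · intro ρ
      obtain ⟨p, σ, h⟩ := M.exists_result q ρ
      exact ⟨_, p, σ, (M.result_iff q ρ p σ).1 h, rfl⟩
    · rintro ρ Δ ⟨p, σ, h, rfl⟩
      exact .meas M q x P ρ p σ ((M.result_iff q ρ p σ).2 h)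
  | int_left P Q ρ α Δ _ hd ih =>
    obtain ⟨ι, κ, _, _, X, P', h1, h2⟩ := ih
    exact ⟨ι, κ, _, _, X, _, h1.lift (fun P' => .par P' Q) Finset.subset_union_left
      fun ρ Δ hs => .int_left P Q ρ α Δ hs hd, h2.map _⟩
  | int_right P Q ρ α Δ _ hd ih =>
    obtain ⟨ι, κ, _, _, X, P', h1, h2⟩ := ih
    exact ⟨ι, κ, _, _, X, _, h1.lift (fun Q' => .par P Q') Finset.subset_union_right
      fun ρ Δ hs => .int_right P Q ρ α Δ hs hd, h2.map _⟩
  | sum_left P Q ρ α Δ _ ih =>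
    obtain ⟨ι, κ, _, _, X, P', h1, h2⟩ := ih
    exact ⟨ι, κ, _, _, X, _, h1.lift_id Finset.subset_union_left
      fun ρ Δ hs => .sum_left P Q ρ α Δ hs, h2⟩
  | sum_right P Q ρ α Δ _ ih =>
    obtain ⟨ι, κ, _, _, X, P', h1, h2⟩ := ih
    exact ⟨ι, κ, _, _, X, _, h1.lift_id Finset.subset_union_right
      fun ρ Δ hs => .sum_right P Q ρ α Δ hs, h2⟩
  | rel P f ρ α Δ _ ih =>
    obtain ⟨ι, κ, _, _, X, P', h1, h2⟩ := ih
    exact ⟨ι, κ, _, _, X, _, h1.lift (fun P' => .rel P' f) subset_rfl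
      fun ρ Δ hs => .rel P f ρ α Δ hs, h2.map _⟩
  | res P L ρ α Δ _ hd ih =>
    obtain ⟨ι, κ, _, _, X, P', h1, h2⟩ := ih
    exact ⟨ι, κ, _, _, X, _, h1.lift (fun P' => .res P' L) subset_rfl
      fun ρ Δ hs => .res P L ρ α Δ hs hd, h2.map _⟩
  | ite b P ρ α Δ _ hb ih =>
    obtain ⟨ι, κ, _, _, X, P', h1, h2⟩ := ih
    exact ⟨ι, κ, _, _, X, _, h1.lift_id subset_rfl fun ρ Δ hs => .ite b P ρ α Δ hs hb, h2⟩
  | const A qs es π ρ α Δ hq hs ih =>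
    obtain ⟨ι, κ, _, _, X, P', h1, h2⟩ := ih
    exact ⟨ι, κ, _, _, X, _, h1.lift_id (body_qv_subset hq)
      fun ρ Δ hs => .const A qs es π ρ α Δ hq hs, h2⟩

end Instruments

/-! ### Conditioning commutes with transitions -/

section Conditioning

/-- The configuration after the bit `false` has been found and removed. -/
def condCon (T : Finset QVar) (C : Con CC QC K) : Con CC QC K := ⟨C.proc, cond T C.st⟩

/-- The probability of finding the bit `false`. -/
def conMass (T : Finset QVar) (C : Con CC QC K) : ℝ≥0∞ := condMass T C.st

theorem conMass_le_one (T : Finset QVar) (C : Con CC QC K) : conMass T C ≤ 1 := condMass_le_one _ _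

/-- The distribution `Δ` conditioned on finding the bit `false`. -/
def condDist (T : Finset QVar) (Δ : PMF (Con CC QC K)) : PMF (Con CC QC K) :=
  (reweight (conMass T) Δ).map (condCon T)

theorem condDist_pure (T : Finset QVar) (C : Con CC QC K) :
    condDist T (PMF.pure C) = PMF.pure (condCon T C) := by
  unfold condDist
  rw [reweight_pure, PMF.pure_map]

/-- The instrument acts inside `S` and the bit is stored outside, so their operators commute.
Reading the bit after outcome `i` or before it gives the same unnormalised state, and comparing
traces gives the equality of the joint probabilities. -/
theorem InstrResult.cond {ι κ : Type} [Fintype κ] {X : ι → κ → Env →L[ℂ] Env}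
    {P : ι → Proc CC QC K} {ρ : QState} {Δ Δ' : PMF (Con CC QC K)} {S T : Finset QVar}
    (hST : S ⊆ T) (hX : ∀ i j, Local S (X i j)) (h : InstrResult X P ρ Δ)
    (h' : InstrResult X P (QCCS.cond T ρ) Δ') :
    mass (conMass T) Δ = condMass T ρ ∧ (condMass T ρ ≠ 0 → condDist T Δ = Δ') := by
  obtain ⟨p, σ, h, rfl⟩ := h
  obtain ⟨p', σ', h', rfl⟩ := h'
  have hF : Outside S (flag T false) := Outside.flag hST _
  have key : ∀ i, p i * condMass T (σ i) = condMass T ρ * p' i ∧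
      (p i * condMass T (σ i) ≠ 0 → QCCS.cond T (σ i) = σ' i) := by
    intro i
    have e : (((p i * condMass T (σ i)).toReal : ℝ) : ℂ) • (QCCS.cond T (σ i)).op =
        (((condMass T ρ * p' i).toReal : ℝ) : ℂ) • (σ' i).op := by
      have e1 : ∀ V Y : Env →L[ℂ] Env, V ∘L Y = Y ∘L V → Y.adjoint ∘L V.adjoint =
          V.adjoint ∘L Y.adjoint := fun V Y e => by
        rw [← ContinuousLinearMap.adjoint_comp, ← ContinuousLinearMap.adjoint_comp, e]
      have e2 : ∀ j, X i j ∘L (flag T false).adjoint = (flag T false).adjoint ∘L X i j :=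
        fun j => (hX i j).1 _ hF.adjoint
      rw [ENNReal.toReal_mul, ENNReal.toReal_mul, Complex.ofReal_mul, Complex.ofReal_mul,
        mul_smul, mul_smul, condMass_smul_cond, h', ← ContinuousLinearMap.comp_smul,
        ← ContinuousLinearMap.smul_comp, h, Finset.smul_sum, ContinuousLinearMap.finsetSum_comp,
        ContinuousLinearMap.comp_finsetSum]
      refine Finset.sum_congr rfl fun j _ => ?_
      rw [← ContinuousLinearMap.comp_smul, ← ContinuousLinearMap.smul_comp, condMass_smul_cond,
        conj_conj, conj_conj, e2 j]
    obtain ⟨h1, h2⟩ := Density.eq_of_smul e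
    have f1 := ENNReal.mul_ne_top (p.apply_ne_top i) (condMass_ne_top T (σ i))
    have f2 := ENNReal.mul_ne_top (condMass_ne_top T ρ) (p'.apply_ne_top i)
    exact ⟨(ENNReal.toReal_eq_toReal_iff' f1 f2).1 h1, fun h0 => h2 (ENNReal.toReal_pos h0 f1).ne'⟩
  have hm : mass (conMass T) (p.bind fun i => PMF.pure (⟨P i, σ i⟩ : Con CC QC K)) =
      condMass T ρ := by
    rw [mass_bind]
    simp only [mass_pure]
    unfold mass
    have : ∀ i, p i * conMass T (⟨P i, σ i⟩ : Con CC QC K) = condMass T ρ * p' i :=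
      fun i => (key i).1
    simp only [this]
    rw [ENNReal.tsum_mul_left, p'.tsum_coe, mul_one]
  refine ⟨hm, fun h0 => ?_⟩
  have hm' := hm
  rw [mass_bind] at hm'
  simp only [mass_pure] at hm'
  unfold condDist
  rw [reweight_bind (conMass_le_one T) _ _ (by rwa [hm]), PMF.map_bind]
  simp only [mass_pure, reweight_pure, PMF.pure_map]
  have hp : reweight (fun i => conMass T (⟨P i, σ i⟩ : Con CC QC K)) p = p' := by
    ext i
    have f := mass_ne_top (fun i => conMass_le_one T (⟨P i, σ i⟩ : Con CC QC K)) p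
    rw [reweight_apply (by rwa [hm']) f, hm']
    change p i * condMass T (σ i) * _ = _
    rw [(key i).1, mul_comm (condMass T ρ), mul_assoc,
      ENNReal.mul_inv_cancel h0 (condMass_ne_top T ρ), mul_one]
  rw [hp]
  refine bind_congr_support fun i hi => ?_
  unfold condCon
  simp only
  rw [(key i).2]
  rw [(key i).1]
  exact mul_ne_zero h0 hi

/-- The instrument behind the transition is applied to the conditioned state instead. The transition
does not change the probability of the bit, as an outside observer cannot notice it. -/
theorem Step.cond {C : Con CC QC K} {α : Act CC QC} {Δ : PMF (Con CC QC K)} {T : Finset QVar}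
    (h : Step D C α Δ) (hT : C.proc.qv ⊆ T) : mass (conMass T) Δ = conMass T C ∧
      (conMass T C ≠ 0 → Step D (condCon T C) α (condDist T Δ)) := by
  obtain ⟨ι, κ, _, _, X, P', h1, h2⟩ := h.exists_instr
  obtain ⟨Δ', h'⟩ := h1.exists_result (QCCS.cond T C.st)
  have := h2.cond hT h1.isLocal h'
  refine ⟨this.1, fun h0 => ?_⟩
  rw [this.2 h0]
  exact h1.step _ _ h'

/-- Conversely, the instrument behind a transition of the conditioned configuration can be applied
before conditioning, since it is available in all states. -/
theorem Step.exists_of_cond {C : Con CC QC K} {α : Act CC QC} {Δ : PMF (Con CC QC K)}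
    {T : Finset QVar} (h : Step D (condCon T C) α Δ) (hT : C.proc.qv ⊆ T) (h0 : conMass T C ≠ 0) :
    ∃ Δ', Step D C α Δ' ∧ condDist T Δ' = Δ := by
  obtain ⟨ι, κ, _, _, X, P', h1, h2⟩ := h.exists_instr
  obtain ⟨Δ', h'⟩ := h1.exists_result C.st
  exact ⟨Δ', h1.step _ _ h', (h'.cond hT h1.isLocal h2).2 h0⟩

end Conditioning

/-! ### Transitions are invariant under permutations of the qubits -/

section Equivariance

/-- The action of a permutation of the quantum variables on actions. -/
def Act.perm (π : Equiv.Perm QVar) : Act CC QC → Act CC QC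
  | .tau => .tau
  | .cin c v => .cin c v
  | .cout c v => .cout c v
  | .qin c r => .qin c (π r)
  | .qout c r => .qout c (π r)

/-- The action of a permutation of the quantum variables on configurations. -/
def permCon (π : Equiv.Perm QVar) (C : Con CC QC K) : Con CC QC K :=
  ⟨C.proc.perm π, permSt π C.st⟩

theorem Act.perm_perm (π π' : Equiv.Perm QVar) (α : Act CC QC) :
    (α.perm π').perm π = α.perm (π * π') := by cases α <;> rfl

theorem Act.perm_one (α : Act CC QC) : α.perm 1 = α := by cases α <;> rfl

theorem Act.perm_eq_tau {π : Equiv.Perm QVar} {α : Act CC QC} : α.perm π = .tau ↔ α = .tau := by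
  cases α <;> simp [perm]

theorem permCon_permCon (π π' : Equiv.Perm QVar) (C : Con CC QC K) :
    permCon π (permCon π' C) = permCon (π * π') C := by
  unfold permCon
  rw [Proc.perm_perm, permSt_permSt]

theorem permCon_one (C : Con CC QC K) : permCon 1 C = C := by
  unfold permCon
  rw [Proc.perm_one, permSt_one]

theorem SuperOp.app_perm {n : ℕ} (E : SuperOp n) (q : Fin n ↪ QVar) (π : Equiv.Perm QVar)
    (ρ : QState) : E.app (q.trans π.toEmbedding) (permSt π ρ) = permSt π (E.app q ρ) := by
  refine Density.ext ?_
  have h1 := (IsKraus.onVars (q.trans π.toEmbedding) E.sum_eq_one).hasSum_apply (permSt π ρ)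
  have h2 := (IsKraus.onVars q E.sum_eq_one).hasSum_conj ρ (permU π)
  rw [← permSt_op] at h2
  refine h1.unique (h2.congr_fun fun k => ?_)
  rw [permSt_op, conj_conj, permU_onVars]

theorem Meas.Result.perm {n : ℕ} {M : Meas n} {q : Fin n ↪ QVar} {ρ : QState}
    {p : PMF (Finset (Fin n))} {σ : Finset (Fin n) → QState} (h : M.Result q ρ p σ)
    (π : Equiv.Perm QVar) :
    M.Result (q.trans π.toEmbedding) (permSt π ρ) p fun i => permSt π (σ i) := by
  rw [Meas.result_iff] at h ⊢
  intro i
  have h1 := h i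
  rw [Fintype.sum_unique] at h1 ⊢
  rw [permSt_op, permSt_op, conj_conj, ← permU_onVars, ← conj_conj, ← h1,
    ContinuousLinearMap.smul_comp, ContinuousLinearMap.comp_smul]

theorem map_perm_pure (π : Equiv.Perm QVar) (P : Proc CC QC K) (ρ : QState) :
    (PMF.pure (⟨P, ρ⟩ : Con CC QC K)).map (permCon π) = PMF.pure ⟨P.perm π, permSt π ρ⟩ :=
  PMF.pure_map _ _

theorem map_perm_mapProc (π : Equiv.Perm QVar) (Δ : PMF (Con CC QC K))
    {g g' : Proc CC QC K → Proc CC QC K} (h : ∀ P, (g P).perm π = g' (P.perm π)) :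
    (Δ.map (Con.mapProc g)).map (permCon π) = (Δ.map (permCon π)).map (Con.mapProc g') := by
  rw [PMF.map_comp, PMF.map_comp]
  congr 1
  funext C
  simp only [Function.comp, permCon, Con.mapProc, h]

theorem disjoint_permS {π : Equiv.Perm QVar} {S T : Finset QVar} :
    Disjoint (permS π S) (permS π T) ↔ Disjoint S T := Finset.disjoint_map _

theorem Act.qbv_perm (π : Equiv.Perm QVar) (α : Act CC QC) : (α.perm π).qbv = permS π α.qbv := by
  cases α <;> simp [Act.perm, Act.qbv, permS]

/-- No rule distinguishes a particular qubit, provided that the permutation acts on terms, states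
and actions simultaneously. -/
theorem Step.perm {C : Con CC QC K} {α : Act CC QC} {Δ : PMF (Con CC QC K)}
    (h : Step D C α Δ) (π : Equiv.Perm QVar) :
    Step D (permCon π C) (α.perm π) (Δ.map (permCon π)) := by
  induction h with
  | tau P ρ => rw [map_perm_pure]; exact .tau _ _
  | cinp c x P ρ v => rw [map_perm_pure, ← Proc.subst_perm]; exact .cinp _ _ _ _ _
  | coutp c e P ρ => rw [map_perm_pure]; exact .coutp _ _ _ _
  | qinp c q r P ρ hr =>
    rw [map_perm_pure]
    -- Conjugating the transposition of `q` and `r` by `π` gives that of `π q` and `π r`.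
    have e : (P.perm (Equiv.swap q r)).perm π = (P.perm π).perm (Equiv.swap (π q) (π r)) := by
      rw [Proc.perm_perm, Proc.perm_perm, Equiv.mul_swap_eq_swap_mul]
    rw [e]
    refine .qinp c (π q) (π r) (P.perm π) _ ?_
    change π r ∉ ((Proc.qin c q P).perm π).qv
    rw [Proc.qv_perm, Finset.mem_map_equiv]
    simpa using hr
  | qoutp c q P ρ => rw [map_perm_pure]; exact .qoutp _ _ _ _
  | ccom_left c v P P' Q Q' ρ _ _ h1 h2 =>
    rw [map_perm_pure] at h1 h2 ⊢; exact .ccom_left c v _ _ _ _ _ h1 h2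
  | ccom_right c v P P' Q Q' ρ _ _ h1 h2 =>
    rw [map_perm_pure] at h1 h2 ⊢; exact .ccom_right c v _ _ _ _ _ h1 h2
  | qcom_left c v P P' Q Q' ρ _ _ h1 h2 =>
    rw [map_perm_pure] at h1 h2 ⊢; exact .qcom_left c (π v) _ _ _ _ _ h1 h2
  | qcom_right c v P P' Q Q' ρ _ _ h1 h2 =>
    rw [map_perm_pure] at h1 h2 ⊢; exact .qcom_right c (π v) _ _ _ _ _ h1 h2
  | oper E q P ρ =>
    rw [map_perm_pure, ← SuperOp.app_perm]
    exact .oper E _ _ _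
  | meas M q x P ρ p σ hr =>
    rw [PMF.map_bind]
    simp only [map_perm_pure, ← Proc.subst_perm]
    exact .meas M _ x _ _ p _ (hr.perm π)
  | int_left P Q ρ α Δ _ hd ih =>
    rw [map_perm_mapProc π Δ (g' := fun P' => .par P' (Q.perm π)) fun P => rfl]
    refine .int_left _ _ _ _ _ ih ?_
    rw [Act.qbv_perm, Proc.qv_perm, disjoint_permS]; exact hd
  | int_right P Q ρ α Δ _ hd ih =>
    rw [map_perm_mapProc π Δ (g' := fun Q' => .par (P.perm π) Q') fun P => rfl]
    refine .int_right _ _ _ _ _ ih ?_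
    rw [Act.qbv_perm, Proc.qv_perm, disjoint_permS]; exact hd
  | sum_left P Q ρ α Δ _ ih => exact .sum_left _ _ _ _ _ ih
  | sum_right P Q ρ α Δ _ ih => exact .sum_right _ _ _ _ _ ih
  | rel P f ρ α Δ _ ih =>
    rw [map_perm_mapProc π Δ (g' := fun P' => .rel P' f) fun P => rfl]
    have e : (α.relabel f).perm π = (α.perm π).relabel f := by cases α <;> rfl
    rw [e]
    exact .rel _ f _ _ _ ih
  | res P L ρ α Δ _ hd ih =>
    rw [map_perm_mapProc π Δ (g' := fun P' => .res P' L) fun P => rfl]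
    have e : (α.perm π).cn = α.cn := by cases α <;> rfl
    exact .res _ L _ _ _ ih (e ▸ hd)
  | ite b P ρ α Δ _ hb ih => exact .ite b _ _ _ _ ih hb
  | const A qs es π' ρ α Δ hq hs ih =>
    refine .const A _ es (π * π') _ _ _ ?_ ?_
    · rw [← hq, List.map_map]; rfl
    · unfold permCon at ih
      rwa [← Proc.subst_perm, Proc.perm_perm] at ih

end Equivariance

/-! ### Renaming of bound quantum variables -/

section AlphaEquivalence

/-- Equality up to renaming of bound quantum variables. -/
inductive AlphaEq : Proc CC QC K → Proc CC QC K → Prop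
  | nil : AlphaEq .nil .nil
  | tau {P P'} : AlphaEq P P' → AlphaEq (.tau P) (.tau P')
  | cin (c x) {P P'} : AlphaEq P P' → AlphaEq (.cin c x P) (.cin c x P')
  | cout (c e) {P P'} : AlphaEq P P' → AlphaEq (.cout c e P) (.cout c e P')
  | qin (c q q' P P') : P.qv \ {q} = P'.qv \ {q'} →
      (∀ r, r ∉ P.qv \ {q} → AlphaEq (P.perm (Equiv.swap q r)) (P'.perm (Equiv.swap q' r))) →
      AlphaEq (.qin c q P) (.qin c q' P')
  | qout (c q) {P P'} : AlphaEq P P' → AlphaEq (.qout c q P) (.qout c q P')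
  | oper {n} (E : SuperOp n) (q) {P P'} : AlphaEq P P' → AlphaEq (.oper E q P) (.oper E q P')
  | meas {n} (M : Meas n) (q x) {P P'} : AlphaEq P P' → AlphaEq (.meas M q x P) (.meas M q x P')
  | sum {P P' Q Q'} : AlphaEq P P' → AlphaEq Q Q' → AlphaEq (.sum P Q) (.sum P' Q')
  | par {P P' Q Q'} : AlphaEq P P' → AlphaEq Q Q' → AlphaEq (.par P Q) (.par P' Q')
  | rel (f) {P P'} : AlphaEq P P' → AlphaEq (.rel P f) (.rel P' f)
  | res (L) {P P'} : AlphaEq P P' → AlphaEq (.res P L) (.res P' L)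
  | ite (b) {P P'} : AlphaEq P P' → AlphaEq (.ite b P) (.ite b P')
  | const (A qs es) : AlphaEq (.const A qs es) (.const A qs es)

theorem permS_congr {π π' : Equiv.Perm QVar} {S : Finset QVar} (h : ∀ x ∈ S, π x = π' x) :
    permS π S = permS π' S := by
  unfold permS
  rw [Finset.map_eq_image, Finset.map_eq_image]
  exact Finset.image_congr h

/-- Permutations that agree on the free quantum variables act equally up to renaming. -/
theorem AlphaEq.of_perm (P : Proc CC QC K) {π π' : Equiv.Perm QVar} (h : ∀ x ∈ P.qv, π x = π' x) :
    AlphaEq (P.perm π) (P.perm π') := by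
  induction P generalizing π π' with
  | nil => exact .nil
  | tau P ih => exact .tau (ih h)
  | cin c x P ih => exact .cin c x (ih h)
  | cout c e P ih => exact .cout c e (ih h)
  | qin c q P ih =>
    simp only [Proc.qv, Finset.mem_sdiff, Finset.mem_singleton] at h
    have e : ∀ π : Equiv.Perm QVar, (P.perm π).qv \ {π q} = permS π (P.qv \ {q}) := fun π => by
      rw [permS_sdiff, Proc.qv_perm]; simp [permS]
    refine .qin c _ _ _ _ ?_ fun r hr => ?_
    · rw [e, e]
      exact permS_congr fun x hx => h x (by simpa using hx)
    · rw [Proc.perm_perm, Proc.perm_perm]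
      -- After the transpositions both permutations send `q` to `r`. Any other free variable has the
      -- same image under `π` and `π'`, and this image is moved by neither transposition since `r`
      -- is fresh.
      refine ih fun x hx => ?_
      by_cases hxq : x = q
      · subst hxq; simp
      · have hx' := h x ⟨hx, hxq⟩
        have h1 : π x ≠ π q := fun e => hxq (π.injective e)
        have h2 : π x ≠ r := by
          rintro rfl
          rw [e, Finset.mem_map_equiv] at hr
          simp [hx, hxq] at hr
        have h3 : π' x ≠ π' q := fun e => hxq (π'.injective e)
        rw [Equiv.Perm.mul_apply, Equiv.Perm.mul_apply, Equiv.swap_apply_of_ne_of_ne h1 h2,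
          Equiv.swap_apply_of_ne_of_ne h3 (hx' ▸ h2), hx']
  | qout c q P ih =>
    simp only [Proc.qv, Finset.mem_union, Finset.mem_singleton] at h
    simp only [Proc.perm]
    rw [h q (Or.inr rfl)]
    exact .qout c _ (ih fun x hx => h x (Or.inl hx))
  | oper E q P ih =>
    simp only [Proc.qv, Finset.mem_union] at h
    simp only [Proc.perm]
    have e : q.trans π.toEmbedding = q.trans π'.toEmbedding := by
      ext i; exact h _ (Or.inr (by simp))
    rw [e]
    exact .oper E _ (ih fun x hx => h x (Or.inl hx))
  | meas M q x P ih =>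
    simp only [Proc.qv, Finset.mem_union] at h
    simp only [Proc.perm]
    have e : q.trans π.toEmbedding = q.trans π'.toEmbedding := by
      ext i; exact h _ (Or.inr (by simp))
    rw [e]
    exact .meas M _ x (ih fun x hx => h x (Or.inl hx))
  | sum P Q ih1 ih2 =>
    simp only [Proc.qv, Finset.mem_union] at h
    exact .sum (ih1 fun x hx => h x (Or.inl hx)) (ih2 fun x hx => h x (Or.inr hx))
  | par P Q ih1 ih2 =>
    simp only [Proc.qv, Finset.mem_union] at h
    exact .par (ih1 fun x hx => h x (Or.inl hx)) (ih2 fun x hx => h x (Or.inr hx))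
  | rel P f ih => exact .rel f (ih h)
  | res P L ih => exact .res L (ih h)
  | ite b P ih => exact .ite b (ih h)
  | const A qs es =>
    simp only [Proc.perm]
    have e : qs.map π = qs.map π' := List.map_congr_left fun x hx => h x (by simpa [Proc.qv] using hx)
    rw [e]
    exact .const A _ es

theorem AlphaEq.refl (P : Proc CC QC K) : AlphaEq P P := by
  simpa only [Proc.perm_one] using AlphaEq.of_perm P (π := 1) (π' := 1) fun _ _ => rfl

theorem AlphaEq.symm {P P' : Proc CC QC K} (h : AlphaEq P P') : AlphaEq P' P := by
  induction h with
  | nil => exact .nil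
  | tau _ ih => exact .tau ih
  | cin c x _ ih => exact .cin c x ih
  | cout c e _ ih => exact .cout c e ih
  | qin c q q' P P' e _ ih => exact .qin c q' q P' P e.symm fun r hr => ih r (e ▸ hr)
  | qout c q _ ih => exact .qout c q ih
  | oper E q _ ih => exact .oper E q ih
  | meas M q x _ ih => exact .meas M q x ih
  | sum _ _ ih1 ih2 => exact .sum ih1 ih2
  | par _ _ ih1 ih2 => exact .par ih1 ih2
  | rel f _ ih => exact .rel f ih
  | res L _ ih => exact .res L ih
  | ite b _ ih => exact .ite b ih
  | const A qs es => exact .const A qs es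

theorem AlphaEq.qv_eq {P P' : Proc CC QC K} (h : AlphaEq P P') : P.qv = P'.qv := by
  induction h <;> simp_all [Proc.qv]

theorem AlphaEq.subst {P P' : Proc CC QC K} (h : AlphaEq P P') (s : CSubst) :
    AlphaEq (P.subst s) (P'.subst s) := by
  induction h generalizing s with
  | nil => exact .nil
  | tau _ ih => exact .tau (ih s)
  | cin c x _ ih => exact .cin c x (ih _)
  | cout c e _ ih => exact .cout c _ (ih s)
  | qin c q q' P P' e _ ih =>
    refine .qin c q q' _ _ (by rw [Proc.qv_subst, Proc.qv_subst, e]) fun r hr => ?_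
    rw [← Proc.subst_perm, ← Proc.subst_perm]
    exact ih r (by rwa [Proc.qv_subst] at hr) s
  | qout c q _ ih => exact .qout c q (ih s)
  | oper E q _ ih => exact .oper E q (ih s)
  | meas M q x _ ih => exact .meas M q x (ih _)
  | sum _ _ ih1 ih2 => exact .sum (ih1 s) (ih2 s)
  | par _ _ ih1 ih2 => exact .par (ih1 s) (ih2 s)
  | rel f _ ih => exact .rel f (ih s)
  | res L _ ih => exact .res L (ih s)
  | ite b _ ih => exact .ite _ (ih s)
  | const A qs es => exact .const A qs _

/-- Equality of configurations up to renaming of bound quantum variables. -/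
def AlphaEqCon (C C' : Con CC QC K) : Prop := AlphaEq C.proc C'.proc ∧ C.st = C'.st

theorem liftRel_refl {S : Type*} {R : S → S → Prop} (hR : ∀ s, R s s) {Δ : PMF S}
    (h : Δ.support.Finite) : LiftRel R Δ Δ := by
  rw [← PMF.bind_pure Δ]
  exact .bind h fun s _ => .point (hR s)

theorem liftRel_pure {S : Type*} {R : S → S → Prop} {s t : S}
    (h : LiftRel R (PMF.pure s) (PMF.pure t)) : R s t := by
  obtain ⟨t', ht, h⟩ := h.exists_right s (by simp)
  rw [PMF.mem_support_pure_iff] at ht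
  exact ht ▸ h

/-- The induction is on the renaming, not on the transition. It need not enter the bodies of
constants, as equivalent constants carry the same arguments. -/
theorem Step.alphaEq {P P' : Proc CC QC K} (h : AlphaEq P P') {ρ : QState} {α : Act CC QC}
    {Δ : PMF (Con CC QC K)} (hs : Step D ⟨P, ρ⟩ α Δ) :
    ∃ Δ', Step D ⟨P', ρ⟩ α Δ' ∧ LiftRel AlphaEqCon Δ Δ' := by
  -- A visible answer has a single target and leaves the state alone, so the answers of two partners
  -- fit together in a communication.
  have vis : ∀ {P₁ P₂ : Proc CC QC K} {β : Act CC QC}, β ≠ .tau →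
      (∃ Δ', Step D ⟨P₁, ρ⟩ β Δ' ∧ LiftRel AlphaEqCon (PMF.pure ⟨P₂, ρ⟩) Δ') →
      ∃ P', AlphaEq P₂ P' ∧ Step D ⟨P₁, ρ⟩ β (PMF.pure ⟨P', ρ⟩) := by
    rintro P₁ P₂ β hβ ⟨Δ', h1, h2⟩
    obtain ⟨P', rfl, -⟩ := h1.visible hβ
    exact ⟨P', (liftRel_pure h2).1, h1⟩
  induction h generalizing ρ α Δ with
  | nil => cases hs
  | tau h _ => cases hs; exact ⟨_, .tau _ _, .point ⟨h, rfl⟩⟩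
  | cin c x h _ => cases hs; exact ⟨_, .cinp _ _ _ _ _, .point ⟨h.subst _, rfl⟩⟩
  | cout c e h _ => cases hs; exact ⟨_, .coutp _ _ _ _, .point ⟨h, rfl⟩⟩
  | qin c q q' P P' e h _ =>
    cases hs with
    | qinp _ _ r _ _ hr =>
      exact ⟨_, .qinp _ _ _ _ _ (show r ∉ P'.qv \ {q'} from e ▸ hr), .point ⟨h r hr, rfl⟩⟩
  | qout c q h _ => cases hs; exact ⟨_, .qoutp _ _ _ _, .point ⟨h, rfl⟩⟩
  | oper E q h _ => cases hs; exact ⟨_, .oper _ _ _ _, .point ⟨h, rfl⟩⟩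
  | meas M q x h _ =>
    cases hs with
    | meas _ _ _ _ _ p σ hr =>
      exact ⟨_, .meas M q x _ _ p σ hr, .bind (Set.toFinite _) fun i _ => .point ⟨h.subst _, rfl⟩⟩
  | @sum P P' Q Q' h1 h2 ih1 ih2 =>
    cases hs with
    | sum_left _ _ _ _ _ h =>
      obtain ⟨Δ', h3, h4⟩ := ih1 h vis
      exact ⟨Δ', .sum_left _ _ _ _ _ h3, h4⟩
    | sum_right _ _ _ _ _ h =>
      obtain ⟨Δ', h3, h4⟩ := ih2 h vis
      exact ⟨Δ', .sum_right _ _ _ _ _ h3, h4⟩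
  | @par P P' Q Q' h1 h2 ih1 ih2 =>
    cases hs with
    | ccom_left c v _ _ _ _ _ s1 s2 =>
      obtain ⟨_, a1, t1⟩ := vis (by simp) (ih1 s1 vis)
      obtain ⟨_, a2, t2⟩ := vis (by simp) (ih2 s2 vis)
      exact ⟨_, .ccom_left c v _ _ _ _ _ t1 t2, .point ⟨.par a1 a2, rfl⟩⟩
    | ccom_right c v _ _ _ _ _ s1 s2 =>
      obtain ⟨_, a1, t1⟩ := vis (by simp) (ih1 s1 vis)
      obtain ⟨_, a2, t2⟩ := vis (by simp) (ih2 s2 vis)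
      exact ⟨_, .ccom_right c v _ _ _ _ _ t1 t2, .point ⟨.par a1 a2, rfl⟩⟩
    | qcom_left c v _ _ _ _ _ s1 s2 =>
      obtain ⟨_, a1, t1⟩ := vis (by simp) (ih1 s1 vis)
      obtain ⟨_, a2, t2⟩ := vis (by simp) (ih2 s2 vis)
      exact ⟨_, .qcom_left c v _ _ _ _ _ t1 t2, .point ⟨.par a1 a2, rfl⟩⟩
    | qcom_right c v _ _ _ _ _ s1 s2 =>
      obtain ⟨_, a1, t1⟩ := vis (by simp) (ih1 s1 vis)
      obtain ⟨_, a2, t2⟩ := vis (by simp) (ih2 s2 vis)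
      exact ⟨_, .qcom_right c v _ _ _ _ _ t1 t2, .point ⟨.par a1 a2, rfl⟩⟩
    | int_left _ _ _ _ _ h hd =>
      obtain ⟨Δ', h3, h4⟩ := ih1 h vis
      exact ⟨_, .int_left _ _ _ _ _ h3 (h2.qv_eq ▸ hd),
        h4.map_of fun _ _ _ _ r => ⟨.par r.1 h2, r.2⟩⟩
    | int_right _ _ _ _ _ h hd =>
      obtain ⟨Δ', h3, h4⟩ := ih2 h vis
      exact ⟨_, .int_right _ _ _ _ _ h3 (h1.qv_eq ▸ hd),
        h4.map_of fun _ _ _ _ r => ⟨.par h1 r.1, r.2⟩⟩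
  | rel f h ih =>
    cases hs with
    | rel _ _ _ _ _ h =>
      obtain ⟨Δ', h3, h4⟩ := ih h vis
      exact ⟨_, .rel _ _ _ _ _ h3, h4.map_of fun _ _ _ _ r => ⟨.rel f r.1, r.2⟩⟩
  | res L h ih =>
    cases hs with
    | res _ _ _ _ _ h hd =>
      obtain ⟨Δ', h3, h4⟩ := ih h vis
      exact ⟨_, .res _ _ _ _ _ h3 hd, h4.map_of fun _ _ _ _ r => ⟨.res L r.1, r.2⟩⟩
  | ite b h ih =>
    cases hs with
    | ite _ _ _ _ _ h hb =>
      obtain ⟨Δ', h3, h4⟩ := ih h vis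
      exact ⟨_, .ite _ _ _ _ _ h3 hb, h4⟩
  | const A qs es =>
    exact ⟨Δ, hs, liftRel_refl (fun C => ⟨.refl _, rfl⟩) hs.finite_support⟩

end AlphaEquivalence

/-! ### Weak transitions: convexity and transport -/

section Weak
variable {ι : Type*}

theorem HatStep.finite_support {α : Act CC QC} {C : Con CC QC K} {Δ : PMF (Con CC QC K)}
    (h : HatStep D α C Δ) : Δ.support.Finite := by
  rcases h with h | ⟨-, rfl⟩
  · exact h.finite_support
  · simp

theorem Lift.hat_refl {Δ : PMF (Con CC QC K)} (h : Δ.support.Finite) :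
    Lift (HatStep D .tau) Δ Δ := by
  conv_rhs => rw [← PMF.bind_pure Δ]
  exact Lift.of_bind h fun s _ => .point _ _ (Or.inr ⟨rfl, rfl⟩)

theorem WeakTau.finite_support {Δ Θ : PMF (Con CC QC K)} (h : WeakTau D Δ Θ)
    (hΔ : Δ.support.Finite) : Θ.support.Finite := by
  induction h with
  | refl => exact hΔ
  | tail _ h _ => exact h.finite_right fun _ _ h => h.finite_support

/-- The components may need different numbers of steps. As hatted steps may stand still, the
components are moved one after another while the others rest. -/
theorem WeakTau.bind_fin {n : ℕ} (p : PMF (Fin n)) {Δ Θ : Fin n → PMF (Con CC QC K)}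
    (h : ∀ i, WeakTau D (Δ i) (Θ i)) (hΔ : ∀ i, (Δ i).support.Finite) :
    WeakTau D (p.bind Δ) (p.bind Θ) := by
  classical
  have key : ∀ s : Finset (Fin n),
      WeakTau D (p.bind Δ) (p.bind fun i => if i ∈ s then Θ i else Δ i) := by
    intro s
    induction s using Finset.induction_on with
    | empty =>
      simp only [Finset.notMem_empty, if_false]
      exact .refl
    | insert a s ha ih =>
      refine ih.trans ?_
      set X : Fin n → PMF (Con CC QC K) := fun i => if i ∈ s then Θ i else Δ i
      have hX : ∀ i, (X i).support.Finite := fun i => by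
        by_cases hi : i ∈ s
        · simp only [X, if_pos hi]; exact (h i).finite_support (hΔ i)
        · simp only [X, if_neg hi]; exact hΔ i
      have e1 : X = Function.update X a (Δ a) := by
        rw [eq_comm, Function.update_eq_self_iff]; simp [X, ha]
      have e2 : (fun i => if i ∈ insert a s then Θ i else Δ i) = Function.update X a (Θ a) := by
        funext i
        by_cases hi : i = a
        · subst hi; simp
        · simp [X, hi]
      rw [e2]
      conv_lhs => rw [e1]
      refine Relation.ReflTransGen.lift (fun Z => p.bind (Function.update X a Z))
        (fun Z Z' hZ => ?_) _ _ (h a)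
      refine Lift.bind (Set.toFinite _) fun i _ => ?_
      by_cases hi : i = a
      · subst hi; simpa using hZ
      · simpa [hi] using Lift.hat_refl (hX i)
  simpa using key Finset.univ

theorem weakStep_tau {Δ Θ : PMF (Con CC QC K)} : WeakStep D .tau Δ Θ ↔ WeakTau D Δ Θ := by
  simp [WeakStep]

theorem WeakStep.bind {p : PMF ι} (hp : p.support.Finite) {α : Act CC QC}
    {Δ Θ : ι → PMF (Con CC QC K)} (h : ∀ i ∈ p.support, WeakStep D α (Δ i) (Θ i))
    (hΔ : ∀ i ∈ p.support, (Δ i).support.Finite) : WeakStep D α (p.bind Δ) (p.bind Θ) := by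
  obtain ⟨n, p', e, rfl, he, -⟩ := exists_map_fin p hp
  rw [PMF.bind_map, PMF.bind_map]
  by_cases hα : α = .tau
  · subst hα
    simp only [weakStep_tau] at h ⊢
    exact WeakTau.bind_fin p' (fun j => h _ (he j)) fun j => hΔ _ (he j)
  · have h' : ∀ j, ∃ Δ₁ Δ₂, WeakTau D (Δ (e j)) Δ₁ ∧ Lift (HatStep D α) Δ₁ Δ₂ ∧
        WeakTau D Δ₂ (Θ (e j)) := fun j =>
      (h _ (he j)).elim (fun h => absurd h.1 hα) fun h => h.2
    choose Δ₁ Δ₂ h1 h2 h3 using h'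
    exact Or.inr ⟨hα, p'.bind Δ₁, p'.bind Δ₂, WeakTau.bind_fin p' h1 fun j => hΔ _ (he j),
      Lift.bind (Set.toFinite _) fun j _ => h2 j, WeakTau.bind_fin p' h3 fun j =>
        (h2 j).finite_right fun _ _ h => h.finite_support⟩

theorem Step.weak {C : Con CC QC K} {α : Act CC QC} {Δ : PMF (Con CC QC K)}
    (h : Step D C α Δ) : WeakStep D α (PMF.pure C) Δ := by
  by_cases hα : α = .tau
  · exact Or.inl ⟨hα, .single (.point _ _ (Or.inl (hα ▸ h)))⟩
  · exact Or.inr ⟨hα, _, _, .refl, .point _ _ (Or.inl h), .refl⟩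

/-- Transport of weak internal transitions along an operation on distributions. -/
theorem WeakTau.transport {CC' QC' K' : Type*} {D' : Defs CC' QC' K'}
    {F : PMF (Con CC QC K) → PMF (Con CC' QC' K')} {J : PMF (Con CC QC K) → Prop}
    (hF : ∀ Δ Δ', J Δ → Lift (HatStep D .tau) Δ Δ' →
      J Δ' ∧ Lift (HatStep D' .tau) (F Δ) (F Δ'))
    {Δ Θ : PMF (Con CC QC K)} (h : WeakTau D Δ Θ) (hJ : J Δ) : J Θ ∧ WeakTau D' (F Δ) (F Θ) := by
  induction h with
  | refl => exact ⟨hJ, .refl⟩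
  | tail _ h ih =>
    obtain ⟨h1, h2⟩ := hF _ _ ih.1 h
    exact ⟨h1, ih.2.tail h2⟩

/-- The distributions before the visible action are transported by `F` under the invariant `J`, and
those after it by `G` under `J'`. A weak `τ` has no point at which to switch, so there the two have
to coincide. -/
theorem WeakStep.transport {F G : PMF (Con CC QC K) → PMF (Con CC QC K)}
    {J J' : PMF (Con CC QC K) → Prop} {α α' : Act CC QC} (hα : α = .tau ↔ α' = .tau)
    (hF : ∀ Δ Δ', J Δ → Lift (HatStep D .tau) Δ Δ' →
      J Δ' ∧ Lift (HatStep D .tau) (F Δ) (F Δ'))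
    (hG : ∀ Δ Δ', J' Δ → Lift (HatStep D .tau) Δ Δ' →
      J' Δ' ∧ Lift (HatStep D .tau) (G Δ) (G Δ'))
    (hFG : ∀ Δ Δ', J Δ → Lift (HatStep D α) Δ Δ' →
      J' Δ' ∧ Lift (HatStep D α') (F Δ) (G Δ'))
    (h0 : α = .tau → F = G ∧ J = J')
    {Δ Θ : PMF (Con CC QC K)} (h : WeakStep D α Δ Θ) (hJ : J Δ) :
    J' Θ ∧ WeakStep D α' (F Δ) (G Θ) := by
  rcases h with ⟨rfl, h⟩ | ⟨h0, Δ₁, Δ₂, h1, h2, h3⟩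
  · obtain ⟨rfl, rfl⟩ := h0 rfl
    obtain ⟨h4, h5⟩ := h.transport hF hJ
    exact ⟨h4, Or.inl ⟨hα.1 rfl, h5⟩⟩
  · obtain ⟨h4, h5⟩ := h1.transport hF hJ
    obtain ⟨h6, h7⟩ := hFG _ _ h4 h2
    obtain ⟨h8, h9⟩ := h3.transport hG h6
    exact ⟨h8, Or.inr ⟨fun h => h0 (hα.2 h), _, _, h5, h7, h9⟩⟩

/-- Transport of weak transitions along a map of configurations. -/
theorem WeakStep.map_of {f : Con CC QC K → Con CC QC K} {α α' : Act CC QC}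
    (hα : α = .tau ↔ α' = .tau)
    (hτ : ∀ C Δ, Step D C .tau Δ → Step D (f C) .tau (Δ.map f))
    (hs : ∀ C Δ, Step D C α Δ → Step D (f C) α' (Δ.map f))
    {Δ Θ : PMF (Con CC QC K)} (h : WeakStep D α Δ Θ) :
    WeakStep D α' (Δ.map f) (Θ.map f) := by
  have key : ∀ β β' : Act CC QC, (β = .tau → β' = .tau) →
      (∀ C Δ, Step D C β Δ → Step D (f C) β' (Δ.map f)) →
      ∀ Δ Δ', Lift (HatStep D β) Δ Δ' → Lift (HatStep D β') (Δ.map f) (Δ'.map f) := by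
    intro β β' hβ hs Δ Δ' h
    refine h.map_of fun C _ Ξ hΞ => .point _ _ ?_
    rcases hΞ with hΞ | ⟨rfl, rfl⟩
    · exact Or.inl (hs C Ξ hΞ)
    · exact Or.inr ⟨hβ rfl, PMF.pure_map _ _⟩
  exact (WeakStep.transport (F := PMF.map f) (G := PMF.map f) (J := fun _ => True)
    (J' := fun _ => True) hα (fun Δ Δ' _ h => ⟨trivial, key _ _ (fun _ => rfl) hτ Δ Δ' h⟩)
    (fun Δ Δ' _ h => ⟨trivial, key _ _ (fun _ => rfl) hτ Δ Δ' h⟩)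
    (fun Δ Δ' _ h => ⟨trivial, key _ _ hα.1 hs Δ Δ' h⟩) (fun _ => ⟨rfl, rfl⟩) h trivial).2

theorem WeakStep.forall_support {I I' : Con CC QC K → Prop} {α : Act CC QC}
    (hI : ∀ C Δ, I C → Step D C .tau Δ → ∀ C' ∈ Δ.support, I C')
    (hI' : ∀ C Δ, I' C → Step D C .tau Δ → ∀ C' ∈ Δ.support, I' C')
    (hα : ∀ C Δ, I C → Step D C α Δ → ∀ C' ∈ Δ.support, I' C') (h0 : α = .tau → I = I')
    {Δ Θ : PMF (Con CC QC K)} (h : WeakStep D α Δ Θ) (hΔ : ∀ C ∈ Δ.support, I C) :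
    ∀ C ∈ Θ.support, I' C := by
  have key : ∀ {I : Con CC QC K → Prop}, (∀ C Δ, I C → Step D C .tau Δ → ∀ C' ∈ Δ.support, I C') →
      ∀ Δ Δ', (∀ C ∈ Δ.support, I C) → Lift (HatStep D .tau) Δ Δ' → (∀ C ∈ Δ'.support, I C) ∧
        Lift (HatStep D .tau) Δ Δ' := by
    intro I hI Δ Δ' hΔ h
    refine ⟨h.forall_support (I := I) (fun C Θ hC hs => ?_) hΔ, h⟩
    rcases hs with hs | ⟨-, rfl⟩
    · exact hI C Θ hC hs
    · simpa using hC
  refine (WeakStep.transport (F := id) (G := id) (J := fun Δ => ∀ C ∈ Δ.support, I C)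
    (J' := fun Δ => ∀ C ∈ Δ.support, I' C) Iff.rfl (key hI) (key hI') (fun Δ Δ' hΔ h => ?_)
    (fun e => ⟨rfl, by rw [h0 e]⟩) h hΔ).1
  refine ⟨h.forall_support (I := I) (fun C Θ hC hs => ?_) hΔ, h⟩
  rcases hs with hs | ⟨e, rfl⟩
  · exact hα C Θ hC hs
  · simpa [← h0 e] using hC

end Weak

/-! ### Simulations also match weak transitions -/

section Simulation

/-- Weak simulations, without the conditions on the qubits outside the processes. -/
def IsSim (D : Defs CC QC K) (R : Con CC QC K → Con CC QC K → Prop) : Prop :=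
  ∀ C C', R C C' → ∀ α Δ, Step D C α Δ →
    ∃ Θ, WeakStep D α (PMF.pure C') Θ ∧ LiftRel R Δ Θ

variable {R : Con CC QC K → Con CC QC K → Prop}

/-- A lifted step out of a point distribution may mix several steps of `C`; each is matched
separately and the answers are mixed. Stating the hypothesis on `Δ` by its support lets it pass to
the components of a mixture. -/
theorem IsSim.pure (hR : IsSim D R) {C C' : Con CC QC K} (hC : R C C') {α : Act CC QC}
    {Δ Δ' : PMF (Con CC QC K)} (h : Lift (HatStep D α) Δ Δ') (hΔ : ∀ s ∈ Δ.support, s = C) :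
    ∃ Θ, WeakStep D α (PMF.pure C') Θ ∧ LiftRel R Δ' Θ := by
  induction h with
  | point s Θ h =>
    obtain rfl := hΔ s (by simp)
    rcases h with h | ⟨rfl, rfl⟩
    · exact hR _ _ hC _ _ h
    · exact ⟨PMF.pure C', weakStep_tau.2 .refl, .point hC⟩
  | linear n p Δ Θ _ ih =>
    have h' : ∀ i, ∃ Θ', i ∈ p.support → WeakStep D α (PMF.pure C') Θ' ∧ LiftRel R (Θ i) Θ' := by
      intro i
      by_cases hi : i ∈ p.support
      · obtain ⟨Θ', h⟩ := ih i fun s hs => hΔ s ((PMF.mem_support_bind_iff _ _ _).2 ⟨i, hi, hs⟩)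
        exact ⟨Θ', fun _ => h⟩
      · exact ⟨PMF.pure C', fun h => absurd h hi⟩
    choose Θ' h' using h'
    refine ⟨p.bind Θ', ?_, .bind (Set.toFinite _) fun i hi => (h' i hi).2⟩
    rw [← PMF.bind_const p (PMF.pure C')]
    exact WeakStep.bind (Set.toFinite _) (fun i hi => (h' i hi).1) fun _ _ => by simp

/-- The step is decomposed into steps of single states, and the lifted relation is given by a
coupling. Every coupled pair is answered separately; mixing the answers with the weights of the
coupling gives the answer of `Θ`. -/
theorem IsSim.hat (hR : IsSim D R) {α : Act CC QC} {Δ Δ' Θ : PMF (Con CC QC K)}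
    (hΔ : LiftRel R Δ Θ) (h : Lift (HatStep D α) Δ Δ') :
    ∃ Θ', WeakStep D α Θ Θ' ∧ LiftRel R Δ' Θ' := by
  obtain ⟨f, hf, rfl⟩ := h.decompose
  obtain ⟨p, hp, hpR, rfl, rfl⟩ := hΔ.exists_coupling
  have h' : ∀ x : Con CC QC K × Con CC QC K, ∃ Θ', x ∈ p.support →
      WeakStep D α (PMF.pure x.2) Θ' ∧ LiftRel R (f x.1) Θ' := by
    intro x
    by_cases hx : x ∈ p.support
    · obtain ⟨Θ', h⟩ := hR.pure (hpR x hx)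
        (hf x.1 ((PMF.mem_support_map_iff _ _ _).2 ⟨x, hx, rfl⟩)) (by simp)
      exact ⟨Θ', fun _ => h⟩
    · exact ⟨PMF.pure x.1, fun h => absurd h hx⟩
  choose Θ' h' using h'
  refine ⟨p.bind Θ', ?_, ?_⟩
  · rw [← PMF.bind_pure_comp]
    exact WeakStep.bind hp (fun x hx => (h' x hx).1) fun _ _ => by simp
  · rw [PMF.bind_map]
    exact .bind hp fun x hx => (h' x hx).2

theorem IsSim.weakTau (hR : IsSim D R) {Δ Δ' Θ : PMF (Con CC QC K)}
    (hΔ : LiftRel R Δ Θ) (h : WeakTau D Δ Δ') : ∃ Θ', WeakTau D Θ Θ' ∧ LiftRel R Δ' Θ' := by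
  induction h with
  | refl => exact ⟨Θ, .refl, hΔ⟩
  | tail _ h ih =>
    obtain ⟨Θ₁, h1, h2⟩ := ih
    obtain ⟨Θ₂, h3, h4⟩ := hR.hat h2 h
    exact ⟨Θ₂, h1.trans (weakStep_tau.1 h3), h4⟩

theorem WeakStep.trans_left {α : Act CC QC} {Δ Δ' Θ : PMF (Con CC QC K)} (h : WeakTau D Δ Δ')
    (h' : WeakStep D α Δ' Θ) : WeakStep D α Δ Θ := by
  rcases h' with ⟨rfl, h'⟩ | ⟨h0, Δ₁, Δ₂, h1, h2, h3⟩
  · exact Or.inl ⟨rfl, h.trans h'⟩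
  · exact Or.inr ⟨h0, Δ₁, Δ₂, h.trans h1, h2, h3⟩

theorem WeakStep.trans_right {α : Act CC QC} {Δ Θ Θ' : PMF (Con CC QC K)}
    (h : WeakStep D α Δ Θ) (h' : WeakTau D Θ Θ') : WeakStep D α Δ Θ' := by
  rcases h with ⟨rfl, h⟩ | ⟨h0, Δ₁, Δ₂, h1, h2, h3⟩
  · exact Or.inl ⟨rfl, h.trans h'⟩
  · exact Or.inr ⟨h0, Δ₁, Δ₂, h1, h2, h3.trans h'⟩

theorem IsSim.weakStep (hR : IsSim D R) {α : Act CC QC} {Δ Δ' Θ : PMF (Con CC QC K)}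
    (hΔ : LiftRel R Δ Θ) (h : WeakStep D α Δ Δ') :
    ∃ Θ', WeakStep D α Θ Θ' ∧ LiftRel R Δ' Θ' := by
  rcases h with ⟨rfl, h⟩ | ⟨h0, Δ₁, Δ₂, h1, h2, h3⟩
  · obtain ⟨Θ', h1, h2⟩ := hR.weakTau hΔ h
    exact ⟨Θ', weakStep_tau.2 h1, h2⟩
  · obtain ⟨Θ₁, w1, r1⟩ := hR.weakTau hΔ h1
    obtain ⟨Θ₂, w2, r2⟩ := hR.hat r1 h2
    obtain ⟨Θ₃, w3, r3⟩ := hR.weakTau r2 h3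
    exact ⟨Θ₃, (w2.trans_left w1).trans_right w3, r3⟩

end Simulation

/-! ### Open bisimilarity: stability, equivalence, renaming -/

section OpenBisimilarity
variable {R : Con CC QC K → Con CC QC K → Prop}

/-- Related configurations agree in their quantum variables and in the state of the other qubits,
and remain related when a super-operator is applied to the other qubits. -/
def IsStable (R : Con CC QC K → Con CC QC K → Prop) : Prop :=
  ∀ C C', R C C' → C.proc.qv = C'.proc.qv ∧ ptr C.proc.qv C.st.op = ptr C.proc.qv C'.st.op ∧
    ∀ (A : ℕ → Env →L[ℂ] Env) (hA : IsKraus A), (∀ k, Outside C.proc.qv (A k)) →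
      R ⟨C.proc, hA.apply C.st⟩ ⟨C'.proc, hA.apply C'.st⟩

theorem ptr_congr_set {S S' : Finset QVar} (h : S = S') {X Y : Env →L[ℂ] Env} :
    ptr S X = ptr S Y ↔ ptr S' X = ptr S' Y := by subst h; rfl

theorem IsStable.flip (h : IsStable R) : IsStable fun C C' => R C' C := by
  intro C C' hC
  obtain ⟨h1, h2, h3⟩ := h C' C hC
  refine ⟨h1.symm, (ptr_congr_set h1).1 h2.symm, fun A hA hS => h3 A hA fun k => ?_⟩
  rw [h1]; exact hS k

/-- If the relation itself is closed under operations on the outside, the quantifier over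
super-operators in the definition of open simulations is redundant. -/
theorem IsStable.isOpenSim (h : IsStable R) (h' : IsSim D R) : IsOpenSim D R := by
  intro C C' hC
  obtain ⟨h1, h2, h3⟩ := h C C' hC
  exact ⟨h1, h2, fun E α Δ hs => h' _ _ (h3 _ E.isKraus.onRest E.outside) α Δ hs⟩

theorem IsStable.openBisimilar (h : IsStable R) (h1 : IsSim D R)
    (h2 : IsSim D fun C C' => R C' C) {C C' : Con CC QC K} (hC : R C C') :
    OpenBisimilar D C C' := ⟨R, ⟨h.isOpenSim h1, h.flip.isOpenSim h2⟩, hC⟩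

theorem OpenBisimilar.symm {C C' : Con CC QC K} (h : OpenBisimilar D C C') :
    OpenBisimilar D C' C := by
  obtain ⟨R, hR, hC⟩ := h
  exact ⟨fun C C' => R C' C, ⟨hR.2, hR.1⟩, hC⟩

theorem IsKraus.comp {σ τ : Type*} {ι : Type*} {B : σ → Ell ι →L[ℂ] Ell ι}
    {A : τ → Ell ι →L[ℂ] Ell ι} (hB : IsKraus B) (hA : IsKraus A) :
    IsKraus fun x : σ × τ => B x.1 ∘L A x.2 := by
  intro ψ
  rw [← (Equiv.prodComm τ σ).hasSum_iff]
  have hf : ∀ k, HasSum (fun j => ‖B j (A k ψ)‖ ^ 2) (‖A k ψ‖ ^ 2) := fun k => hB (A k ψ)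
  have hs : Summable fun x : τ × σ => ‖B x.2 (A x.1 ψ)‖ ^ 2 := by
    rw [summable_prod_of_nonneg fun x => by positivity]
    refine ⟨fun k => (hf k).summable, ?_⟩
    simp only [fun k => (hf k).tsum_eq]
    exact (hA ψ).summable
  have := (hs.hasSum.prod_fiberwise hf).unique (hA ψ)
  exact this ▸ hs.hasSum

theorem IsKraus.apply_apply {σ τ : Type*} {ι : Type*} {B : σ → Ell ι →L[ℂ] Ell ι}
    {A : τ → Ell ι →L[ℂ] Ell ι} (hB : IsKraus B) (hA : IsKraus A) (ρ : Density ι) :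
    hB.apply (hA.apply ρ) = (hB.comp hA).apply ρ := by
  refine Density.ext ?_
  have h1 := ((hB.comp hA).hasSum_apply ρ).prod_fiberwise fun j => hA.hasSum_conj ρ (B j)
  exact (hB.hasSum_apply (hA.apply ρ)).unique h1

/-- The identity is among the super-operators allowed. -/
theorem IsOpenSim.isSim (h : IsOpenSim D R) : IsSim D R := by
  intro C C' hC α Δ hs
  obtain ⟨-, -, h3⟩ := h C C' hC
  obtain ⟨E, hE⟩ := isKraus_one.exists_restOp (S := C.proc.qv) fun _ => (Local.one ∅).2 _ (by simp)
  have := h3 E α Δ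
  simp only [hE, isKraus_one_apply] at this
  exact this hs

/-- Two operations on the outside compose to one. So the clause for the original pair answers for
its image under an operation too, and its answers are related by `R` itself. -/
theorem IsOpenSim.union_apply (h : IsOpenSim D R) : IsOpenSim D fun X X' => R X X' ∨
    ∃ C C', R C C' ∧ ∃ (A : ℕ → Env →L[ℂ] Env) (hA : IsKraus A), (∀ k, Outside C.proc.qv (A k)) ∧
      X = ⟨C.proc, hA.apply C.st⟩ ∧ X' = ⟨C'.proc, hA.apply C'.st⟩ := by
  rintro X X' (hX | ⟨C, C', hC, A, hA, hS, rfl, rfl⟩)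
  · obtain ⟨h1, h2, h3⟩ := h X X' hX
    refine ⟨h1, h2, fun E α Δ hs => ?_⟩
    obtain ⟨Θ, hw, hl⟩ := h3 E α Δ hs
    exact ⟨Θ, hw, hl.mono fun _ _ _ _ r => Or.inl r⟩
  · obtain ⟨h1, h2, h3⟩ := h C C' hC
    refine ⟨h1, ptr_apply_eq hA hS h2, fun E α Δ hs => ?_⟩
    obtain ⟨E', hE'⟩ := (E.isKraus.onRest.comp hA).exists_restOp
      (fun x => (E.outside x.1).comp (hS x.2))
    have e : ∀ ρ, E.app (hA.apply ρ) = E'.app ρ := fun ρ =>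
      (IsKraus.apply_apply E.isKraus.onRest hA ρ).trans (hE' ρ).symm
    simp only [e] at hs ⊢
    obtain ⟨Θ, hw, hl⟩ := h3 E' α Δ hs
    exact ⟨Θ, hw, hl.mono fun _ _ _ _ r => Or.inl r⟩

theorem OpenBisimilar.isStable : IsStable (OpenBisimilar D) := by
  rintro C C' ⟨R, hR, hC⟩
  obtain ⟨h1, h2, -⟩ := hR.1 C C' hC
  refine ⟨h1, h2, fun A hA hS => ?_⟩
  refine ⟨_, ⟨hR.1.union_apply, ?_⟩, Or.inr ⟨C, C', hC, A, hA, hS, rfl, rfl⟩⟩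
  convert hR.2.union_apply using 1
  funext X X'
  refine propext (or_congr Iff.rfl ⟨?_, ?_⟩)
  · rintro ⟨C, C', hC, A, hA, hS, rfl, rfl⟩
    exact ⟨C', C, hC, A, hA, (hR.1 C C' hC).1 ▸ hS, rfl, rfl⟩
  · rintro ⟨C, C', hC, A, hA, hS, rfl, rfl⟩
    exact ⟨C', C, hC, A, hA, (hR.1 C' C hC).1 ▸ hS, rfl, rfl⟩

theorem OpenBisimilar.isSim : IsSim D (OpenBisimilar D) := by
  rintro C C' ⟨R, hR, hC⟩ α Δ hs
  obtain ⟨Θ, hw, hl⟩ := hR.1.isSim C C' hC α Δ hs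
  exact ⟨Θ, hw, hl.mono fun _ _ _ _ r => ⟨R, hR, r⟩⟩

/-- Stable symmetric simulations consist of open bisimilar configurations. -/
theorem IsStable.openBisimilar_of_symm (h : IsStable R) (h1 : IsSim D R)
    (h2 : ∀ C C', R C C' → R C' C) {C C' : Con CC QC K} (hC : R C C') :
    OpenBisimilar D C C' := by
  have e : (fun C C' => R C' C) = R := by
    funext C C'; exact propext ⟨h2 _ _, h2 _ _⟩
  exact h.openBisimilar h1 (e.symm ▸ h1) hC

theorem OpenBisimilar.trans {C C' C'' : Con CC QC K} (h : OpenBisimilar D C C')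
    (h' : OpenBisimilar D C' C'') : OpenBisimilar D C C'' := by
  refine IsStable.openBisimilar_of_symm
    (R := fun C C'' => ∃ C', OpenBisimilar D C C' ∧ OpenBisimilar D C' C'') ?_ ?_ ?_ ⟨C', h, h'⟩
  · rintro C C'' ⟨C', h, h'⟩
    obtain ⟨h1, h2, h3⟩ := OpenBisimilar.isStable _ _ h
    obtain ⟨h1', h2', h3'⟩ := OpenBisimilar.isStable _ _ h'
    exact ⟨h1.trans h1', h2.trans ((ptr_congr_set h1).2 h2'), fun A hA hS =>
      ⟨_, h3 A hA hS, h3' A hA (h1 ▸ hS)⟩⟩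
  · rintro C C'' ⟨C', h, h'⟩ α Δ hs
    obtain ⟨Θ, w, l⟩ := OpenBisimilar.isSim _ _ h α Δ hs
    obtain ⟨Ξ, w', l'⟩ := OpenBisimilar.isSim.weakStep (.point h') w
    exact ⟨Ξ, w', l.trans (fun s t u h h' => ⟨t, h, h'⟩) l'⟩
  · rintro C C'' ⟨C', h, h'⟩
    exact ⟨C', h'.symm, h.symm⟩

theorem AlphaEqCon.openBisimilar {C C' : Con CC QC K} (h : AlphaEqCon C C') :
    OpenBisimilar D C C' := by
  refine IsStable.openBisimilar_of_symm (R := AlphaEqCon) ?_ ?_ ?_ h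
  · rintro ⟨P, ρ⟩ ⟨P', ρ'⟩ ⟨h, e⟩
    obtain rfl : ρ = ρ' := e
    exact ⟨h.qv_eq, rfl, fun A hA _ => ⟨h, rfl⟩⟩
  · rintro ⟨P, ρ⟩ ⟨P', ρ'⟩ ⟨h, e⟩ α Δ hs
    obtain rfl : ρ = ρ' := e
    obtain ⟨Θ, hs', hl⟩ := hs.alphaEq h
    exact ⟨Θ, hs'.weak, hl⟩
  · exact fun C C' h => ⟨h.1.symm, h.2.symm⟩

theorem OpenBisimilar.refl (C : Con CC QC K) : OpenBisimilar D C C :=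
  AlphaEqCon.openBisimilar ⟨.refl _, rfl⟩

theorem IsKraus.apply_permSt {τ : Type*} {A : τ → Env →L[ℂ] Env} (hA : IsKraus A)
    (π : Equiv.Perm QVar) : ∃ hA' : IsKraus fun k => permU π ∘L A k ∘L (permU π).adjoint,
      ∀ ρ, permSt π (hA.apply ρ) = hA'.apply (permSt π ρ) := by
  have hA' : IsKraus fun k => permU π ∘L A k ∘L (permU π).adjoint := by
    intro ψ
    have h := hA ((permU π).adjoint ψ)
    rw [permU_adjoint, norm_permU] at h
    simpa only [permU_adjoint, ContinuousLinearMap.comp_apply, norm_permU] using h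
  refine ⟨hA', fun ρ => Density.ext ?_⟩
  have h1 := hA.hasSum_conj ρ (permU π)
  rw [← permSt_op] at h1
  refine h1.unique ((hA'.hasSum_apply (permSt π ρ)).congr_fun fun k => ?_)
  have e : (permU π).adjoint ∘L permU π = 1 := by
    rw [permU_adjoint, permU_comp, inv_mul_cancel, permU_one]
  have e' : (permU π ∘L A k ∘L (permU π).adjoint) ∘L permU π = permU π ∘L A k := by
    rw [ContinuousLinearMap.comp_assoc, ContinuousLinearMap.comp_assoc, e]; rfl
  rw [permSt_op, conj_conj, e']

/-- Transitions, reduced states and operations on the outside can all be transported back along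
`π⁻¹`. This gives the closure under renaming that quantum input requires. -/
theorem OpenBisimilar.perm {C C' : Con CC QC K} (h : OpenBisimilar D C C') (π : Equiv.Perm QVar) :
    OpenBisimilar D (permCon π C) (permCon π C') := by
  refine IsStable.openBisimilar_of_symm
    (R := fun X X' => OpenBisimilar D (permCon π⁻¹ X) (permCon π⁻¹ X')) ?_ ?_ ?_ ?_
  · rintro X X' h
    obtain ⟨h1, h2, h3⟩ := OpenBisimilar.isStable _ _ h
    have e : permS π (permCon π⁻¹ X).proc.qv = X.proc.qv := by
      unfold permCon; rw [Proc.qv_perm, permS_permS, mul_inv_cancel, permS_one]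
    refine ⟨?_, ?_, fun A hA hS => ?_⟩
    · unfold permCon at h1
      rw [Proc.qv_perm, Proc.qv_perm] at h1
      exact permS_injective _ h1
    · have := ptr_perm π h2
      unfold permCon at this
      simp only at this
      rw [permSt_permSt, permSt_permSt, mul_inv_cancel, permSt_one, permSt_one] at this
      exact (ptr_congr_set e).1 this
    · obtain ⟨hA', e'⟩ := hA.apply_permSt π⁻¹
      have := h3 _ hA' fun k => by
        have := (hS k).perm π⁻¹
        unfold permCon
        rwa [Proc.qv_perm]
      unfold permCon at this ⊢
      simp only at this ⊢
      rwa [e', e']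
  · rintro X X' h α Δ hs
    obtain ⟨Θ, w, l⟩ := OpenBisimilar.isSim _ _ h _ _ (hs.perm π⁻¹)
    have w' := WeakStep.map_of (f := permCon π) (α' := α) Act.perm_eq_tau
      (fun C Δ h => h.perm π) (fun C Δ h => by
        have := h.perm π
        rwa [Act.perm_perm, mul_inv_cancel, Act.perm_one] at this) w
    rw [PMF.pure_map, permCon_permCon, mul_inv_cancel, permCon_one] at w'
    refine ⟨_, w', ?_⟩
    have l' := l.map_of (f := permCon π) (g := permCon π)
      (R' := fun X X' => OpenBisimilar D (permCon π⁻¹ X) (permCon π⁻¹ X')) fun s _ t _ h => by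
        rwa [permCon_permCon, permCon_permCon, inv_mul_cancel, permCon_one, permCon_one]
    rw [PMF.map_comp] at l'
    have e : (permCon π ∘ permCon π⁻¹ : Con CC QC K → _) = id := by
      funext C; simp only [Function.comp, permCon_permCon, mul_inv_cancel, permCon_one, id]
    rwa [e, PMF.map_id] at l'
  · exact fun X X' h => h.symm
  · rwa [permCon_permCon, permCon_permCon, inv_mul_cancel, permCon_one, permCon_one]

end OpenBisimilarity

/-! ### Bisimilarity survives conditioning on outcomes outside the processes -/

section PostSelection

theorem norm_flag (T : Finset QVar) (b : Bool) (ψ : Env) : ‖flag T b ψ‖ = ‖ψ‖ := by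
  have h : ⟪flag T b ψ, flag T b ψ⟫_ℂ = ⟪ψ, ψ⟫_ℂ := by
    rw [← ContinuousLinearMap.adjoint_inner_right, ← ContinuousLinearMap.comp_apply,
      adjoint_flag_flag, if_pos rfl, one_apply_eq_self]
  rw [inner_self_eq_norm_sq_to_K, inner_self_eq_norm_sq_to_K] at h
  have h' : ‖flag T b ψ‖ ^ 2 = ‖ψ‖ ^ 2 := by exact_mod_cast h
  exact (pow_left_inj₀ (norm_nonneg _) (norm_nonneg _) two_ne_zero).1 h'

/-- The operation that applies `A` if the bit stored outside `T` is `false`, and moves this bit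
to the qubits outside `T'`. -/
def ctrl (T T' : Finset QVar) {τ : Type*} (A : τ → Env →L[ℂ] Env) : Option τ → Env →L[ℂ] Env
  | none => flag T' true ∘L (flag T true).adjoint
  | some k => flag T' false ∘L A k ∘L (flag T false).adjoint

theorem isKraus_ctrl (T T' : Finset QVar) {τ : Type*} {A : τ → Env →L[ℂ] Env} (hA : IsKraus A) :
    IsKraus (ctrl T T' A) := by
  intro ψ
  have h1 := (isKraus_adjoint_flag T ψ).unique (hasSum_fintype _)
  rw [Fintype.sum_bool] at h1
  rw [h1]
  have h2 : HasSum (fun k => ‖ctrl T T' A (some k) ψ‖ ^ 2) (‖(flag T false).adjoint ψ‖ ^ 2) := by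
    simpa only [ctrl, ContinuousLinearMap.comp_apply, norm_flag] using
      hA ((flag T false).adjoint ψ)
  have h3 : ‖ctrl T T' A none ψ‖ ^ 2 = ‖(flag T true).adjoint ψ‖ ^ 2 := by
    simp only [ctrl, ContinuousLinearMap.comp_apply, norm_flag]
  rw [← h3]
  have h4 := (Equiv.optionEquivSumPUnit.{0} τ).symm.hasSum_iff
    (f := fun o => ‖ctrl T T' A o ψ‖ ^ 2)
    (a := ‖ctrl T T' A none ψ‖ ^ 2 + ‖(flag T false).adjoint ψ‖ ^ 2)
  rw [← h4, add_comm]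
  exact HasSum.sum h2 (hasSum_unique _)

theorem Outside.ctrl {S T T' : Finset QVar} (hT : S ⊆ T) (hT' : S ⊆ T') {τ : Type*}
    {A : τ → Env →L[ℂ] Env} (hA : ∀ k, Outside S (A k)) (o : Option τ) :
    Outside S (ctrl T T' A o) := by
  cases o with
  | none => exact (Outside.flag hT' _).comp (Outside.flag hT _).adjoint
  | some k => exact (Outside.flag hT' _).comp ((hA k).comp (Outside.flag hT _).adjoint)

theorem adjoint_flag_ctrl (T T' : Finset QVar) {τ : Type*} (A : τ → Env →L[ℂ] Env) :
    (flag T' false).adjoint ∘L ctrl T T' A none = 0 ∧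
    ∀ k, (flag T' false).adjoint ∘L ctrl T T' A (some k) = A k ∘L (flag T false).adjoint := by
  constructor
  · unfold ctrl
    rw [← ContinuousLinearMap.comp_assoc, adjoint_flag_flag, if_neg (by simp)]
    exact ContinuousLinearMap.zero_comp _
  · intro k
    unfold ctrl
    rw [← ContinuousLinearMap.comp_assoc, adjoint_flag_flag, if_pos rfl]
    exact ContinuousLinearMap.id_comp _

theorem hasSum_smul_conj {τ : Type*} {A : τ → Env →L[ℂ] Env} (hA : IsKraus A) {B : Env →L[ℂ] Env}
    {c : ℂ} {ρ σ : QState} (h : c • σ.op = B ∘L ρ.op ∘L B.adjoint) :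
    HasSum (fun k => (A k ∘L B) ∘L ρ.op ∘L (A k ∘L B).adjoint) (c • (hA.apply σ).op) := by
  refine ((hA.hasSum_apply σ).const_smul c).congr_fun fun k => ?_
  rw [← conj_conj, ← h]
  simp

/-- Finding the new bit `false` excludes the branch `none` and turns the others into `A` applied
after the old bit was found `false`. So operations after conditioning are conditioned versions of
trace-preserving operations before it. -/
theorem cond_ctrl (T T' : Finset QVar) {τ : Type*} {A : τ → Env →L[ℂ] Env} (hA : IsKraus A)
    (ρ : QState) : condMass T' ((isKraus_ctrl T T' hA).apply ρ) = condMass T ρ ∧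
      (condMass T ρ ≠ 0 → cond T' ((isKraus_ctrl T T' hA).apply ρ) = hA.apply (cond T ρ)) := by
  refine condMass_eq (condMass_ne_top T ρ) ?_
  have h1 := (isKraus_ctrl T T' hA).hasSum_conj ρ (flag T' false).adjoint
  refine HasSum.unique ?_ h1
  rw [← (Equiv.optionEquivSumPUnit.{0} τ).symm.hasSum_iff]
  rw [← add_zero (_ • _)]
  obtain ⟨e1, e2⟩ := adjoint_flag_ctrl T T' A
  refine HasSum.sum ?_ ?_
  · refine (hasSum_smul_conj hA (condMass_smul_cond T ρ)).congr_fun fun k => ?_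
    simp only [Function.comp, Equiv.optionEquivSumPUnit_symm_inl]
    rw [e2]
  · refine hasSum_zero.congr_fun fun k => ?_
    simp only [Function.comp, Equiv.optionEquivSumPUnit_symm_inr]
    rw [e1]; simp

theorem OpenBisimilar.apply {C C' : Con CC QC K} (h : OpenBisimilar D C C') {τ : Type*}
    [Countable τ] {A : τ → Env →L[ℂ] Env} (hA : IsKraus A) (hS : ∀ k, Outside C.proc.qv (A k)) :
    OpenBisimilar D ⟨C.proc, hA.apply C.st⟩ ⟨C'.proc, hA.apply C'.st⟩ := by
  obtain ⟨E, hE⟩ := hA.exists_restOp hS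
  rw [← hE, ← hE]
  exact (OpenBisimilar.isStable _ _ h).2.2 _ E.isKraus.onRest E.outside

/-- A single step preserves the probability of the bit and commutes with conditioning; convexity of
both is all that the lifting needs. The condition on `α` keeps the qubits of the targets inside `T`,
so that further steps can follow. -/
theorem Lift.cond {T : Finset QVar} {α : Act CC QC} (hα : α.qbv ⊆ T) {Δ Δ' : PMF (Con CC QC K)}
    (h : Lift (HatStep D α) Δ Δ')
    (hΔ : (∀ C ∈ Δ.support, C.proc.qv ⊆ T) ∧ mass (conMass T) Δ ≠ 0) :
    ((∀ C ∈ Δ'.support, C.proc.qv ⊆ T) ∧ mass (conMass T) Δ' ≠ 0) ∧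
      Lift (HatStep D α) (condDist T Δ) (condDist T Δ') := by
  have h1 := h.reweight_map (R' := HatStep D α) (conMass_le_one T) (f := condCon T)
    fun C hC Ξ hs => by
      rcases hs with hs | ⟨rfl, rfl⟩
      · obtain ⟨h1, h2⟩ := hs.cond (hΔ.1 C hC)
        exact ⟨h1, fun h0 => .point _ _ (Or.inl (h2 h0))⟩
      · refine ⟨mass_pure _ _, fun _ => ?_⟩
        rw [reweight_pure, PMF.pure_map]
        exact .point _ _ (Or.inr ⟨rfl, rfl⟩)
  refine ⟨⟨h.forall_support (I := fun C => C.proc.qv ⊆ T) (fun C Ξ hC hs => ?_) hΔ.1, h1.1 ▸ hΔ.2⟩,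
    h1.2 hΔ.2⟩
  rcases hs with hs | ⟨-, rfl⟩
  · exact fun C' hC' => (hs.qv_subset.2 C' hC').trans (Finset.union_subset hC hα)
  · simpa using hC

theorem WeakStep.cond {T : Finset QVar} {α : Act CC QC} (hα : α.qbv ⊆ T) {Δ Θ : PMF (Con CC QC K)}
    (h : WeakStep D α Δ Θ) (hΔ : (∀ C ∈ Δ.support, C.proc.qv ⊆ T) ∧ mass (conMass T) Δ ≠ 0) :
    WeakStep D α (condDist T Δ) (condDist T Θ) :=
  (h.transport (F := condDist T) (G := condDist T)
    (J := fun Δ => (∀ C ∈ Δ.support, C.proc.qv ⊆ T) ∧ mass (conMass T) Δ ≠ 0) Iff.rfl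
    (fun _ _ hJ h => h.cond (by simp [Act.qbv]) hJ) (fun _ _ hJ h => h.cond (by simp [Act.qbv]) hJ)
    (fun _ _ hJ h => h.cond hα hJ) (fun _ => ⟨rfl, rfl⟩) hΔ).2

/-- Bisimilar configurations have equal reduced states outside, and these determine the distribution
of the bit. -/
theorem OpenBisimilar.conMass_eq {C C' : Con CC QC K} (h : OpenBisimilar D C C') {T : Finset QVar}
    (hT : C.proc.qv ⊆ T) : conMass T C' = conMass T C :=
  condMass_congr (by rw [← (OpenBisimilar.isStable _ _ h).1]; exact hT)
    ((ptr_congr_set (OpenBisimilar.isStable _ _ h).1).1 (OpenBisimilar.isStable _ _ h).2.1.symm)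

/-- Configurations that arise from open bisimilar ones by finding the same value of a bit stored
outside of the processes. -/
def PostSelected (D : Defs CC QC K) (X X' : Con CC QC K) : Prop :=
  ∃ C C' T, OpenBisimilar D C C' ∧ C.proc.qv ⊆ T ∧ conMass T C ≠ 0 ∧
    X = condCon T C ∧ X' = condCon T C'

/-- Applying `A` to two post-selected configurations gives again a post-selected pair, by way of the
controlled operation. With the identity for `A` it serves to move the bit away from further qubits.
-/
theorem OpenBisimilar.ctrl {C C' : Con CC QC K} (h : OpenBisimilar D C C') {T T' : Finset QVar}
    (hT : C.proc.qv ⊆ T) (hT' : C.proc.qv ⊆ T') (h0 : conMass T C ≠ 0) {τ : Type*} [Countable τ]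
    {A : τ → Env →L[ℂ] Env} (hA : IsKraus A) (hS : ∀ k, Outside C.proc.qv (A k)) :
    ∃ C₁ C₁', OpenBisimilar D C₁ C₁' ∧ C₁.proc = C.proc ∧ conMass T' C₁ ≠ 0 ∧
      (⟨C.proc, hA.apply (cond T C.st)⟩ : Con CC QC K) = condCon T' C₁ ∧
      (⟨C'.proc, hA.apply (cond T C'.st)⟩ : Con CC QC K) = condCon T' C₁' := by
  refine ⟨_, _, h.apply (isKraus_ctrl T T' hA) (Outside.ctrl hT hT' hS), rfl, ?_, ?_, ?_⟩
  · unfold conMass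
    rwa [(cond_ctrl T T' hA C.st).1]
  · unfold condCon
    rw [(cond_ctrl T T' hA C.st).2 h0]
  · unfold condCon
    rw [(cond_ctrl T T' hA C'.st).2 ((h.conMass_eq hT).trans_ne h0)]

theorem PostSelected.symm {X X' : Con CC QC K} (h : PostSelected D X X') :
    PostSelected D X' X := by
  obtain ⟨C, C', T, h, hT, h0, rfl, rfl⟩ := h
  exact ⟨C', C, T, h.symm, (OpenBisimilar.isStable _ _ h).1 ▸ hT, (h.conMass_eq hT).trans_ne h0,
    rfl, rfl⟩

/-- A transition of the conditioned configuration comes from one before conditioning. This one has a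
weak answer by bisimilarity, and the answer can be conditioned in turn. Related targets give the bit
the same probability, so conditioning reweights both sides of the lifted relation alike. -/
theorem PostSelected.isSim : IsSim D (PostSelected D) := by
  rintro X X' ⟨C₀, C₀', T₀, h, hT₀, h0, rfl, rfl⟩ α Δ hs
  have hT : C₀.proc.qv ⊆ T₀ ∪ α.qbv := hT₀.trans Finset.subset_union_left
  have hα : α.qbv ⊆ T₀ ∪ α.qbv := Finset.subset_union_right
  -- If `α` inputs a qubit, that qubit may be involved in the storage of the bit. The bit is
  -- therefore first moved outside `T₀ ∪ α.qbv`.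
  obtain ⟨C, C', h, e, h0, e1, e2⟩ := h.ctrl hT₀ hT h0 isKraus_one
    fun _ => (Local.one ∅).2 _ (by simp)
  rw [isKraus_one_apply] at e1 e2
  rw [← e] at hT
  change condCon T₀ C₀ = _ at e1
  change condCon T₀ C₀' = _ at e2
  rw [e1] at hs
  rw [e2]
  generalize T₀ ∪ α.qbv = T at *
  obtain ⟨Δ₁, hs₁, rfl⟩ := hs.exists_of_cond hT h0
  obtain ⟨Θ, hw, hl⟩ := OpenBisimilar.isSim _ _ h _ _ hs₁
  have hw' := hw.cond hα (T := T) ⟨by simpa [← (OpenBisimilar.isStable _ _ h).1] using hT, by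
    rw [mass_pure]; exact (h.conMass_eq hT).trans_ne h0⟩
  rw [condDist_pure] at hw'
  refine ⟨_, hw', ?_⟩
  refine (Lift.reweight_map (R' := fun s Θ => ∃ t, PostSelected D s t ∧ Θ = PMF.pure t)
    (conMass_le_one T) hl ?_).2 ((hs₁.cond hT).1.trans_ne h0)
  rintro s hsΔ _ ⟨t, hst, rfl⟩
  have hsT : s.proc.qv ⊆ T := (hs₁.qv_subset.2 s hsΔ).trans (Finset.union_subset hT hα)
  rw [mass_pure, reweight_pure, PMF.pure_map]
  exact ⟨hst.conMass_eq hsT, fun h0 => .point _ _ ⟨_, ⟨s, t, T, hst, hsT, h0, rfl, rfl⟩, rfl⟩⟩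

theorem PostSelected.openBisimilar {X X' : Con CC QC K} (h : PostSelected D X X') :
    OpenBisimilar D X X' := by
  refine IsStable.openBisimilar_of_symm (R := PostSelected D) ?_ PostSelected.isSim
    (fun _ _ h => h.symm) h
  rintro X X' ⟨C, C', T, h, hT, h0, rfl, rfl⟩
  obtain ⟨h1, h2, -⟩ := OpenBisimilar.isStable _ _ h
  refine ⟨h1, ptr_cond_eq hT h2 h0, fun A hA hS => ?_⟩
  obtain ⟨C₁, C₁', h', e, h0', e1, e2⟩ := h.ctrl hT hT h0 hA hS
  exact ⟨C₁, C₁', T, h', e ▸ hT, h0', e1, e2⟩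

/-- Open bisimilarity is preserved by each outcome of an instrument on the other qubits. -/
theorem OpenBisimilar.outcome {P Q : Proc CC QC K} {ρ σ : QState}
    (h : OpenBisimilar D ⟨P, ρ⟩ ⟨Q, σ⟩) {ι κ : Type} [Countable ι] [Fintype κ]
    {X : ι → κ → Env →L[ℂ] Env} (hX : IsKraus fun x : ι × κ => X x.1 x.2)
    (hS : ∀ i j, Outside P.qv (X i j)) {p q : PMF ι} {ρ' σ' : ι → QState}
    (hp : ∀ i, ((p i).toReal : ℂ) • (ρ' i).op = ∑ j, X i j ∘L ρ.op ∘L (X i j).adjoint)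
    (hq : ∀ i, ((q i).toReal : ℂ) • (σ' i).op = ∑ j, X i j ∘L σ.op ∘L (X i j).adjoint) (i : ι) :
    p i = q i ∧ (p i ≠ 0 → OpenBisimilar D ⟨P, ρ' i⟩ ⟨Q, σ' i⟩) := by
  classical
  set T := P.qv with hT
  -- The whole instrument is performed, and the bit records whether the outcome differs from `i`.
  -- This is trace preserving, and finding `false` leaves exactly the Kraus operators of outcome
  -- `i`.
  set G : ι × κ → Env →L[ℂ] Env := fun x => flag T (decide (x.1 ≠ i)) ∘L X x.1 x.2 with hG
  have hK : IsKraus G := fun ψ => by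
    simpa only [hG, ContinuousLinearMap.comp_apply, norm_flag] using hX ψ
  have key : ∀ {p : PMF ι} {ρ : QState} {ρ' : ι → QState},
      (∀ i, ((p i).toReal : ℂ) • (ρ' i).op = ∑ j, X i j ∘L ρ.op ∘L (X i j).adjoint) →
      condMass T (hK.apply ρ) = p i ∧ (p i ≠ 0 → cond T (hK.apply ρ) = ρ' i) := by
    intro p ρ ρ' hp
    refine condMass_eq (p.apply_ne_top i) ?_
    rw [hp i]
    refine HasSum.unique ?_ (hK.hasSum_conj ρ (flag T false).adjoint)
    have e : ∀ x, (flag T false).adjoint ∘L G x = if x.1 = i then X x.1 x.2 else 0 := by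
      intro x
      simp only [hG]
      rw [← ContinuousLinearMap.comp_assoc, adjoint_flag_flag]
      by_cases hx : x.1 = i
      · rw [if_pos (by simp [hx]), if_pos hx]
        exact ContinuousLinearMap.id_comp _
      · rw [if_neg (by simp [hx]), if_neg hx]
        exact ContinuousLinearMap.zero_comp _
    simp only [e]
    have hinj : Function.Injective (fun j : κ => (i, j)) := fun j j' h => (Prod.mk.inj h).2
    rw [← hinj.hasSum_iff]
    · simpa [Function.comp_def] using
        hasSum_fintype fun j => X i j ∘L ρ.op ∘L (X i j).adjoint
    · rintro ⟨i', j⟩ hx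
      have : i' ≠ i := fun h => hx ⟨j, by rw [h]⟩
      simp [this]
  have h' := h.apply hK fun x => (Outside.flag subset_rfl _).comp (hS x.1 x.2)
  obtain ⟨h1, h2⟩ := key hp
  obtain ⟨h3, h4⟩ := key hq
  have e : q i = p i := by
    rw [← h1, ← h3]; exact h'.conMass_eq (T := T) subset_rfl
  refine ⟨e.symm, fun h0 => ?_⟩
  rw [← h2 h0, ← h4 (e.trans_ne h0)]
  exact PostSelected.openBisimilar ⟨_, _, T, h', subset_rfl, by
    unfold conMass; rwa [h1], rfl, rfl⟩

end PostSelection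

/-! ### The constructors other than recursion and summation -/

section Congruence

/-- Open bisimilarity in every state. -/
def Bisim (D : Defs CC QC K) (P Q : Proc CC QC K) : Prop :=
  ∀ ρ, OpenBisimilar D ⟨P, ρ⟩ ⟨Q, ρ⟩

theorem Bisim.refl (P : Proc CC QC K) : Bisim D P P := fun _ => .refl _

theorem Bisim.symm {P Q : Proc CC QC K} (h : Bisim D P Q) : Bisim D Q P := fun ρ => (h ρ).symm

theorem Bisim.trans {P Q R : Proc CC QC K} (h : Bisim D P Q) (h' : Bisim D Q R) : Bisim D P R :=
  fun ρ => (h ρ).trans (h' ρ)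

/-- The state with all qubits in `|0⟩`. -/
def groundState : QState where
  op := (innerSL ℂ (basis ∅ : Env)).smulRight (basis ∅)
  pos := by
    rw [ContinuousLinearMap.isPositive_iff_complex]
    intro x
    simp only [ContinuousLinearMap.smulRight_apply, innerSL_apply_apply, inner_smul_left]
    rw [mul_comm, Complex.mul_conj]
    simp [Complex.normSq_nonneg]
  trace_one := by
    classical
    simp only [ContinuousLinearMap.smulRight_apply, innerSL_apply_apply, inner_smul_right,
      orthonormal_iff_ite.1 basis_orthonormal]
    convert hasSum_ite_eq (∅ : Finset QVar) (1 : ℂ) using 2 with u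
    by_cases h : u = ∅ <;> simp [h]

theorem Bisim.qv_eq {P Q : Proc CC QC K} (h : Bisim D P Q) : P.qv = Q.qv :=
  (OpenBisimilar.isStable _ _ (h groundState)).1

theorem Bisim.perm {P Q : Proc CC QC K} (h : Bisim D P Q) (π : Equiv.Perm QVar) :
    Bisim D (P.perm π) (Q.perm π) := fun ρ => by
  have := (h (permSt π⁻¹ ρ)).perm π
  unfold permCon at this
  simpa only [permSt_permSt, mul_inv_cancel, permSt_one] using this

/-- Terms are bisimilar if their first steps match in every state. -/
theorem Bisim.of_step {P Q : Proc CC QC K} (hq : P.qv = Q.qv)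
    (h1 : ∀ ρ α Δ, Step D ⟨P, ρ⟩ α Δ →
      ∃ Θ, Step D ⟨Q, ρ⟩ α Θ ∧ LiftRel (OpenBisimilar D) Δ Θ)
    (h2 : ∀ ρ α Δ, Step D ⟨Q, ρ⟩ α Δ →
      ∃ Θ, Step D ⟨P, ρ⟩ α Θ ∧ LiftRel (OpenBisimilar D) Δ Θ) : Bisim D P Q := by
  intro ρ
  refine IsStable.openBisimilar
    (R := fun X X' => OpenBisimilar D X X' ∨ ∃ ρ, X = ⟨P, ρ⟩ ∧ X' = ⟨Q, ρ⟩) ?_ ?_ ?_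
    (Or.inr ⟨ρ, rfl, rfl⟩)
  · rintro X X' (h | ⟨ρ, rfl, rfl⟩)
    · obtain ⟨e1, e2, e3⟩ := OpenBisimilar.isStable _ _ h
      exact ⟨e1, e2, fun A hA hS => Or.inl (e3 A hA hS)⟩
    · exact ⟨hq, rfl, fun A hA _ => Or.inr ⟨_, rfl, rfl⟩⟩
  · rintro X X' (h | ⟨ρ, rfl, rfl⟩) α Δ hs
    · obtain ⟨Θ, w, l⟩ := OpenBisimilar.isSim _ _ h α Δ hs
      exact ⟨Θ, w, l.mono fun _ _ _ _ h => Or.inl h⟩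
    · obtain ⟨Θ, w, l⟩ := h1 ρ α Δ hs
      exact ⟨Θ, w.weak, l.mono fun _ _ _ _ h => Or.inl h⟩
  · rintro X' X (h | ⟨ρ, rfl, rfl⟩) α Δ hs
    · obtain ⟨Θ, w, l⟩ := OpenBisimilar.isSim _ _ h.symm α Δ hs
      exact ⟨Θ, w, l.mono fun _ _ _ _ h => Or.inl h.symm⟩
    · obtain ⟨Θ, w, l⟩ := h2 ρ α Δ hs
      exact ⟨Θ, w.weak, l.mono fun _ _ _ _ h => Or.inl h.symm⟩

/-- Operations on terms preserve bisimilarity if the first steps match. -/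
theorem Bisim.of_step_symm {H : Proc CC QC K → Proc CC QC K → Prop}
    (hH : ∀ P Q, H P Q → H Q P ∧ P.qv = Q.qv ∧ ∀ ρ α Δ, Step D ⟨P, ρ⟩ α Δ →
      ∃ Θ, Step D ⟨Q, ρ⟩ α Θ ∧ LiftRel (OpenBisimilar D) Δ Θ) {P Q : Proc CC QC K} (h : H P Q) :
    Bisim D P Q :=
  .of_step (hH P Q h).2.1 (hH P Q h).2.2 (hH Q P (hH P Q h).1).2.2

theorem Bisim.tau {P Q : Proc CC QC K} (h : Bisim D P Q) : Bisim D (.tau P) (.tau Q) := by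
  refine of_step_symm (H := fun X Y => ∃ P Q, Bisim D P Q ∧ X = .tau P ∧ Y = .tau Q) ?_
    ⟨P, Q, h, rfl, rfl⟩
  rintro _ _ ⟨P, Q, h, rfl, rfl⟩
  refine ⟨⟨Q, P, h.symm, rfl, rfl⟩, h.qv_eq, fun ρ α Δ hs => ?_⟩
  cases hs
  exact ⟨_, .tau _ _, .point (h ρ)⟩

theorem Bisim.cin {P Q : Proc CC QC K} (c : CC) {x : CVar}
    (h : ∀ v, Bisim D (P.subst (CSubst.single x v)) (Q.subst (CSubst.single x v))) :
    Bisim D (.cin c x P) (.cin c x Q) := by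
  refine of_step_symm (H := fun X Y => ∃ P Q, (∀ v, Bisim D (P.subst (CSubst.single x v))
    (Q.subst (CSubst.single x v))) ∧ X = .cin c x P ∧ Y = .cin c x Q) ?_ ⟨P, Q, h, rfl, rfl⟩
  rintro _ _ ⟨P, Q, h, rfl, rfl⟩
  refine ⟨⟨Q, P, fun v => (h v).symm, rfl, rfl⟩, ?_, fun ρ α Δ hs => ?_⟩
  · have := (h 0).qv_eq
    rwa [Proc.qv_subst, Proc.qv_subst] at this
  · cases hs
    exact ⟨_, .cinp _ _ _ _ _, .point (h _ ρ)⟩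

theorem Bisim.cout {P Q : Proc CC QC K} (c : CC) (e : CExp) (h : Bisim D P Q) :
    Bisim D (.cout c e P) (.cout c e Q) := by
  refine of_step_symm (H := fun X Y => ∃ P Q, Bisim D P Q ∧ X = .cout c e P ∧ Y = .cout c e Q) ?_
    ⟨P, Q, h, rfl, rfl⟩
  rintro _ _ ⟨P, Q, h, rfl, rfl⟩
  refine ⟨⟨Q, P, h.symm, rfl, rfl⟩, h.qv_eq, fun ρ α Δ hs => ?_⟩
  cases hs
  exact ⟨_, .coutp _ _ _ _, .point (h ρ)⟩

/-- The continuations are `P` and `Q` permuted by the same transposition, so invariance under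
permutations applies. The admissible inputs coincide since bisimilar terms have the same free
quantum variables. -/
theorem Bisim.qin {P Q : Proc CC QC K} (c : QC) (q : QVar) (h : Bisim D P Q) :
    Bisim D (.qin c q P) (.qin c q Q) := by
  refine of_step_symm (H := fun X Y => ∃ P Q, Bisim D P Q ∧ X = .qin c q P ∧ Y = .qin c q Q) ?_
    ⟨P, Q, h, rfl, rfl⟩
  rintro _ _ ⟨P, Q, h, rfl, rfl⟩
  have e : (Proc.qin c q P).qv = (Proc.qin c q Q).qv := congrArg (· \ {q}) h.qv_eq
  refine ⟨⟨Q, P, h.symm, rfl, rfl⟩, e, fun ρ α Δ hs => ?_⟩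
  cases hs with
  | qinp c q r P ρ hr => exact ⟨_, .qinp _ _ r _ _ (e ▸ hr), .point (h.perm _ ρ)⟩

theorem Bisim.qout {P Q : Proc CC QC K} (c : QC) (q : QVar) (h : Bisim D P Q) :
    Bisim D (.qout c q P) (.qout c q Q) := by
  refine of_step_symm (H := fun X Y => ∃ P Q, Bisim D P Q ∧ X = .qout c q P ∧ Y = .qout c q Q) ?_
    ⟨P, Q, h, rfl, rfl⟩
  rintro _ _ ⟨P, Q, h, rfl, rfl⟩
  refine ⟨⟨Q, P, h.symm, rfl, rfl⟩, congrArg (· ∪ {q}) h.qv_eq, fun ρ α Δ hs => ?_⟩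
  cases hs
  exact ⟨_, .qoutp _ _ _ _, .point (h ρ)⟩

theorem Bisim.oper {P Q : Proc CC QC K} {n : ℕ} (E : SuperOp n) (q : Fin n ↪ QVar)
    (h : Bisim D P Q) : Bisim D (.oper E q P) (.oper E q Q) := by
  refine of_step_symm (H := fun X Y => ∃ P Q, Bisim D P Q ∧ X = .oper E q P ∧ Y = .oper E q Q) ?_
    ⟨P, Q, h, rfl, rfl⟩
  rintro _ _ ⟨P, Q, h, rfl, rfl⟩
  refine ⟨⟨Q, P, h.symm, rfl, rfl⟩, congrArg (· ∪ Finset.univ.map q) h.qv_eq, fun ρ α Δ hs => ?_⟩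
  cases hs
  exact ⟨_, .oper _ _ _ _, .point (h _)⟩

theorem Bisim.meas {P Q : Proc CC QC K} {n : ℕ} (M : Meas n) (q : Fin n ↪ QVar) {x : CVar}
    (h : ∀ v, Bisim D (P.subst (CSubst.single x v)) (Q.subst (CSubst.single x v))) :
    Bisim D (.meas M q x P) (.meas M q x Q) := by
  refine of_step_symm (H := fun X Y => ∃ P Q, (∀ v, Bisim D (P.subst (CSubst.single x v))
    (Q.subst (CSubst.single x v))) ∧ X = .meas M q x P ∧ Y = .meas M q x Q) ?_ ⟨P, Q, h, rfl, rfl⟩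
  rintro _ _ ⟨P, Q, h, rfl, rfl⟩
  refine ⟨⟨Q, P, fun v => (h v).symm, rfl, rfl⟩, ?_, fun ρ α Δ hs => ?_⟩
  · exact congrArg (· ∪ Finset.univ.map q) (by simpa only [Proc.qv_subst] using (h 0).qv_eq)
  · cases hs with
    | meas M q x P ρ p σ hr =>
      exact ⟨_, .meas _ _ _ _ _ p σ hr, .bind (Set.toFinite _) fun i _ => .point (h _ _)⟩

theorem Bisim.ite_of_holds {P : Proc CC QC K} {b : BExp} (hb : b.holds) :
    Bisim D (.ite b P) P := by
  refine of_step rfl (fun ρ α Δ hs => ?_) fun ρ α Δ hs => ?_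
  · cases hs with
    | ite _ _ _ _ _ hs _ => exact ⟨Δ, hs, liftRel_refl (fun _ => .refl _) hs.finite_support⟩
  · exact ⟨Δ, .ite _ _ _ _ _ hs hb, liftRel_refl (fun _ => .refl _) hs.finite_support⟩

/-- Either the condition holds and the conditional has the same steps as its body, or both sides are
stuck. -/
theorem Bisim.ite {P Q : Proc CC QC K} (b : BExp) (h : Bisim D P Q) :
    Bisim D (.ite b P) (.ite b Q) := by
  by_cases hb : b.holds
  · exact (ite_of_holds hb).trans (h.trans (ite_of_holds hb).symm)
  · refine of_step h.qv_eq (fun ρ α Δ hs => ?_) fun ρ α Δ hs => ?_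
    · cases hs with | ite _ _ _ _ _ _ hb' => exact absurd hb' hb
    · cases hs with | ite _ _ _ _ _ _ hb' => exact absurd hb' hb

/-- Unary static operators preserve open bisimilarity. -/
theorem OpenBisimilar.mapProc {g : Proc CC QC K → Proc CC QC K} (hg : ∀ P, (g P).qv = P.qv)
    {f : Act CC QC → Act CC QC} (hf : ∀ α, f α = .tau ↔ α = .tau) {I : Act CC QC → Prop}
    (hI : I .tau)
    (h1 : ∀ P ρ α Δ, Step D ⟨P, ρ⟩ α Δ → I α → Step D ⟨g P, ρ⟩ (f α) (Δ.map (Con.mapProc g)))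
    (h2 : ∀ P ρ α Δ, Step D ⟨g P, ρ⟩ α Δ → ∃ β Δ', Step D ⟨P, ρ⟩ β Δ' ∧ I β ∧ α = f β ∧
      Δ = Δ'.map (Con.mapProc g)) {C C' : Con CC QC K} (h : OpenBisimilar D C C') :
    OpenBisimilar D (C.mapProc g) (C'.mapProc g) := by
  refine IsStable.openBisimilar_of_symm (R := fun X X' => ∃ C C', OpenBisimilar D C C' ∧
    X = C.mapProc g ∧ X' = C'.mapProc g) ?_ ?_ ?_ ⟨C, C', h, rfl, rfl⟩
  · rintro _ _ ⟨C, C', h, rfl, rfl⟩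
    obtain ⟨e1, e2, e3⟩ := OpenBisimilar.isStable _ _ h
    have e := hg C.proc
    refine ⟨?_, (ptr_congr_set e.symm).1 e2, fun A hA hS => ?_⟩
    · unfold Con.mapProc
      rw [hg, hg, e1]
    · exact ⟨_, _, e3 A hA fun k => e ▸ hS k, rfl, rfl⟩
  · rintro _ _ ⟨C, C', h, rfl, rfl⟩ α Δ hs
    obtain ⟨β, Δ', hs', hβ, rfl, rfl⟩ := h2 _ _ _ _ hs
    obtain ⟨Θ, w, l⟩ := OpenBisimilar.isSim _ _ h _ _ hs'
    have w' := w.map_of (f := Con.mapProc g) (α' := f β) (hf β).symm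
      (fun C Δ hs => by
        have := h1 C.proc C.st _ _ hs hI
        rwa [(hf _).2 rfl] at this)
      (fun C Δ hs => h1 C.proc C.st _ _ hs hβ)
    rw [PMF.pure_map] at w'
    exact ⟨_, w', l.map_of fun s _ t _ h => ⟨s, t, h, rfl, rfl⟩⟩
  · rintro _ _ ⟨C, C', h, rfl, rfl⟩
    exact ⟨C', C, h.symm, rfl, rfl⟩

theorem OpenBisimilar.rel {C C' : Con CC QC K} (f : Relabel CC QC) (h : OpenBisimilar D C C') :
    OpenBisimilar D (C.mapProc fun P => .rel P f) (C'.mapProc fun P => .rel P f) := by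
  refine h.mapProc (g := fun P => .rel P f) (fun P => rfl) (f := Act.relabel f) (I := fun _ => True) ?_ trivial ?_ ?_
  · intro α; cases α <;> simp [Act.relabel]
  · exact fun P ρ α Δ hs _ => .rel _ _ _ _ _ hs
  · intro P ρ α Δ hs
    cases hs with
    | rel _ _ _ _ _ hs => exact ⟨_, _, hs, trivial, rfl, rfl⟩

theorem OpenBisimilar.res {C C' : Con CC QC K} (L : Set (CC ⊕ QC)) (h : OpenBisimilar D C C') :
    OpenBisimilar D (C.mapProc fun P => .res P L) (C'.mapProc fun P => .res P L) := by
  refine h.mapProc (g := fun P => .res P L) (fun P => rfl) (f := id) (I := fun α => Disjoint α.cn L) ?_ ?_ ?_ ?_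
  · exact fun α => Iff.rfl
  · simp [Act.cn]
  · exact fun P ρ α Δ hs hα => .res _ _ _ _ _ hs hα
  · intro P ρ α Δ hs
    cases hs with
    | res _ _ _ _ _ hs hα => exact ⟨_, _, hs, hα, rfl, rfl⟩

/-- Complementary actions. -/
inductive Act.Compl : Act CC QC → Act CC QC → Prop
  | cin (c v) : Compl (.cin c v) (.cout c v)
  | cout (c v) : Compl (.cout c v) (.cin c v)
  | qin (c r) : Compl (.qin c r) (.qout c r)
  | qout (c r) : Compl (.qout c r) (.qin c r)

theorem Act.Compl.symm {α β : Act CC QC} (h : α.Compl β) : β.Compl α := by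
  cases h <;> constructor

theorem Act.Compl.ne_tau {α β : Act CC QC} (h : α.Compl β) : α ≠ .tau := by
  cases h <;> simp

theorem Act.Compl.step {α β : Act CC QC} (h : α.Compl β) {P P' Q Q' : Proc CC QC K} {ρ : QState}
    (h1 : Step D ⟨P, ρ⟩ α (PMF.pure ⟨P', ρ⟩)) (h2 : Step D ⟨Q, ρ⟩ β (PMF.pure ⟨Q', ρ⟩)) :
    Step D ⟨.par P Q, ρ⟩ .tau (PMF.pure ⟨.par P' Q', ρ⟩) := by
  cases h
  · exact .ccom_left _ _ _ _ _ _ _ h1 h2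
  · exact .ccom_right _ _ _ _ _ _ _ h1 h2
  · exact .qcom_left _ _ _ _ _ _ _ h1 h2
  · exact .qcom_right _ _ _ _ _ _ _ h1 h2

theorem Step.par_cases {P Q : Proc CC QC K} {ρ : QState} {α : Act CC QC} {Δ : PMF (Con CC QC K)}
    (h : Step D ⟨.par P Q, ρ⟩ α Δ) :
    (∃ Δ', Step D ⟨P, ρ⟩ α Δ' ∧ Disjoint α.qbv Q.qv ∧
      Δ = Δ'.map (Con.mapProc fun P' => .par P' Q)) ∨
    (∃ Δ', Step D ⟨Q, ρ⟩ α Δ' ∧ Disjoint α.qbv P.qv ∧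
      Δ = Δ'.map (Con.mapProc fun Q' => .par P Q')) ∨
    (∃ β γ P' Q', β.Compl γ ∧ Step D ⟨P, ρ⟩ β (PMF.pure ⟨P', ρ⟩) ∧
      Step D ⟨Q, ρ⟩ γ (PMF.pure ⟨Q', ρ⟩) ∧ α = .tau ∧ Δ = PMF.pure ⟨.par P' Q', ρ⟩) := by
  cases h with
  | int_left _ _ _ _ Δ h hd => exact Or.inl ⟨Δ, h, hd, rfl⟩
  | int_right _ _ _ _ Δ h hd => exact Or.inr (Or.inl ⟨Δ, h, hd, rfl⟩)
  | ccom_left _ _ _ _ _ _ _ h1 h2 => exact Or.inr (Or.inr ⟨_, _, _, _, .cin _ _, h1, h2, rfl, rfl⟩)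
  | ccom_right _ _ _ _ _ _ _ h1 h2 => exact Or.inr (Or.inr ⟨_, _, _, _, .cout _ _, h1, h2, rfl, rfl⟩)
  | qcom_left _ _ _ _ _ _ _ h1 h2 => exact Or.inr (Or.inr ⟨_, _, _, _, .qin _ _, h1, h2, rfl, rfl⟩)
  | qcom_right _ _ _ _ _ _ _ h1 h2 => exact Or.inr (Or.inr ⟨_, _, _, _, .qout _ _, h1, h2, rfl, rfl⟩)

/-- The only qubit that changes owner is the one communicated, and legality makes the sender give it
up. -/
theorem Act.Compl.disjoint {α β : Act CC QC} (h : α.Compl β) {C C' : Con CC QC K}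
    {Δ Δ' : PMF (Con CC QC K)} (hs : Step D C α Δ) (hs' : Step D C' β Δ') (hl : D.Legal C.proc)
    (hl' : D.Legal C'.proc) (hd : Disjoint C.proc.qv C'.proc.qv) :
    ∀ X ∈ Δ.support, ∀ X' ∈ Δ'.support, Disjoint X.proc.qv X'.proc.qv := by
  intro X hX X' hX'
  have h1 := hs.qv_subset
  have h2 := hs'.qv_subset
  have h3 := (hs.preserves hl X hX).2.2
  have h4 := (hs'.preserves hl' X' hX').2.2
  have h5 := h1.2 X hX
  have h6 := h2.2 X' hX'
  cases h with
  | cin | cout =>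
    simp only [Act.qbv, Finset.union_empty] at h5 h6
    exact hd.mono h5 h6
  | qin c r =>
    have h7 := h2.1 c r rfl
    have h8 := h4 c r rfl
    simp only [Act.qbv, Finset.union_empty] at h5 h6
    rw [Finset.disjoint_left] at hd ⊢
    intro x hx hx'
    rcases Finset.mem_union.1 (h5 hx) with h | h
    · exact hd h (h6 hx')
    · rw [Finset.mem_singleton] at h; exact h8 (h ▸ hx')
  | qout c r =>
    have h7 := h1.1 c r rfl
    have h8 := h3 c r rfl
    simp only [Act.qbv, Finset.union_empty] at h5 h6
    rw [Finset.disjoint_left] at hd ⊢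
    intro x hx hx'
    rcases Finset.mem_union.1 (h6 hx') with h | h
    · exact hd (h5 hx) h
    · rw [Finset.mem_singleton] at h; exact h8 (h ▸ hx)

/-- The rules for parallel composition come in mirrored pairs. This reduces the right argument to
the left one. -/
theorem Bisim.par_comm (P Q : Proc CC QC K) : Bisim D (.par P Q) (.par Q P) := by
  intro ρ
  refine IsStable.openBisimilar_of_symm (R := fun X X' => ∃ P Q ρ, X = ⟨.par P Q, ρ⟩ ∧
    X' = ⟨.par Q P, ρ⟩) ?_ ?_ ?_ ⟨P, Q, ρ, rfl, rfl⟩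
  · rintro _ _ ⟨P, Q, ρ, rfl, rfl⟩
    exact ⟨Finset.union_comm _ _, rfl, fun A hA _ => ⟨_, _, _, rfl, rfl⟩⟩
  · rintro _ _ ⟨P, Q, ρ, rfl, rfl⟩ α Δ hs
    rcases hs.par_cases with ⟨Δ, h, hd, rfl⟩ | ⟨Δ, h, hd, rfl⟩ |
      ⟨β, γ, P', Q', hc, h1, h2, rfl, rfl⟩
    · refine ⟨_, (Step.int_right _ _ _ _ _ h hd).weak, ?_⟩
      exact (liftRel_refl (R := Eq) (fun _ => rfl) h.finite_support).map_of
        fun s _ t _ e => ⟨_, _, _, rfl, by rw [e]; rfl⟩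
    · refine ⟨_, (Step.int_left _ _ _ _ _ h hd).weak, ?_⟩
      exact (liftRel_refl (R := Eq) (fun _ => rfl) h.finite_support).map_of
        fun s _ t _ e => ⟨_, _, _, rfl, by rw [e]; rfl⟩
    · exact ⟨_, (hc.symm.step h2 h1).weak, .point ⟨_, _, _, rfl, rfl⟩⟩
  · rintro _ _ ⟨P, Q, ρ, rfl, rfl⟩
    exact ⟨Q, P, ρ, rfl, rfl⟩

/-- Configurations with the same third component running in parallel to bisimilar ones. -/
def ParRel (D : Defs CC QC K) (X X' : Con CC QC K) : Prop :=
  ∃ C C' R, OpenBisimilar D C C' ∧ (D.Legal C.proc ∧ Disjoint C.proc.qv R.qv) ∧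
    (D.Legal C'.proc ∧ Disjoint C'.proc.qv R.qv) ∧ D.Legal R ∧
    X = C.mapProc (fun P => .par P R) ∧ X' = C'.mapProc fun P => .par P R

theorem ParRel.left {C C' : Con CC QC K} {R : Proc CC QC K} (h : OpenBisimilar D C C')
    (hl : D.Legal C.proc ∧ Disjoint C.proc.qv R.qv)
    (hl' : D.Legal C'.proc ∧ Disjoint C'.proc.qv R.qv) (hR : D.Legal R) {α : Act CC QC}
    {Δ : PMF (Con CC QC K)} (hs : Step D C α Δ) (hd : Disjoint α.qbv R.qv) :
    ∃ Θ, WeakStep D α (PMF.pure (C'.mapProc fun P => .par P R)) Θ ∧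
      LiftRel (ParRel D) (Δ.map (Con.mapProc fun P => .par P R)) Θ := by
  obtain ⟨Θ, w, l⟩ := OpenBisimilar.isSim _ _ h _ _ hs
  have w' := w.map_of (f := Con.mapProc fun P => .par P R) (α' := α) Iff.rfl
    (fun C Δ hs => .int_left _ _ _ _ _ hs (by simp [Act.qbv]))
    (fun C Δ hs => .int_left _ _ _ _ _ hs hd)
  rw [PMF.pure_map] at w'
  refine ⟨_, w', l.map_of fun s hs' t ht hst => ?_⟩
  have key : ∀ {C : Con CC QC K} {β : Act CC QC} {Δ : PMF (Con CC QC K)}, Step D C β Δ →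
      Disjoint β.qbv R.qv → D.Legal C.proc ∧ Disjoint C.proc.qv R.qv →
      ∀ s ∈ Δ.support, D.Legal s.proc ∧ Disjoint s.proc.qv R.qv := fun hs hd hC s hs' =>
    ⟨(hs.preserves hC.1 s hs').1, (Finset.disjoint_union_left.2 ⟨hC.2, hd⟩).mono_left
      (hs.qv_subset.2 s hs')⟩
  refine ⟨s, t, R, hst, key hs hd hl s hs', ?_, hR, rfl, rfl⟩
  exact w.forall_support (I := fun C => D.Legal C.proc ∧ Disjoint C.proc.qv R.qv)
    (I' := fun C => D.Legal C.proc ∧ Disjoint C.proc.qv R.qv)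
    (fun C Δ hC hs => key hs (by simp [Act.qbv]) hC) (fun C Δ hC hs => key hs (by simp [Act.qbv]) hC)
    (fun C Δ hC hs => key hs hd hC) (fun _ => rfl) (by simpa using hl') t ht

/-- Here the common component moves alone. Its instrument lies outside the bisimilar components and
can also be applied on the other side; by `OpenBisimilar.outcome` the outcomes have the same
probabilities and leave bisimilar configurations behind. The answer is a single strong step. -/
theorem ParRel.right {C C' : Con CC QC K} {R : Proc CC QC K} (h : OpenBisimilar D C C')
    (hl : D.Legal C.proc ∧ Disjoint C.proc.qv R.qv)
    (hl' : D.Legal C'.proc ∧ Disjoint C'.proc.qv R.qv) (hR : D.Legal R) {α : Act CC QC}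
    {Δ : PMF (Con CC QC K)} (hs : Step D ⟨R, C.st⟩ α Δ) (hd : Disjoint α.qbv C.proc.qv) :
    ∃ Θ, WeakStep D α (PMF.pure (C'.mapProc fun P => .par P R)) Θ ∧
      LiftRel (ParRel D) (Δ.map (Con.mapProc fun R => .par C.proc R)) Θ := by
  have e1 := (OpenBisimilar.isStable _ _ h).1
  obtain ⟨ι, κ, _, _, X, R', hi, hr⟩ := hs.exists_instr
  obtain ⟨Θ, hr'⟩ := hi.exists_result C'.st
  have hs' := hi.step _ _ hr'
  have hp := hs.preserves hR
  have hq := hs.qv_subset.2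
  obtain ⟨p, ρ', hp1, rfl⟩ := hr
  obtain ⟨q, σ', hq1, rfl⟩ := hr'
  have key := h.outcome hi.isKraus (fun i j => (hi.isLocal i j).2 _ hl.2.symm) hp1 hq1
  obtain rfl : p = q := PMF.ext fun i => (key i).1
  refine ⟨_, (Step.int_right C'.proc R C'.st α _ hs' (e1 ▸ hd)).weak, ?_⟩
  rw [PMF.map_bind, PMF.map_bind]
  refine .bind (Set.toFinite _) fun i hi => ?_
  rw [PMF.pure_map, PMF.pure_map]
  have hm := (PMF.mem_support_bind_iff p (fun i => PMF.pure (⟨R' i, ρ' i⟩ : Con CC QC K)) _).2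
    ⟨i, hi, (PMF.mem_support_pure_iff _ _).2 rfl⟩
  refine .point ⟨_, _, R' i, (key i).2 hi, ⟨hl.1, ?_⟩, ⟨hl'.1, ?_⟩, (hp _ hm).1, rfl, rfl⟩
  · exact (Finset.disjoint_union_right.2 ⟨hl.2, hd.symm⟩).mono_right (hq _ hm)
  · exact (Finset.disjoint_union_right.2 ⟨hl'.2, (e1 ▸ hd).symm⟩).mono_right (hq _ hm)

/-- In the weak answer to the visible action, the component `R` waits during the first internal
steps, then joins the visible step, and stays at `R'` afterwards. Its own step is independent of the
state, so it can join in every branch. -/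
theorem ParRel.com {C C' : Con CC QC K} {R R' P' : Proc CC QC K} (h : OpenBisimilar D C C')
    (hl : D.Legal C.proc ∧ Disjoint C.proc.qv R.qv)
    (hl' : D.Legal C'.proc ∧ Disjoint C'.proc.qv R.qv) (hR : D.Legal R) {β γ : Act CC QC}
    (hc : β.Compl γ) (hs : Step D C β (PMF.pure ⟨P', C.st⟩))
    (hs' : Step D ⟨R, C.st⟩ γ (PMF.pure ⟨R', C.st⟩)) :
    ∃ Θ, WeakStep D .tau (PMF.pure (C'.mapProc fun P => .par P R)) Θ ∧
      LiftRel (ParRel D) (PMF.pure ⟨.par P' R', C.st⟩) Θ := by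
  obtain ⟨R₁, e, hR'⟩ := hs'.visible hc.symm.ne_tau
  have e' := congrArg PMF.support e
  rw [PMF.support_pure, PMF.support_pure, Set.singleton_eq_singleton_iff, Con.mk.injEq] at e'
  obtain ⟨rfl, -⟩ := e'
  obtain ⟨Θ, w, l⟩ := OpenBisimilar.isSim _ _ h _ _ hs
  have hlR : D.Legal R' := (hs'.preserves hR _ ((PMF.mem_support_pure_iff _ _).2 rfl)).1
  have hτ : ∀ (R : Proc CC QC K) {Δ Θ : PMF (Con CC QC K)}, WeakTau D Δ Θ →
      WeakTau D (Δ.map (Con.mapProc fun P => .par P R)) (Θ.map (Con.mapProc fun P => .par P R)) :=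
    fun R Δ Θ h => weakStep_tau.1 (WeakStep.map_of (f := Con.mapProc fun P => .par P R) Iff.rfl
      (fun C Δ hs => .int_left _ _ _ _ _ hs (by simp [Act.qbv]))
      (fun C Δ hs => .int_left _ _ _ _ _ hs (by simp [Act.qbv])) (weakStep_tau.2 h))
  have hm : ∀ {Δ Θ : PMF (Con CC QC K)}, Lift (HatStep D β) Δ Θ →
      Lift (HatStep D .tau) (Δ.map (Con.mapProc fun P => .par P R))
        (Θ.map (Con.mapProc fun P => .par P R')) := by
    intro Δ Θ h
    refine h.map_of fun X _ Ξ hX => .point _ _ (Or.inl ?_)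
    rcases hX with hX | ⟨e, -⟩
    · obtain ⟨Q', rfl, -⟩ := hX.visible hc.ne_tau
      rw [PMF.pure_map]
      exact hc.step hX (hR' _)
    · exact absurd e hc.ne_tau
  have w' : WeakTau D (PMF.pure (C'.mapProc fun P => .par P R))
      (Θ.map (Con.mapProc fun P => .par P R')) := by
    obtain ⟨e, -⟩ | ⟨-, Δ₁, Δ₂, w1, w2, w3⟩ := w
    · exact absurd e hc.ne_tau
    · have := hτ R w1
      rw [PMF.pure_map] at this
      exact (this.tail (hm w2)).trans (hτ R' w3)
  refine ⟨_, weakStep_tau.2 w', ?_⟩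
  have l' := l.map_of (R' := ParRel D) (f := Con.mapProc fun P => .par P R')
    (g := Con.mapProc fun P => .par P R') fun s hsm t ht hst => ?_
  · rwa [PMF.pure_map] at l'
  have key : ∀ (R : Proc CC QC K) (C : Con CC QC K) (Δ : PMF (Con CC QC K)),
      D.Legal C.proc ∧ Disjoint C.proc.qv R.qv → Step D C .tau Δ →
      ∀ s ∈ Δ.support, D.Legal s.proc ∧ Disjoint s.proc.qv R.qv := fun R C Δ hC hs s hs' =>
    ⟨(hs.preserves hC.1 s hs').1, hC.2.mono_left (by
      simpa [Act.qbv] using hs.qv_subset.2 s hs')⟩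
  have key' : ∀ (C : Con CC QC K) (Δ : PMF (Con CC QC K)),
      D.Legal C.proc ∧ Disjoint C.proc.qv R.qv → Step D C β Δ →
      ∀ s ∈ Δ.support, D.Legal s.proc ∧ Disjoint s.proc.qv R'.qv := fun C Δ hC hs s hsm =>
    ⟨(hs.preserves hC.1 s hsm).1, hc.disjoint hs hs' hC.1 hR hC.2 s hsm _
      ((PMF.mem_support_pure_iff _ _).2 rfl)⟩
  exact ⟨s, t, R', hst, key' _ _ hl hs s hsm, w.forall_support
    (I := fun C => D.Legal C.proc ∧ Disjoint C.proc.qv R.qv)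
    (I' := fun C => D.Legal C.proc ∧ Disjoint C.proc.qv R'.qv) (key R) (key R') key'
    (fun e => absurd e hc.ne_tau) (by simpa using hl') t ht, hlR, rfl, rfl⟩

theorem OpenBisimilar.par {C C' : Con CC QC K} {R : Proc CC QC K} (h : OpenBisimilar D C C')
    (hl : D.Legal (.par C.proc R)) (hl' : D.Legal (.par C'.proc R)) :
    OpenBisimilar D (C.mapProc fun P => .par P R) (C'.mapProc fun P => .par P R) := by
  refine IsStable.openBisimilar_of_symm (R := ParRel D) ?_ ?_ ?_
    ⟨C, C', R, h, ⟨hl.2.1, hl.1⟩, ⟨hl'.2.1, hl'.1⟩, hl.2.2, rfl, rfl⟩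
  · rintro _ _ ⟨C, C', R, h, hl, hl', hR, rfl, rfl⟩
    obtain ⟨e1, e2, e3⟩ := OpenBisimilar.isStable _ _ h
    refine ⟨?_, ptr_mono Finset.subset_union_left e2, fun A hA hS => ?_⟩
    · exact congrArg (· ∪ R.qv) e1
    · exact ⟨_, _, R, e3 A hA fun k => (hS k).anti Finset.subset_union_left, hl, hl', hR, rfl, rfl⟩
  · rintro _ _ ⟨C, C', R, h, hl, hl', hR, rfl, rfl⟩ α Δ hs
    rcases Step.par_cases hs with ⟨Δ, h1, hd, rfl⟩ | ⟨Δ, h1, hd, rfl⟩ |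
      ⟨β, γ, P', Q', hc, h1, h2, rfl, rfl⟩
    · exact ParRel.left h hl hl' hR h1 hd
    · exact ParRel.right h hl hl' hR h1 hd
    · exact ParRel.com h hl hl' hR hc h1 h2
  · rintro _ _ ⟨C, C', R, h, hl, hl', hR, rfl, rfl⟩
    exact ⟨C', C, R, h.symm, hl', hl, hR, rfl, rfl⟩

theorem Bisim.par_left {P Q R : Proc CC QC K} (h : Bisim D P Q) (hl : D.Legal (.par P R))
    (hl' : D.Legal (.par Q R)) : Bisim D (.par P R) (.par Q R) := fun ρ => (h ρ).par hl hl'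

theorem Bisim.par_right {P Q R : Proc CC QC K} (h : Bisim D P Q) (hl : D.Legal (.par R P))
    (hl' : D.Legal (.par R Q)) : Bisim D (.par R P) (.par R Q) :=
  (par_comm R P).trans ((h.par_left ⟨hl.1.symm, hl.2.2, hl.2.1⟩
    ⟨hl'.1.symm, hl'.2.2, hl'.2.1⟩).trans (par_comm Q R))

theorem Bisim.rel {P Q : Proc CC QC K} (h : Bisim D P Q) (f : Relabel CC QC) :
    Bisim D (.rel P f) (.rel Q f) := fun ρ => (h ρ).rel f

theorem Bisim.res {P Q : Proc CC QC K} (h : Bisim D P Q) (L : Set (CC ⊕ QC)) :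
    Bisim D (.res P L) (.res Q L) := fun ρ => (h ρ).res L

end Congruence

/-! ### Recursion: constants with bisimilar bodies -/

section Recursion
variable {I : Type*} {A B : I → K}

theorem PBisimilar.symm {P Q : Proc CC QC K} (h : PBisimilar D P Q) : PBisimilar D Q P :=
  fun ρ ν => (h ρ ν).symm

theorem PBisimilar.subst {P Q : Proc CC QC K} (h : PBisimilar D P Q) {s : CSubst}
    (hP : ∀ x ∈ P.fv, s x ≠ none) (hQ : ∀ x ∈ Q.fv, s x ≠ none) :
    Bisim D (P.subst s) (Q.subst s) := fun ρ => by
  have e : ∀ x, s x ≠ none → s x = some ((s x).getD 0) := fun x hx => by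
    cases hs : s x with
    | none => exact absurd hs hx
    | some v => rfl
  rw [Proc.subst_congr fun x hx => e x (hP x hx), Proc.subst_congr fun x hx => e x (hQ x hx)]
  exact h ρ _

/-- A constant is bisimilar to its instantiated body. -/
theorem Bisim.const {A : K} (hq : (D.body A).qv = (D.qpar A).toFinset) {qs : List QVar}
    {π : Equiv.Perm QVar} (hπ : (D.qpar A).map π = qs) (es : List CExp) :
    Bisim D (.const A qs es)
      (((D.body A).perm π).subst (CSubst.ofLists (D.cpar A) (es.map CExp.val))) := by
  refine of_step ?_ (fun ρ α Δ hs => ?_) fun ρ α Δ hs => ?_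
  -- A constant counts all its actual quantum parameters as free, so its body must use all the
  -- formal ones for the free variables to agree.
  · rw [Proc.qv_subst, Proc.qv_perm, hq, permS_toFinset, hπ]; rfl
  · cases hs with
    | const _ _ _ π' _ _ _ hπ' hs =>
      -- The transition may use another permutation than `π`. Both agree on the formal parameters
      -- and hence on the free quantum variables of the body.
      have h : AlphaEq ((D.body A).perm π') ((D.body A).perm π) := .of_perm _ fun x hx => by
        rw [hq, List.mem_toFinset] at hx
        exact List.map_inj_left.1 (hπ'.trans hπ.symm) x hx
      obtain ⟨Θ, hs', hl⟩ := hs.alphaEq (h.subst _)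
      exact ⟨Θ, hs', hl.mono fun _ _ _ _ h => h.openBisimilar⟩
  · exact ⟨Δ, .const _ _ _ π _ _ _ hπ hs, liftRel_refl (fun _ => .refl _) hs.finite_support⟩

/-- Replacement of the process variables in a configuration. -/
def instCon (C : I → K) (X : Con CC QC (K ⊕ I)) : Con CC QC K := ⟨PExp.inst C X.proc, X.st⟩

theorem PExp.inst_subst (C : I → K) (G : PExp CC QC K I) (s : CSubst) :
    (inst C G).subst s = inst C (G.subst s) := Proc.subst_mapConst _ _ _

theorem PExp.inst_perm (C : I → K) (G : PExp CC QC K I) (π : Equiv.Perm QVar) :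
    (inst C G).perm π = inst C (G.perm π) := Proc.perm_mapConst _ _ _

theorem PExp.qv_inst (C : I → K) (G : PExp CC QC K I) : (inst C G).qv = G.qv :=
  Proc.qv_mapConst _ _

theorem PExp.inst_congr {G : PExp CC QC K I} (h : G.NoVar) (A B : I → K) :
    inst A G = inst B G := by
  refine Proc.mapConst_congr fun k hk => ?_
  cases k with
  | inl k => rfl
  | inr i => exact absurd hk (h i)

theorem PExp.inst_inl (C : I → K) (P : Proc CC QC K) :
    inst C (P.mapConst Sum.inl : PExp CC QC K I) = P := by
  unfold inst
  rw [Proc.mapConst_mapConst]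
  exact Proc.mapConst_id P

theorem PExp.noVar_inl (P : Proc CC QC K) : PExp.NoVar (P.mapConst Sum.inl : PExp CC QC K I) := by
  intro i h
  rw [Proc.consts_mapConst] at h
  obtain ⟨k, -, hk⟩ := h
  exact Sum.inl_ne_inr hk

/-- The transition of `G` with the constants `A` is matched by a term that is bisimilar to `G` with
the constants `B`, up to replacing `A` by `B` in the outcome. -/
def Matches (D : Defs CC QC K) (A B : I → K) (G : PExp CC QC K I) (ρ : QState) (α : Act CC QC)
    (Δ : PMF (Con CC QC K)) : Prop :=
  ∃ Q, ∃ Γ : PMF (Con CC QC (K ⊕ I)), D.Legal Q ∧ Bisim D Q (G.inst B) ∧ Γ.support.Finite ∧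
    (∀ X ∈ Γ.support, X.proc.NoVarInSum) ∧ Δ = Γ.map (instCon A) ∧
    Step D ⟨Q, ρ⟩ α (Γ.map (instCon B))

theorem Matches.pure {G G' : PExp CC QC K I} {ρ ρ' : QState} {α : Act CC QC}
    (hl : D.Legal (G.inst B)) (hG : G'.NoVarInSum)
    (hs : Step D ⟨G.inst B, ρ⟩ α (PMF.pure ⟨G'.inst B, ρ'⟩)) :
    Matches D A B G ρ α (PMF.pure ⟨G'.inst A, ρ'⟩) :=
  ⟨_, PMF.pure ⟨G', ρ'⟩, hl, .refl _, by simp, by simpa using hG, by rw [PMF.pure_map]; rfl, by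
    rw [PMF.pure_map]; exact hs⟩

/-- Without process variables the two instances are the same term, and so are the targets, regarded
as expressions via `Sum.inl`. -/
theorem Matches.of_noVar {G : PExp CC QC K I} {ρ : QState} {α : Act CC QC}
    {Δ : PMF (Con CC QC K)} (hl : D.Legal (G.inst B)) (hG : G.NoVar)
    (hs : Step D ⟨G.inst A, ρ⟩ α Δ) : Matches D A B G ρ α Δ := by
  have e : ∀ C : I → K, (Δ.map fun X => (⟨X.proc.mapConst Sum.inl, X.st⟩ :
      Con CC QC (K ⊕ I))).map (instCon C) = Δ := fun C => by
    rw [PMF.map_comp]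
    convert PMF.map_id Δ using 2
    funext X
    simp [instCon, PExp.inst_inl]
  refine ⟨_, Δ.map fun X => ⟨X.proc.mapConst Sum.inl, X.st⟩, hl, .refl _,
    finite_support_map hs.finite_support _, ?_, (e A).symm, ?_⟩
  · intro X hX
    obtain ⟨Y, -, rfl⟩ := (PMF.mem_support_map_iff _ _ _).1 hX
    exact Proc.noVarInSum_of_noVar (PExp.noVar_inl _)
  · rw [e B, PExp.inst_congr hG B A]; exact hs

/-- This carries a match through a static context. The hypothesis `hQ` is where the congruence
property of the context enters. -/
theorem Matches.map {G G₁ : PExp CC QC K I} {ρ : QState} {α β : Act CC QC} {Δ : PMF (Con CC QC K)}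
    (h : Matches D A B G ρ α Δ) {g : Proc CC QC (K ⊕ I) → Proc CC QC (K ⊕ I)}
    {gA gB : Proc CC QC K → Proc CC QC K} (hA : ∀ P, PExp.inst A (g P) = gA (PExp.inst A P))
    (hB : ∀ P, PExp.inst B (g P) = gB (PExp.inst B P))
    (hg : ∀ P, Proc.NoVarInSum P → (g P).NoVarInSum) {g' : Proc CC QC K → Proc CC QC K}
    (hQ : ∀ Q, D.Legal Q → Bisim D Q (G.inst B) → D.Legal (g' Q) ∧ Bisim D (g' Q) (G₁.inst B))
    (hs : ∀ Q Θ, Step D ⟨Q, ρ⟩ α Θ → Step D ⟨g' Q, ρ⟩ β (Θ.map (Con.mapProc gB))) :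
    Matches D A B G₁ ρ β (Δ.map (Con.mapProc gA)) := by
  obtain ⟨Q, Γ, h1, h2, h3, h4, rfl, h5⟩ := h
  have e : ∀ {C : I → K} {gC : Proc CC QC K → Proc CC QC K},
      (∀ P, PExp.inst C (g P) = gC (PExp.inst C P)) →
      (Γ.map (instCon C)).map (Con.mapProc gC) = (Γ.map (Con.mapProc g)).map (instCon C) := by
    intro C gC hC
    rw [PMF.map_comp, PMF.map_comp]
    congr 1
    funext X
    simp only [Function.comp, instCon, Con.mapProc, hC]
  refine ⟨g' Q, Γ.map (Con.mapProc g), (hQ Q h1 h2).1, (hQ Q h1 h2).2, finite_support_map h3 _, ?_,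
    e hA, ?_⟩
  · intro X hX
    obtain ⟨Y, hY, rfl⟩ := (PMF.mem_support_map_iff _ _ _).1 hX
    exact hg _ (h4 Y hY)
  · rw [← e hB]; exact hs _ _ h5

theorem Matches.exists_pure {G : PExp CC QC K I} {ρ : QState} {α : Act CC QC} {P' : Proc CC QC K}
    (h : Matches D A B G ρ α (PMF.pure ⟨P', ρ⟩)) (hα : α ≠ .tau) :
    ∃ Q G', D.Legal Q ∧ Bisim D Q (G.inst B) ∧ Proc.NoVarInSum G' ∧ P' = PExp.inst A G' ∧
      Step D ⟨Q, ρ⟩ α (PMF.pure ⟨PExp.inst B G', ρ⟩) := by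
  obtain ⟨Q, Γ, h1, h2, -, h4, h5, h6⟩ := h
  obtain ⟨Q', e, -⟩ := h6.visible hα
  obtain ⟨X, hX⟩ := Γ.support_nonempty
  have hA := (PMF.mem_support_map_iff (instCon A) _ _).2 ⟨X, hX, rfl⟩
  have hB := (PMF.mem_support_map_iff (instCon B) _ _).2 ⟨X, hX, rfl⟩
  rw [← h5, PMF.mem_support_pure_iff] at hA
  rw [e, PMF.mem_support_pure_iff] at hB
  rw [e, ← hB] at h6
  have hst : X.st = ρ := congrArg Con.st hB
  refine ⟨Q, X.proc, h1, h2, h4 X hX, (congrArg Con.proc hA).symm, ?_⟩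
  rw [← hst] at h6 ⊢
  exact h6

theorem Matches.com {G₁ G₂ : PExp CC QC K I} {ρ : QState} {α β : Act CC QC}
    {P' Q' : Proc CC QC K} (hc : α.Compl β) (hl : D.Legal (PExp.inst B (.par G₁ G₂)))
    (h1 : Matches D A B G₁ ρ α (PMF.pure ⟨P', ρ⟩)) (h2 : Matches D A B G₂ ρ β (PMF.pure ⟨Q', ρ⟩)) :
    Matches D A B (.par G₁ G₂) ρ .tau (PMF.pure ⟨.par P' Q', ρ⟩) := by
  obtain ⟨Q₁, H₁, l1, b1, n1, rfl, s1⟩ := h1.exists_pure hc.ne_tau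
  obtain ⟨Q₂, H₂, l2, b2, n2, rfl, s2⟩ := h2.exists_pure hc.symm.ne_tau
  have hd : Disjoint (G₁.inst B).qv (G₂.inst B).qv := hl.1
  have hl1 : D.Legal (.par Q₁ Q₂) := ⟨by rw [b1.qv_eq, b2.qv_eq]; exact hd, l1, l2⟩
  have hl2 : D.Legal (.par (G₁.inst B) Q₂) := ⟨by rw [b2.qv_eq]; exact hd, hl.2.1, l2⟩
  exact ⟨.par Q₁ Q₂, PMF.pure ⟨.par H₁ H₂, ρ⟩, hl1,
    (b1.par_left hl1 hl2).trans (b2.par_right hl2 hl), by simp, by simpa using ⟨n1, n2⟩,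
    by rw [PMF.pure_map]; rfl, by rw [PMF.pure_map]; exact hc.step s1 s2⟩

/-- The constants `A` and `B` have the same parameters, the body of `A i` is the expression `E i`,
and the one of `B i` is bisimilar to `E i` with the constants `B`. -/
structure Unfolding (D : Defs CC QC K) (A B : I → K) (E : I → PExp CC QC K I) : Prop where
  qpar i : D.qpar (A i) = D.qpar (B i)
  cpar i : D.cpar (A i) = D.cpar (B i)
  body i : D.body (A i) = (E i).inst A
  bisim i : PBisimilar D ((E i).inst B) (D.body (B i))
  noVarInSum i : (E i).NoVarInSum
  qv_body i : (D.body (B i)).qv = (D.qpar (B i)).toFinset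

variable {E : I → PExp CC QC K I}

theorem Unfolding.legal (hU : Unfolding D A B E) {G : PExp CC QC K I} (h : D.Legal (G.inst A)) :
    D.Legal (G.inst B) := by
  unfold Defs.Legal PExp.inst at h ⊢
  rw [Proc.legal_mapConst] at h ⊢
  convert h using 1 <;>
  · funext k
    cases k with
    | inl k => rfl
    | inr i => simp [hU.qpar, hU.cpar]

/-- Instantiating the bisimilarity between `E i` with the constants `B` and the body of `B i` at the
actual parameters, and folding the latter into the constant. -/
theorem Unfolding.bisim_const (hU : Unfolding D A B E) {i : I} {qs : List QVar} {es : List CExp}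
    {π : Equiv.Perm QVar} (hπ : (D.qpar (A i)).map π = qs) (hl : D.Legal (.const (A i) qs es)) :
    Bisim D (PExp.inst B (((E i).perm π).subst
      (CSubst.ofLists (D.cpar (A i)) (es.map CExp.val)))) (.const (B i) qs es) := by
  refine Bisim.trans ?_ (Bisim.const (hU.qv_body i) (hU.qpar i ▸ hπ) es).symm
  rw [← PExp.inst_subst, ← PExp.inst_perm, Proc.subst_perm, Proc.subst_perm, ← hU.cpar]
  have hx : ∀ x ∈ D.cpar (A i), CSubst.ofLists (D.cpar (A i)) (es.map CExp.val) x ≠ none :=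
    fun x hx => CSubst.ofLists_eq_none (by rw [List.length_map]; exact hl.2.2.symm) hx
  refine ((hU.bisim i).subst (fun x h => hx x ?_) fun x h => hx x ?_).perm π
  · refine D.fv_body (A i) x ?_
    rw [hU.body]
    unfold PExp.inst at h ⊢
    rwa [Proc.fv_mapConst] at h ⊢
  · rw [hU.cpar]
    exact D.fv_body (B i) x h

/-- The induction is on the derivation of the transition, since unfolding a constant replaces `G` by
an expression that need not be smaller. The matching term `Q` is allowed to differ from `G.inst B`
up to bisimilarity precisely in order to absorb the difference between the bodies at each unfolding.
-/
theorem Unfolding.matches (hU : Unfolding D A B E) {C : Con CC QC K} {α : Act CC QC}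
    {Δ : PMF (Con CC QC K)} (h : Step D C α Δ) {G : PExp CC QC K I} (hC : C.proc = G.inst A)
    (hl : D.Legal (G.inst A)) (hG : G.NoVarInSum) : Matches D A B G C.st α Δ := by
  have hl' := hU.legal hl
  induction h generalizing G with
  | tau P ρ =>
    cases G <;> simp [PExp.inst, Proc.mapConst] at hC
    subst hC
    exact .pure hl' hG (.tau _ _)
  | cinp c x P ρ v =>
    cases G <;> simp [PExp.inst, Proc.mapConst] at hC
    obtain ⟨rfl, rfl, rfl⟩ := hC
    rw [Proc.subst_mapConst]
    refine .pure hl' (Proc.noVarInSum_subst.2 hG) ?_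
    rw [← PExp.inst_subst]
    exact .cinp _ _ _ _ _
  | coutp c e P ρ =>
    cases G <;> simp [PExp.inst, Proc.mapConst] at hC
    obtain ⟨rfl, rfl, rfl⟩ := hC
    exact .pure hl' hG (.coutp _ _ _ _)
  | qinp c q r P ρ hr =>
    cases G <;> simp [PExp.inst, Proc.mapConst] at hC
    obtain ⟨rfl, rfl, rfl⟩ := hC
    rw [Proc.perm_mapConst]
    refine .pure hl' (Proc.noVarInSum_perm.2 hG) ?_
    rw [← PExp.inst_perm]
    refine .qinp _ _ _ _ _ ?_
    unfold Proc.qv at hr ⊢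
    rwa [Proc.qv_mapConst] at hr ⊢
  | qoutp c q P ρ =>
    cases G <;> simp [PExp.inst, Proc.mapConst] at hC
    obtain ⟨rfl, rfl, rfl⟩ := hC
    exact .pure hl' hG (.qoutp _ _ _ _)
  | oper E q P ρ =>
    cases G <;> simp [PExp.inst, Proc.mapConst] at hC
    obtain ⟨rfl, h1, h2, rfl⟩ := hC
    obtain rfl := eq_of_heq h1
    obtain rfl := eq_of_heq h2
    exact .pure hl' hG (.oper _ _ _ _)
  | meas M q x P ρ p σ hr =>
    cases G with
    | meas M' q' x' G =>
      simp only [PExp.inst, Proc.mapConst, Proc.meas.injEq] at hC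
      obtain ⟨rfl, h1, h2, rfl, rfl⟩ := hC
      obtain rfl := eq_of_heq h1
      obtain rfl := eq_of_heq h2
      have e : ∀ C : I → K, (p.bind fun i => PMF.pure (⟨G.subst (CSubst.single x (M.value i)), σ i⟩ :
          Con CC QC (K ⊕ I))).map (instCon C) = p.bind fun i => PMF.pure
            ⟨(PExp.inst C G).subst (CSubst.single x (M.value i)), σ i⟩ := fun C => by
        rw [PMF.map_bind]
        simp only [PMF.pure_map, instCon, PExp.inst_subst]
      refine ⟨_, _, hl', .refl _, ?_, ?_, (e A).symm, ?_⟩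
      · exact finite_support_bind (Set.toFinite _) fun i _ => by simp
      · intro X hX
        obtain ⟨i, -, hi⟩ := (PMF.mem_support_bind_iff _ _ _).1 hX
        rw [PMF.mem_support_pure_iff] at hi
        subst hi
        exact Proc.noVarInSum_subst.2 hG
      · rw [e B]
        exact .meas _ _ _ _ _ _ _ hr
    | _ => simp [PExp.inst, Proc.mapConst] at hC
  | ccom_left c v P P' Q Q' ρ _ _ ih1 ih2 =>
    cases G <;> simp [PExp.inst, Proc.mapConst] at hC
    exact .com (.cin c v) hl' (ih1 hC.1 hl.2.1 hG.1 hl'.2.1) (ih2 hC.2 hl.2.2 hG.2 hl'.2.2)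
  | ccom_right c v P P' Q Q' ρ _ _ ih1 ih2 =>
    cases G <;> simp [PExp.inst, Proc.mapConst] at hC
    exact .com (.cout c v) hl' (ih1 hC.1 hl.2.1 hG.1 hl'.2.1) (ih2 hC.2 hl.2.2 hG.2 hl'.2.2)
  | qcom_left c v P P' Q Q' ρ _ _ ih1 ih2 =>
    cases G <;> simp [PExp.inst, Proc.mapConst] at hC
    exact .com (.qin c v) hl' (ih1 hC.1 hl.2.1 hG.1 hl'.2.1) (ih2 hC.2 hl.2.2 hG.2 hl'.2.2)
  | qcom_right c v P P' Q Q' ρ _ _ ih1 ih2 =>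
    cases G <;> simp [PExp.inst, Proc.mapConst] at hC
    exact .com (.qout c v) hl' (ih1 hC.1 hl.2.1 hG.1 hl'.2.1) (ih2 hC.2 hl.2.2 hG.2 hl'.2.2)
  | int_left P Q ρ α Δ _ hd ih =>
    cases G <;> simp [PExp.inst, Proc.mapConst] at hC
    case par G₁ G₂ =>
    obtain ⟨h1, rfl⟩ := hC
    refine (ih h1 hl.2.1 hG.1 hl'.2.1).map (g := fun P => .par P G₂)
      (gB := fun P => .par P (PExp.inst B G₂)) (g' := fun P => .par P (PExp.inst B G₂))
      (fun _ => rfl) (fun _ => rfl) (fun P hP => ⟨hP, hG.2⟩) (fun Q hQ hb => ?_) fun Q Θ hs => ?_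
    · have : D.Legal (.par Q (PExp.inst B G₂)) := ⟨hb.qv_eq ▸ hl'.1, hQ, hl'.2.2⟩
      exact ⟨this, hb.par_left this hl'⟩
    · refine .int_left _ _ _ _ _ hs ?_
      rw [PExp.qv_inst]
      rwa [Proc.qv_mapConst] at hd
  | int_right P Q ρ α Δ _ hd ih =>
    cases G <;> simp [PExp.inst, Proc.mapConst] at hC
    case par G₁ G₂ =>
    obtain ⟨rfl, h1⟩ := hC
    refine (ih h1 hl.2.2 hG.2 hl'.2.2).map (g := fun P => .par G₁ P)
      (gB := fun P => .par (PExp.inst B G₁) P) (g' := fun P => .par (PExp.inst B G₁) P)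
      (fun _ => rfl) (fun _ => rfl) (fun P hP => ⟨hG.1, hP⟩) (fun Q hQ hb => ?_) fun Q Θ hs => ?_
    · have : D.Legal (.par (PExp.inst B G₁) Q) := ⟨hb.qv_eq ▸ hl'.1, hl'.2.1, hQ⟩
      exact ⟨this, hb.par_right this hl'⟩
    · refine .int_right _ _ _ _ _ hs ?_
      rw [PExp.qv_inst]
      rwa [Proc.qv_mapConst] at hd
  | sum_left P Q ρ α Δ hs _ =>
    cases G <;> simp [PExp.inst, Proc.mapConst] at hC
    obtain ⟨rfl, rfl⟩ := hC
    -- A summand could not be replaced by the bisimilar term that induction would provide. As no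
    -- process variable occurs in it, nothing has to be replaced.
    exact .of_noVar hl' (fun i hi => hi.elim (hG.1 i) (hG.2 i)) (.sum_left _ _ _ _ _ hs)
  | sum_right P Q ρ α Δ hs _ =>
    cases G <;> simp [PExp.inst, Proc.mapConst] at hC
    obtain ⟨rfl, rfl⟩ := hC
    exact .of_noVar hl' (fun i hi => hi.elim (hG.1 i) (hG.2 i)) (.sum_right _ _ _ _ _ hs)
  | rel P f ρ α Δ _ ih =>
    cases G <;> simp [PExp.inst, Proc.mapConst] at hC
    obtain ⟨h1, rfl⟩ := hC
    exact (ih h1 hl hG hl').map (g := fun P => .rel P f) (gB := fun P => .rel P f)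
      (g' := fun P => .rel P f) (fun _ => rfl) (fun _ => rfl) (fun P hP => hP)
      (fun Q hQ hb => ⟨hQ, hb.rel f⟩) fun Q Θ hs => .rel _ _ _ _ _ hs
  | res P L ρ α Δ _ hd ih =>
    cases G <;> simp [PExp.inst, Proc.mapConst] at hC
    obtain ⟨h1, rfl⟩ := hC
    exact (ih h1 hl hG hl').map (g := fun P => .res P L) (gB := fun P => .res P L)
      (g' := fun P => .res P L) (fun _ => rfl) (fun _ => rfl) (fun P hP => hP)
      (fun Q hQ hb => ⟨hQ, hb.res L⟩) fun Q Θ hs => .res _ _ _ _ _ hs hd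
  | ite b P ρ α Δ _ hb ih =>
    cases G <;> simp [PExp.inst, Proc.mapConst] at hC
    obtain ⟨rfl, h1⟩ := hC
    obtain ⟨Q, Γ, h1, h2, h3, h4, h5, h6⟩ := ih h1 hl hG hl'
    exact ⟨.ite b Q, Γ, h1, h2.ite b, h3, h4, h5, .ite _ _ _ _ _ h6 hb⟩
  | const k qs es π ρ α Δ hπ hs ih =>
    cases G with
    | const k' qs' es' =>
      cases k' with
      | inl k' =>
        refine .of_noVar hl' (fun i hi => Sum.inr_ne_inl hi) ?_
        rw [← hC]
        exact .const _ _ _ π _ _ _ hπ hs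
      | inr i =>
        have hC' : Proc.const k qs es = .const (A i) qs' es' := hC
        simp only [Proc.const.injEq] at hC'
        obtain ⟨rfl, rfl, rfl⟩ := hC'
        have e : ((D.body (A i)).perm π).subst (CSubst.ofLists (D.cpar (A i)) (es.map CExp.val)) =
            PExp.inst A (((E i).perm π).subst
              (CSubst.ofLists (D.cpar (A i)) (es.map CExp.val))) := by
          rw [hU.body, PExp.inst_perm, PExp.inst_subst]
        have hl₁ := e ▸ legal_body (D := D) (A i) π
          (CSubst.ofLists (D.cpar (A i)) (es.map CExp.val))
        -- The body of `A i` is itself an instance with the constants `A`, so the induction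
        -- hypothesis applies to the unfolded expression. The term `Q` obtained is bisimilar to `E
        -- i` with the constants `B`, hence to the constant `B i`.
        obtain ⟨Q, Γ, h1, h2, h3⟩ := ih e hl₁
          (Proc.noVarInSum_subst.2 (Proc.noVarInSum_perm.2 (hU.noVarInSum i))) (hU.legal hl₁)
        exact ⟨Q, Γ, h1, h2.trans (hU.bisim_const hπ hl), h3⟩
    | _ => simp [PExp.inst, Proc.mapConst] at hC

/-- The relation between instances of one expression with the constants `A` and `B`. -/
def InstRel (D : Defs CC QC K) (A B : I → K) (X X' : Con CC QC K) : Prop :=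
  ∃ G : PExp CC QC K I, ∃ ρ, D.Legal (G.inst A) ∧ G.NoVarInSum ∧ X = ⟨G.inst A, ρ⟩ ∧
    OpenBisimilar D ⟨G.inst B, ρ⟩ X'

/-- The step is matched by a strong step of a term `Q` that is bisimilar to `G.inst B`, hence to
`X'`, whose weak answer is taken. Since the first match is strong and the relation absorbs
bisimilarity on the right, no up-to argument for weak transitions is needed. -/
theorem Unfolding.isSim (hU : Unfolding D A B E) : IsSim D (InstRel D A B) := by
  rintro _ X' ⟨G, ρ, hl, hG, rfl, hb⟩ α Δ hs
  have hp := hs.preserves hl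
  obtain ⟨Q, Γ, h1, h2, h3, h4, rfl, h5⟩ := hU.matches hs rfl hl hG
  obtain ⟨Θ, w, l⟩ := OpenBisimilar.isSim _ _ ((h2 ρ).trans hb) _ _ h5
  refine ⟨Θ, w, ?_⟩
  have hA : ∀ X ∈ Γ.support, D.Legal (PExp.inst A X.proc) := fun X hX =>
    (hp _ ((PMF.mem_support_map_iff _ _ _).2 ⟨X, hX, rfl⟩)).1
  have hlift : LiftRel (fun s t => ∃ G : PExp CC QC K I, ∃ ρ, D.Legal (G.inst A) ∧ G.NoVarInSum ∧
      s = ⟨G.inst A, ρ⟩ ∧ t = ⟨G.inst B, ρ⟩) (Γ.map (instCon A)) (Γ.map (instCon B)) :=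
    (liftRel_refl (R := Eq) (fun _ => rfl) h3).map_of fun X hX Y _ e =>
      ⟨X.proc, X.st, hA X hX, h4 X hX, rfl, by rw [← e]; rfl⟩
  refine hlift.trans (fun s t u hst htu => ?_) l
  obtain ⟨G, ρ, h1, h2, rfl, rfl⟩ := hst
  exact ⟨G, ρ, h1, h2, rfl, htu⟩

/-- Absorbing bisimilarity on the left as well gives the relation the same shape as its converse,
with `A` and `B` exchanged. -/
theorem Unfolding.isSim_comp (hU : Unfolding D A B E) :
    IsSim D fun X X' => ∃ Y, OpenBisimilar D X Y ∧ InstRel D A B Y X' := by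
  rintro X X' ⟨Y, h, h'⟩ α Δ hs
  obtain ⟨Θ, w, l⟩ := OpenBisimilar.isSim _ _ h α Δ hs
  obtain ⟨Ξ, w', l'⟩ := hU.isSim.weakStep (.point h') w
  exact ⟨Ξ, w', l.trans (fun s t u h h' => ⟨t, h, h'⟩) l'⟩

theorem Unfolding.openBisimilar {F : I → PExp CC QC K I} (hU : Unfolding D A B E)
    (hU' : Unfolding D B A F) {G : PExp CC QC K I} (hl : D.Legal (G.inst A))
    (hG : G.NoVarInSum) : Bisim D (G.inst A) (G.inst B) := by
  intro ρ
  refine IsStable.openBisimilar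
    (R := fun X X' => ∃ Y, OpenBisimilar D X Y ∧ InstRel D A B Y X') ?_ hU.isSim_comp ?_
    ⟨_, .refl _, G, ρ, hl, hG, rfl, .refl _⟩
  · rintro X X' ⟨_, h, G, ρ, hl, hG, rfl, h'⟩
    obtain ⟨e1, e2, e3⟩ := OpenBisimilar.isStable _ _ h
    obtain ⟨e1', e2', e3'⟩ := OpenBisimilar.isStable _ _ h'
    have e : (G.inst A).qv = (G.inst B).qv := by rw [PExp.qv_inst, PExp.qv_inst]
    refine ⟨e1.trans (e.trans e1'), e2.trans ((ptr_congr_set (e1.trans e)).2 e2'),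
      fun K hK hS => ?_⟩
    exact ⟨_, e3 K hK hS, G, _, hl, hG, rfl, e3' K hK (e1.trans e ▸ hS)⟩
  · convert hU'.isSim_comp using 1
    funext X' X
    refine propext ⟨?_, ?_⟩
    · rintro ⟨_, h, G, ρ, hl, hG, rfl, h'⟩
      exact ⟨_, h'.symm, G, ρ, hU.legal hl, hG, rfl, h.symm⟩
    · rintro ⟨_, h, G, ρ, hl, hG, rfl, h'⟩
      exact ⟨_, h'.symm, G, ρ, hU'.legal hl, hG, rfl, h.symm⟩

end Recursion

/-! ### The exception: summation -/

section Summation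

/-- The term with the prefix first spends its internal step in order to answer; its own internal
step is answered by doing nothing. -/
theorem Bisim.self_tau (P : Proc CC QC K) : Bisim D P (.tau P) := by
  intro ρ
  refine IsStable.openBisimilar
    (R := fun X X' => OpenBisimilar D X X' ∨ ∃ ρ, X = ⟨P, ρ⟩ ∧ X' = ⟨.tau P, ρ⟩) ?_ ?_ ?_
    (Or.inr ⟨ρ, rfl, rfl⟩)
  · rintro X X' (h | ⟨ρ, rfl, rfl⟩)
    · obtain ⟨e1, e2, e3⟩ := OpenBisimilar.isStable _ _ h
      exact ⟨e1, e2, fun A hA hS => Or.inl (e3 A hA hS)⟩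
    · exact ⟨rfl, rfl, fun A hA _ => Or.inr ⟨_, rfl, rfl⟩⟩
  · rintro X X' (h | ⟨ρ, rfl, rfl⟩) α Δ hs
    · obtain ⟨Θ, w, l⟩ := OpenBisimilar.isSim _ _ h α Δ hs
      exact ⟨Θ, w, l.mono fun _ _ _ _ h => Or.inl h⟩
    · exact ⟨Δ, hs.weak.trans_left (weakStep_tau.1 (Step.tau P ρ).weak),
        (liftRel_refl OpenBisimilar.refl hs.finite_support).mono fun _ _ _ _ h => Or.inl h⟩
  · rintro X' X (h | ⟨ρ, rfl, rfl⟩) α Δ hs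
    · obtain ⟨Θ, w, l⟩ := OpenBisimilar.isSim _ _ h.symm α Δ hs
      exact ⟨Θ, w, l.mono fun _ _ _ _ h => Or.inl h.symm⟩
    · cases hs
      exact ⟨_, weakStep_tau.2 .refl, .point (Or.inl (.refl _))⟩

/-- The unitary matrix that exchanges `|0⟩` and `|1⟩`. -/
def notMatrix : Matrix (Finset (Fin 1)) (Finset (Fin 1)) ℂ :=
  Matrix.of fun a b => if a = bᶜ then 1 else 0

/-- The unitary operation that exchanges `|0⟩` and `|1⟩`. -/
def notGate : SuperOp 1 where
  num := 1
  kraus _ := notMatrix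
  sum_eq_one := by
    ext a b
    rw [Matrix.sum_apply, Fin.sum_univ_one, Matrix.mul_apply, Finset.sum_eq_single aᶜ]
    · simp [notMatrix, Matrix.one_apply]
    · intro c _ hc
      simp [notMatrix, hc]
    · simp

theorem onVars_notMatrix (q : Fin 1 ↪ QVar) :
    onVars q notMatrix (basis ∅) = basis (Finset.univ.map q) := by
  rw [onVars_eq, _root_.sum_apply, Finset.sum_eq_single Finset.univ, _root_.sum_apply,
    Finset.sum_eq_single ∅]
  · rw [_root_.smul_apply, unit_basis (map_subset_univ_map q _) (map_subset_univ_map q _)]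
    simp [notMatrix]
  · intro b _ hb
    rw [_root_.smul_apply, unit_basis (map_subset_univ_map q _) (map_subset_univ_map q _), if_neg,
      smul_zero]
    simpa using hb
  · simp
  · intro a _ ha
    rw [_root_.sum_apply]
    refine Finset.sum_eq_zero fun b _ => ?_
    rw [_root_.smul_apply, unit_basis (map_subset_univ_map q _) (map_subset_univ_map q _)]
    by_cases hb : b = ∅
    · subst hb
      rw [notMatrix, Matrix.of_apply, if_neg (by rwa [Finset.compl_empty]), zero_smul]
    · rw [if_neg, smul_zero]
      simpa using hb
  · simp

/-- Nothing is traced out, and the diagonal matrix element at the state with all qubits `|0⟩` drops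
from `1` to `0`. -/
theorem ptr_notGate_ne (q : Fin 1 ↪ QVar) :
    ptr ∅ groundState.op ≠ ptr ∅ (notGate.app q groundState).op := by
  intro h
  have h1 := ptr_eq_iff.1 h ∅ ∅ (by simp) (by simp)
  have e : (notGate.app q groundState).op = onVars q notMatrix ∘L groundState.op ∘L
      (onVars q notMatrix).adjoint :=
    ((IsKraus.onVars q notGate.sum_eq_one).hasSum_apply groundState).unique
      (hasSum_unique (α := Env →L[ℂ] Env) (β := Fin 1) _)
  have h2 : ⟪basis ∅, (onVars q notMatrix).adjoint (basis ∅)⟫_ℂ = 0 := by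
    rw [ContinuousLinearMap.adjoint_inner_right, onVars_notMatrix,
      orthonormal_iff_ite.1 basis_orthonormal, if_neg (by simp)]
  simp only [Finset.powerset_empty, Finset.sum_singleton, Finset.union_empty, e,
    ContinuousLinearMap.comp_apply] at h1
  simp only [groundState, ContinuousLinearMap.smulRight_apply, innerSL_apply_apply, h2, zero_smul,
    map_zero, inner_zero_right, orthonormal_iff_ite.1 basis_orthonormal, if_true, one_smul] at h1
  exact one_ne_zero h1

theorem Step.nil_false {ρ : QState} {α : Act CC QC} {Δ : PMF (Con CC QC K)}
    (h : Step D ⟨.nil, ρ⟩ α Δ) : False := by cases h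

/-- Open bisimilarity is not preserved by summation. -/
theorem not_bisim_sum (D : Defs CC QC K) (q : Fin 1 ↪ QVar) :
    ¬ Bisim D (.sum .nil (.oper notGate q .nil)) (.sum (.tau .nil) (.oper notGate q .nil)) := by
  intro h
  obtain ⟨ρ, hρ⟩ : ∃ ρ, ρ = groundState := ⟨_, rfl⟩
  have hstep : Step D ⟨.sum (.tau .nil) (.oper notGate q .nil), ρ⟩ .tau (PMF.pure ⟨.nil, ρ⟩) :=
    .sum_left _ _ _ _ _ (.tau _ _)
  obtain ⟨Θ, w, l⟩ := OpenBisimilar.isSim _ _ (h ρ).symm _ _ hstep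
  have hI : ∀ C Δ, C = ⟨.sum .nil (.oper notGate q .nil), ρ⟩ ∨ C = ⟨.nil, notGate.app q ρ⟩ →
      Step D C .tau Δ → ∀ C' ∈ Δ.support,
        C' = ⟨.sum .nil (.oper notGate q .nil), ρ⟩ ∨ C' = ⟨.nil, notGate.app q ρ⟩ := by
    rintro C Δ (rfl | rfl) hs C' hC'
    · cases hs with
      | sum_left _ _ _ _ _ hs => exact hs.nil_false.elim
      | sum_right _ _ _ _ _ hs =>
        cases hs
        exact Or.inr ((PMF.mem_support_pure_iff _ _).1 hC')
    · exact hs.nil_false.elim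
  have hΘ := w.forall_support hI hI hI (fun _ => rfl) (by simp)
  obtain ⟨C, hC, hb⟩ := l.exists_right _ ((PMF.mem_support_pure_iff _ _).2 rfl)
  obtain ⟨e1, e2, -⟩ := OpenBisimilar.isStable _ _ hb
  -- If it has waited, it still owns the qubit and `nil` does not; if it has applied the gate, the
  -- states differ.
  rcases hΘ C hC with rfl | rfl
  · simp [Proc.qv] at e1
  · subst hρ
    exact ptr_notGate_ne q e2

end Summation

/-! ### Terms with free classical variables, and the theorem -/

theorem Bisim.pBisimilar {P Q : Proc CC QC K}
    (h : ∀ ν : CVar → ℝ, Bisim D (P.subst fun x => some (ν x)) (Q.subst fun x => some (ν x))) :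
    PBisimilar D P Q := fun ρ ν => h ν ρ

theorem PBisimilar.bisim {P Q : Proc CC QC K} (h : PBisimilar D P Q) (ν : CVar → ℝ) :
    Bisim D (P.subst fun x => some (ν x)) (Q.subst fun x => some (ν x)) := fun ρ => h ρ ν

/-- Under a binder for `x` the valuation skips `x`, which is filled in by the value received or
measured. Together they again assign a value to every variable. -/
theorem PBisimilar.bisim_erase {P Q : Proc CC QC K} (h : PBisimilar D P Q) (ν : CVar → ℝ)
    (x : CVar) (v : ℝ) :
    Bisim D ((P.subst (CSubst.erase (fun x => some (ν x)) x)).subst (CSubst.single x v))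
      ((Q.subst (CSubst.erase (fun x => some (ν x)) x)).subst (CSubst.single x v)) := by
  rw [Proc.subst_subst, Proc.subst_subst]
  have hs : ∀ y, CSubst.seq (CSubst.erase (fun x => some (ν x)) x) (CSubst.single x v) y ≠ none := by
    intro y
    unfold CSubst.seq CSubst.erase CSubst.single
    split_ifs <;> simp
  exact h.subst (fun y _ => hs y) fun y _ => hs y

theorem PBisimilar.qv_eq {P Q : Proc CC QC K} (h : PBisimilar D P Q) : P.qv = Q.qv := by
  have := (h.bisim fun _ => 0).qv_eq
  rwa [Proc.qv_subst, Proc.qv_subst] at this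

end
end QCCS

open QCCS in
theorem mainTheorem4 {CC QC K : Type*} (D : Defs CC QC K) :
    -- all constructors on processes, except summation
    (∀ P Q : Proc CC QC K, D.Legal P → D.Legal Q → PBisimilar D P Q →
      PBisimilar D (.tau P) (.tau Q) ∧
      (∀ (c : CC) (x : CVar), PBisimilar D (.cin c x P) (.cin c x Q)) ∧
      (∀ (c : CC) (e : CExp), PBisimilar D (.cout c e P) (.cout c e Q)) ∧
      (∀ (c : QC) (q : QVar), PBisimilar D (.qin c q P) (.qin c q Q)) ∧
      (∀ (c : QC) (q : QVar), D.Legal (.qout c q P) → D.Legal (.qout c q Q) →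
        PBisimilar D (.qout c q P) (.qout c q Q)) ∧
      (∀ (n : ℕ) (E : SuperOp n) (q : Fin n ↪ QVar),
        PBisimilar D (.oper E q P) (.oper E q Q)) ∧
      (∀ (n : ℕ) (M : Meas n) (q : Fin n ↪ QVar) (x : CVar),
        PBisimilar D (.meas M q x P) (.meas M q x Q)) ∧
      (∀ R : Proc CC QC K, D.Legal (.par P R) → D.Legal (.par Q R) →
        PBisimilar D (.par P R) (.par Q R)) ∧
      (∀ R : Proc CC QC K, D.Legal (.par R P) → D.Legal (.par R Q) →
        PBisimilar D (.par R P) (.par R Q)) ∧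
      (∀ f : Relabel CC QC, PBisimilar D (.rel P f) (.rel Q f)) ∧
      (∀ L : Set (CC ⊕ QC), PBisimilar D (.res P L) (.res Q L)) ∧
      (∀ b : BExp, PBisimilar D (.ite b P) (.ite b Q))) ∧
    -- recursion
    (∀ (I : Type*) (A B : I → K) (E F : I → PExp CC QC K I),
      (∀ i, D.qpar (A i) = D.qpar (B i) ∧ D.cpar (A i) = D.cpar (B i)) →
      (∀ i, D.body (A i) = (E i).inst A) →
      (∀ i, D.body (B i) = (F i).inst B) →
      (∀ i, (E i).NoVarInSum ∧ (F i).NoVarInSum) →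
      (∀ i, (E i).qv = (D.qpar (A i)).toFinset) →
      (∀ C : I → K,
        (∀ i, (D.qpar (C i)).length = (D.qpar (A i)).length ∧
          (D.cpar (C i)).length = (D.cpar (A i)).length) →
        ∀ i, PBisimilar D ((E i).inst C) ((F i).inst C)) →
      ∀ (i : I) (qs : List QVar) (es : List CExp),
        D.Legal (.const (A i) qs es) → D.Legal (.const (B i) qs es) →
        PBisimilar D (.const (A i) qs es) (.const (B i) qs es)) ∧
    -- summation is really an exception
    (∃ P Q R : Proc CC QC K, D.Legal P ∧ D.Legal Q ∧ D.Legal R ∧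
      PBisimilar D P Q ∧ ¬ PBisimilar D (.sum P R) (.sum Q R)) := by
  refine ⟨fun P Q hP hQ h => ⟨?_, ?_, ?_, ?_, ?_, ?_, ?_, ?_, ?_, ?_, ?_, ?_⟩, ?_, ?_⟩
  · exact Bisim.pBisimilar fun ν => (h.bisim ν).tau
  · exact fun c x => Bisim.pBisimilar fun ν => Bisim.cin c (h.bisim_erase ν x)
  · exact fun c e => Bisim.pBisimilar fun ν => (h.bisim ν).cout c _
  · exact fun c q => Bisim.pBisimilar fun ν => (h.bisim ν).qin c q
  · exact fun c q _ _ => Bisim.pBisimilar fun ν => (h.bisim ν).qout c q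
  · exact fun n E q => Bisim.pBisimilar fun ν => (h.bisim ν).oper E q
  · exact fun n M q x => Bisim.pBisimilar fun ν => Bisim.meas M q (h.bisim_erase ν x)
  · exact fun R h1 h2 => Bisim.pBisimilar fun ν =>
      (h.bisim ν).par_left (Proc.legal_subst (P := .par P R).2 h1)
        (Proc.legal_subst (P := .par Q R).2 h2)
  · exact fun R h1 h2 => Bisim.pBisimilar fun ν =>
      (h.bisim ν).par_right (Proc.legal_subst (P := .par R P).2 h1)
        (Proc.legal_subst (P := .par R Q).2 h2)
  · exact fun f => Bisim.pBisimilar fun ν => (h.bisim ν).rel f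
  · exact fun L => Bisim.pBisimilar fun ν => (h.bisim ν).res L
  · exact fun b => Bisim.pBisimilar fun ν => (h.bisim ν).ite _
  · intro I A B E F hpar hA hB hsum hqv hEF i qs es hlA _
    -- The hypothesis on all families of constants is used only for the families `A` and `B`.
    have hAA := hEF A fun i => ⟨rfl, rfl⟩
    have hBB := hEF B fun i => by rw [(hpar i).1, (hpar i).2]; exact ⟨rfl, rfl⟩
    -- The condition on the quantum variables is assumed for `E i` only; it passes to `F i` because
    -- bisimilar terms have the same free quantum variables.
    have hqF : ∀ i, (F i).qv = (D.qpar (A i)).toFinset := fun i => by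
      rw [← hqv, ← PExp.qv_inst A (E i), (hAA i).qv_eq, PExp.qv_inst]
    have hU : Unfolding D A B E :=
      { qpar := fun i => (hpar i).1
        cpar := fun i => (hpar i).2
        body := hA
        bisim := fun i => hB i ▸ hBB i
        noVarInSum := fun i => (hsum i).1
        qv_body := fun i => by rw [hB, PExp.qv_inst, hqF, (hpar i).1] }
    have hU' : Unfolding D B A F :=
      { qpar := fun i => (hpar i).1.symm
        cpar := fun i => (hpar i).2.symm
        body := hB
        bisim := fun i => hA i ▸ (hAA i).symm
        noVarInSum := fun i => (hsum i).2
        qv_body := fun i => by rw [hA, PExp.qv_inst, hqv] }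
    refine Bisim.pBisimilar fun ν => ?_
    -- The two constants are the instances of a single process variable applied to the parameters.
    exact hU.openBisimilar hU' (G := .const (Sum.inr i) qs (es.map (CExp.subst _)))
      (Proc.legal_subst (P := .const (A i) qs es).2 hlA) trivial
  · refine ⟨.nil, .tau .nil, .oper notGate ⟨fun _ => 0, fun _ _ _ => Subsingleton.elim _ _⟩ .nil,
      trivial, trivial, trivial, Bisim.pBisimilar fun ν => Bisim.self_tau _, fun h => ?_⟩
    exact not_bisim_sum D _ (h.bisim fun _ => 0)
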